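/- **Setting.** Let $N,n\ge 1$, $\omega=e^{2\pi i/N}$, $\epsilon=(-1)^N$. Let $\mathcal V_k$ be $N$-dimensional with basis $|\gamma\rangle_k$, $\gamma\in\mathbb Z_N=\mathbb Z/N\mathbb Z$, let $\mathcal V^{(m)}=\mathcal V_1\otimes\cdots\otimes\mathcal V_m$, and let $\mathbf u_k|\gamma\rangle_k=\omega^\gamma|\gamma\rangle_k$, $\mathbf v_k|\gamma\rangle_k=|\gamma+1\rangle_k$ (acting trivially in the other factors). For complex parameters $\kappa_k,a_k,b_k,c_k,d_k$ ($1\le k\le n$), $a_0,c_{n+1}$ and boundary spins $\gamma_0,\gamma_{n+1}\in\mathbb Z_N$ put $$L_k(\lambda)=\begin{pmatrix}1+\lambda\kappa_k\mathbf v_k&\lambda\mathbf u_k^{-1}(a_k-b_k\mathbf v_k)\\ \mathbf u_k(c_k-d_k\mathbf v_k)&\lambda a_kc_k+\mathbf v_kb_kd_k/\kappa_k\end{pmatrix}\ (1\le k\le n),\qquad L_{n+1}(\lambda)=\begin{pmatrix}1&\lambda\mathbf u_{n+1}^{-1}a_0\omega^{\gamma_{n+1}-\gamma_0}\\ \mathbf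 u_{n+1}c_{n+1}&\lambda a_0c_{n+1}\omega^{\gamma_{n+1}-\gamma_0}\end{pmatrix},$$ $$L_1(\lambda)\cdots L_{n+1}(\lambda)=\begin{pmatrix}A_{n+1}(\lambda)&B_{n+1}(\lambda)\\ C_{n+1}(\lambda)&D_{n+1}(\lambda)\end{pmatrix}.$$ These operators preserve the subspace of $\mathcal V^{(n+1)}$ with fixed spin $\gamma_{n+1}$ at site $n+1$, which is identified with $\mathcal V^{(n)}$ by $f\mapsto f\otimes|\gamma_{n+1}\rangle$; below they act on it. **Amplitudes.** Put $$\mathcal L_k(\Lambda)=\begin{pmatrix}1-\epsilon\kappa_k^N\Lambda&-\epsilon\Lambda(a_k^N-b_k^N)\\ c_k^N-d_k^N&b_k^Nd_k^N/\kappa_k^N-\epsilon\Lambda a_k^Nc_k^N\end{pmatrix}\ (1\le k\le n),\qquad \mathcal L_{n+1}(\Lambda)=\begin{pmatrix}1&-\epsilon\Lambda a_0^N\\ c_{n+1}^N&-\epsilon\Lambda a_0^Nc_{n+1}^N\end{pmatrix},$$ $\mathcal T_m=\mathcal L_1\cdots\mathcal L_m$, and let $\mathcal B_m$ be the upper right entry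 of $\mathcal T_m$. Fix numbers $r_k$ with $r_k^N=a_k^N-b_k^N$ ($1\le k\le n$), $r_{n+1}=a_0$, and $r_{m,s}$ ($1\le m\le n+1$, $0\le s\le m-1$) with $r_{1,0}=r_1$ and $$\mathcal B_m(\Lambda)=(-\epsilon)^m\Lambda\, r_{m,0}^N\prod_{s=1}^{m-1}(\Lambda-\epsilon r_{m,s}^N).$$ Write $\tilde r_m=r_{m,0}r_{m,1}\cdots r_{m,m-1}$, and choose the phase of $r_{n+1,0}$ so that $\tilde r_{n+1}=\omega a_0$. **Fermat curve points.** For $p=(x,y)$ with $x^N+y^N=1$ let $w_p$ be the function on $\mathbb Z_N$ with $w_p(0)=1$, $w_p(\gamma)/w_p(\gamma-1)=y/(1-\omega^\gamma x)$. Points on this curve, with coordinates denoted by $x,y$ with the same indices and tilde, are defined by $x_k=r_k/a_k$, $y_k=b_k/a_k$ ($1\le k\le n$); $x_{m,0}=r_{m-1,0}a_mc_m/r_{m,0}$, $y_{m,0}=\kappa_1\cdots\kappa_{m-1}r_m/r_{m,0}$ and $\tilde x_m=r_m/\tilde r_m$, $\tilde y_m=b_md_m\tilde r_{m-1}/(\kappa_m\tilde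 r_m)$ ($2\le m\le n$); $x_{n+1,0}=r_{n,0}a_0c_{n+1}/r_{n+1,0}$, $y_{n+1,0}=\kappa_1\cdots\kappa_na_0/r_{n+1,0}$. For $s,s'\ge1$ the points $p_{m,s}$, $\tilde p_{m,s}$ ($2\le m\le n$), $p^{m,s}_{m,s'}$ ($2\le m\le n$, $s\ne s'$) and $p^{m+1,s}_{m,s'}$ ($2\le m\le n$) have $$x_{m,s}=a_m\kappa_mr_{m,s}/b_m,\qquad \tilde x_{m,s}=d_m/(\kappa_mc_mr_{m,s}),\qquad x^{m,s}_{m',s'}=r_{m,s}/r_{m',s'},$$ and $y$-coordinates that put them on the Fermat curve and satisfy, for $3\le m\le n+1$ and $1\le l\le m-2$, $$\frac{\tilde r_{m-1}r_{m,0}r_{m-1}}{\tilde r_{m-2}r_{m-1,0}r_mb_{m-1}c_{m-1}y_{m-1,l}\tilde y_{m-1,l}}\ \prod_{1\le s\le m-2,\ s\ne l}\frac{y^{m-1,l}_{m-1,s}}{y^{m-1,s}_{m-1,l}}\ \cdot\ \frac{\prod_{k=1}^{m-1}y^{m,k}_{m-1,l}}{\prod_{s=1}^{m-3}y^{m-1,l}_{m-2,s}}=1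 .$$ **Genericity.** Assume $a_0\neq0$; $\kappa_k,a_k,b_k,r_k\ne0$ for $1\le k\le n$; $c_k,d_k\neq0$ for $2\le k\le n$; and, for $2\le m\le n$, that $\mathcal B_m(\Lambda)/\Lambda$ has degree $m-1$ with nonzero simple zeros and $\det\mathcal T_n(\epsilon r_{m,s}^N)\ne0$ for $1\le s\le m-1$. **Vectors.** For $\boldsymbol\rho_m=(\rho_{m,0},\dots,\rho_{m,m-1})\in\mathbb Z_N^m$ let $\tilde\rho_m=\sum_{s=0}^{m-1}\rho_{m,s}$. Put $\psi^{(k)}_\rho=\sum_\gamma w_{p_k}(\gamma-\rho)|\gamma\rangle_k$ and $$K_m(\boldsymbol\rho_m|\boldsymbol\rho_{m+1})=\frac{\prod_{l=1}^{m-1}\prod_{k=1}^{m}w_{p^{m+1,k}_{m,l}}(\rho_{m,l}-\rho_{m+1,k})}{\prod_{1\le j,l\le m-1,\ j\ne l}w_{p^{m,l}_{m,j}}(\rho_{m,j}-\rho_{m,l})}\ \prod_{l=1}^{m-1}\frac{w_{p_{m,l}}(-\rho_{m,l})}{w_{\tilde p_{m,l}}(\rho_{m,l})},$$ which does not involve $\rho_{m+1,0}$.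 Let $\Psi_{\boldsymbol\rho_1}=\psi^{(1)}_{\rho_{1,0}}$ and, for $2\le m\le n$, $$\Psi_{\boldsymbol\rho_m}=\sum_{\boldsymbol\rho_{m-1}\in\mathbb Z_N^{m-1}}\ \sum_{\rho\in\mathbb Z_N}\frac{\omega^{(\tilde\rho_m-\tilde\rho_{m-1})(\rho-\rho_{m,0})}}{w_{p_{m,0}}(\rho_{m,0}-\rho_{m-1,0}-1)\,w_{\tilde p_m}(\tilde\rho_m-\rho-1)}K_{m-1}(\boldsymbol\rho_{m-1}|\boldsymbol\rho_m)\,\Psi_{\boldsymbol\rho_{m-1}}\otimes\psi^{(m)}_{\rho}.$$ For $\boldsymbol\rho'_{n+1}=(\rho_{n+1,1},\dots,\rho_{n+1,n})\in\mathbb Z_N^n$ let $\tilde\rho'_{n+1}=\sum_{k=1}^n\rho_{n+1,k}$, $\rho_{n+1,0}=\gamma_0+1-\tilde\rho'_{n+1}$, and let $\boldsymbol\rho'^{-k}_{n+1}$ be $\boldsymbol\rho'_{n+1}$ with $\rho_{n+1,k}$ replaced by $\rho_{n+1,k}-1$. **Theorem.** Under these assumptions, for every $\boldsymbol\rho'_{n+1}\in\mathbb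 Z_N^n$ the vector $$\Psi^{\rm B}_{\boldsymbol\rho'_{n+1}}=\sum_{\boldsymbol\rho_n\in\mathbb Z_N^n}Q^{\rm B}(\boldsymbol\rho_n|\boldsymbol\rho'_{n+1})\Psi_{\boldsymbol\rho_n},\qquad Q^{\rm B}(\boldsymbol\rho_n|\boldsymbol\rho'_{n+1})=\frac{\omega^{(\gamma_0+1-\tilde\rho_n)(\tilde\rho'_{n+1}-1)}}{w_{p_{n+1,0}}(\gamma_{n+1}-\tilde\rho'_{n+1}-\rho_{n,0})}K_n(\boldsymbol\rho_n|\boldsymbol\rho_{n+1}),$$ is nonzero and is an eigenvector of $B_{n+1}(\lambda)$ for every $\lambda\in\mathbb C$: $$B_{n+1}(\lambda)\Psi^{\rm B}_{\boldsymbol\rho'_{n+1}}=\lambda\,r_{n+1,0}\,\omega^{-\rho_{n+1,0}}\prod_{k=1}^n\bigl(\lambda+r_{n+1,k}\omega^{-\rho_{n+1,k}}\bigr)\Psi^{\rm B}_{\boldsymbol\rho'_{n+1}}.$$ At the zeros $\lambda_{n+1,k}=-r_{n+1,k}\omega^{-\rho_{n+1,k}}$, $k=1,\dots,n$, $$A_{n+1}(\lambda_{n+1,k})\Psi^{\rm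 B}_{\boldsymbol\rho'_{n+1}}=0,\qquad D_{n+1}(\lambda_{n+1,k})\Psi^{\rm B}_{\boldsymbol\rho'_{n+1}}=\tilde\varphi_k(\boldsymbol\rho'_{n+1})\,\Psi^{\rm B}_{\boldsymbol\rho'^{-k}_{n+1}},$$ where $$\tilde\varphi_k(\boldsymbol\rho'_{n+1})=-\frac{r_{n+1}}{\tilde r_n}\,\frac{\omega^{\tilde\rho'_{n+1}-1}}{\prod_{s=1}^{n-1}y^{n+1,k}_{n,s}}\prod_{s=1}^nF_s(\lambda_{n+1,k}),\qquad F_s(\lambda)=(b_s+\omega a_s\kappa_s\lambda)(\lambda c_s+d_s/\kappa_s).$$ -/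

import Mathlib

open scoped BigOperators

noncomputable section

namespace BBS

/-! Sites, parameters and amplitudes carry the indices `1, …, n+1` of the mathematics (functions on
`ℕ`); a tensor factor `i : Fin (n+1)` is the site number `i + 1`. Here `N` is the number of
spin states. -/

/-- `ω ^ γ` for `γ ∈ ℤ/N`, where `ω = exp (2πi/N)`. -/
def om {N : ℕ} [NeZero N] (γ : ZMod N) : ℂ := ZMod.stdAddChar γ

/-- `ε = (-1)^N`. -/
def eps (N : ℕ) : ℂ := (-1) ^ N

/-- The cyclic function `w_p`: `w_p(0) = 1` and `w_p(γ) / w_p(γ-1) = y / (1 - ω^γ x)` for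
`p = (x, y)`, written as a product over the representative of `γ` in `{0, …, N-1}`
(for `p` on the Fermat curve the recursion is consistent modulo `N`). -/
def w {N : ℕ} [NeZero N] (p : ℂ × ℂ) (γ : ZMod N) : ℂ :=
  ∏ j ∈ Finset.range γ.val, p.2 / (1 - om ((j + 1 : ℕ) : ZMod N) * p.1)

/-- The Fermat curve `x^N + y^N = 1`. -/
def OnFermat (N : ℕ) (p : ℂ × ℂ) : Prop := p.1 ^ N + p.2 ^ N = 1

/-! ### The quantum space and the Weyl elements -/

/-- `V^{(m)} = V_1 ⊗ ⋯ ⊗ V_m`, in coordinates with respect to the basis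
`|γ_1⟩ ⊗ ⋯ ⊗ |γ_m⟩`. -/
abbrev State (N m : ℕ) : Type := (Fin m → ZMod N) → ℂ

/-- `f ⊗ g` for `f ∈ V_1 ⊗ ⋯ ⊗ V_m` and `g ∈ V_{m+1}`. -/
def tens {N m : ℕ} (f : State N m) (g : ZMod N → ℂ) : State N (m + 1) :=
  fun γ => f (Fin.init γ) * g (γ (Fin.last m))

/-- The basis vector `|γ⟩` of a one-site space. -/
def ket {N : ℕ} (γ : ZMod N) : ZMod N → ℂ := Pi.single γ 1

variable {N : ℕ} [NeZero N]

/-- `u_k |γ⟩ = ω^{γ_k} |γ⟩`. -/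
def u {m : ℕ} (k : Fin m) : Module.End ℂ (State N m) :=
  LinearMap.mulLeft ℂ (fun γ : Fin m → ZMod N => om (γ k))

/-- The inverse of `u_k`. -/
def uInv {m : ℕ} (k : Fin m) : Module.End ℂ (State N m) :=
  LinearMap.mulLeft ℂ (fun γ : Fin m → ZMod N => om (-γ k))

/-- `v_k` raises the spin at site `k`: `v_k |γ⟩ = |γ + e_k⟩`, so
`(v_k f)(γ) = f (γ - e_k)`. -/
def v {m : ℕ} (k : Fin m) : Module.End ℂ (State N m) :=
  LinearMap.funLeft ℂ ℂ (fun γ : Fin m → ZMod N => γ - Pi.single k 1)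

/-! ### The model -/

/-- Parameters of the chain. For `1 ≤ k ≤ n` all five of `κ_k, a_k, b_k, c_k, d_k` are used; at
the boundary site only `a_0` and `c_{n+1}`. -/
structure Params where
  κ : ℕ → ℂ
  a : ℕ → ℂ
  b : ℕ → ℂ
  c : ℕ → ℂ
  d : ℕ → ℂ
  a0 : ℂ

/-- The `L`-operator `L_k(λ)` of site `k = i + 1`. -/
def L (P : Params) {m : ℕ} (i : Fin m) (lam : ℂ) :
    Matrix (Fin 2) (Fin 2) (Module.End ℂ (State N m)) :=
  !![1 + (lam * P.κ (i + 1)) • v i, lam • (uInv i * (P.a (i + 1) • 1 - P.b (i + 1) • v i));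
     u i * (P.c (i + 1) • 1 - P.d (i + 1) • v i),
       (lam * P.a (i + 1) * P.c (i + 1)) • 1 + (P.b (i + 1) * P.d (i + 1) / P.κ (i + 1)) • v i]

/-- The degenerate boundary operator `L_{n+1}(λ)`, with boundary spins
`g0 = γ_0` and `g1 = γ_{n+1}`. -/
def LBdry (P : Params) (n : ℕ) (g0 g1 : ZMod N) (lam : ℂ) :
    Matrix (Fin 2) (Fin 2) (Module.End ℂ (State N (n + 1))) :=
  !![1, (lam * P.a0 * om (g1 - g0)) • uInv (Fin.last n);
     P.c (n + 1) • u (Fin.last n), (lam * P.a0 * P.c (n + 1) * om (g1 - g0)) • 1]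

/-- `T_{n+1}(λ) = L_1(λ) ⋯ L_n(λ) L_{n+1}(λ) = (A, B; C, D)` with the boundary operator at the
last site. -/
def monodromy (P : Params) (n : ℕ) (g0 g1 : ZMod N) (lam : ℂ) :
    Matrix (Fin 2) (Fin 2) (Module.End ℂ (State N (n + 1))) :=
  (List.ofFn fun i : Fin n => L P i.castSucc lam).prod * LBdry P n g0 g1 lam

/-- `A_{n+1}(λ)`. -/
def opA (P : Params) (n : ℕ) (g0 g1 : ZMod N) (lam : ℂ) : Module.End ℂ (State N (n + 1)) :=
  monodromy P n g0 g1 lam 0 0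

/-- `B_{n+1}(λ)`. -/
def opB (P : Params) (n : ℕ) (g0 g1 : ZMod N) (lam : ℂ) : Module.End ℂ (State N (n + 1)) :=
  monodromy P n g0 g1 lam 0 1

/-- `D_{n+1}(λ)`. -/
def opD (P : Params) (n : ℕ) (g0 g1 : ZMod N) (lam : ℂ) : Module.End ℂ (State N (n + 1)) :=
  monodromy P n g0 g1 lam 1 1

/-! ### Averaged operators, in the variable `Λ = λ^N` -/

/-- The averaged `L`-operator of site `k`. -/
def avgL (N : ℕ) (P : Params) (k : ℕ) (Λ : ℂ) : Matrix (Fin 2) (Fin 2) ℂ :=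
  !![1 - eps N * P.κ k ^ N * Λ, -eps N * Λ * (P.a k ^ N - P.b k ^ N);
     P.c k ^ N - P.d k ^ N,
       P.b k ^ N * P.d k ^ N / P.κ k ^ N - eps N * Λ * P.a k ^ N * P.c k ^ N]

/-- The averaged boundary operator of site `n+1`. -/
def avgLBdry (N : ℕ) (P : Params) (n : ℕ) (Λ : ℂ) : Matrix (Fin 2) (Fin 2) ℂ :=
  !![1, -eps N * Λ * P.a0 ^ N;
     P.c (n + 1) ^ N, -eps N * Λ * P.a0 ^ N * P.c (n + 1) ^ N]

/-- The averaged monodromy of the sites `1, …, m`, where `m ≤ n`. -/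
def avgT (N : ℕ) (P : Params) (m : ℕ) (Λ : ℂ) : Matrix (Fin 2) (Fin 2) ℂ :=
  (List.ofFn fun i : Fin m => avgL N P (i + 1) Λ).prod

/-- The averaged monodromy of the whole chain, boundary site included. -/
def avgTBdry (N : ℕ) (P : Params) (n : ℕ) (Λ : ℂ) : Matrix (Fin 2) (Fin 2) ℂ :=
  avgT N P n Λ * avgLBdry N P n Λ

/-! ### Amplitudes and Fermat points -/

/-- The chosen roots: one-site amplitudes `r_k`, amplitudes `R m s = r_{m,s}`, and the
`y`-coordinates `y m s = y_{m,s}`, `yt m s = ỹ_{m,s}`, `yy m s m' s' = y^{m,s}_{m',s'}`. -/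
structure Roots where
  r : ℕ → ℂ
  R : ℕ → ℕ → ℂ
  y : ℕ → ℕ → ℂ
  yt : ℕ → ℕ → ℂ
  yy : ℕ → ℕ → ℕ → ℕ → ℂ

/-- `r̃_m = r_{m,0} r_{m,1} ⋯ r_{m,m-1}`. -/
def rt (S : Roots) (m : ℕ) : ℂ := ∏ s ∈ Finset.range m, S.R m s

/-- The one-site point `p_k`. -/
def pSite (P : Params) (S : Roots) (k : ℕ) : ℂ × ℂ := (S.r k / P.a k, P.b k / P.a k)

/-- The point `p^{m,s}_{m',s'}`. -/
def pCross (S : Roots) (m s m' s' : ℕ) : ℂ × ℂ := (S.R m s / S.R m' s', S.yy m s m' s')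

/-- The point `p_{m,s}`, `s ≥ 1`. -/
def pPos (P : Params) (S : Roots) (m s : ℕ) : ℂ × ℂ :=
  (P.a m * P.κ m * S.R m s / P.b m, S.y m s)

/-- The point `p̃_{m,s}`, `s ≥ 1`. -/
def ptPos (P : Params) (S : Roots) (m s : ℕ) : ℂ × ℂ :=
  (P.d m / (P.κ m * P.c m * S.R m s), S.yt m s)

/-- The point `p_{m,0}`, `2 ≤ m ≤ n`. -/
def pZero (P : Params) (S : Roots) (m : ℕ) : ℂ × ℂ :=
  (S.R (m - 1) 0 * P.a m * P.c m / S.R m 0,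
    (∏ k ∈ Finset.Icc 1 (m - 1), P.κ k) * S.r m / S.R m 0)

/-- The point `p_{n+1,0}` of the boundary site. -/
def pZeroBdry (P : Params) (S : Roots) (n : ℕ) : ℂ × ℂ :=
  (S.R n 0 * P.a0 * P.c (n + 1) / S.R (n + 1) 0,
    (∏ k ∈ Finset.Icc 1 n, P.κ k) * P.a0 / S.R (n + 1) 0)

/-- The point `p̃_m`, `2 ≤ m ≤ n`. -/
def pTilde (P : Params) (S : Roots) (m : ℕ) : ℂ × ℂ :=
  (S.r m / rt S m, P.b m * P.d m * rt S (m - 1) / (P.κ m * rt S m))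

/-- `S` is an admissible choice of amplitudes and Fermat curve points for the chain with bulk
sites `1, …, n` and the boundary site `n+1`. -/
structure IsChoice (N n : ℕ) [NeZero N] (P : Params) (S : Roots) : Prop where
  site : ∀ k ∈ Finset.Icc 1 n, S.r k ^ N = P.a k ^ N - P.b k ^ N
  site_bdry : S.r (n + 1) = P.a0
  first : S.R 1 0 = S.r 1
  /-- The averaged `B_m` in factorised form, `1 ≤ m ≤ n`. -/
  avgB : ∀ m ∈ Finset.Icc 1 n, ∀ Λ : ℂ,
    avgT N P m Λ 0 1 = (-eps N) ^ m * Λ * S.R m 0 ^ N *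
      ∏ s ∈ Finset.Icc 1 (m - 1), (Λ - eps N * S.R m s ^ N)
  /-- The averaged `B_{n+1}` in factorised form. -/
  avgB_bdry : ∀ Λ : ℂ,
    avgTBdry N P n Λ 0 1 = (-eps N) ^ (n + 1) * Λ * S.R (n + 1) 0 ^ N *
      ∏ s ∈ Finset.Icc 1 n, (Λ - eps N * S.R (n + 1) s ^ N)
  /-- The phase of `r_{n+1,0}` is fixed by `r̃_{n+1} = ω a_0`. -/
  rt_bdry : rt S (n + 1) = om (1 : ZMod N) * P.a0
  fermat_y : ∀ m ∈ Finset.Icc 2 n, ∀ s ∈ Finset.Icc 1 (m - 1), OnFermat N (pPos P S m s)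
  fermat_yt : ∀ m ∈ Finset.Icc 2 n, ∀ s ∈ Finset.Icc 1 (m - 1), OnFermat N (ptPos P S m s)
  fermat_same : ∀ m ∈ Finset.Icc 2 n, ∀ s ∈ Finset.Icc 1 (m - 1), ∀ s' ∈ Finset.Icc 1 (m - 1),
    s ≠ s' → OnFermat N (pCross S m s m s')
  fermat_next : ∀ m ∈ Finset.Icc 2 n, ∀ k ∈ Finset.Icc 1 m, ∀ l ∈ Finset.Icc 1 (m - 1),
    OnFermat N (pCross S (m + 1) k m l)
  /-- The relations between the phases of the `y`-coordinates. -/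
  phases : ∀ m ∈ Finset.Icc 3 (n + 1), ∀ l ∈ Finset.Icc 1 (m - 2),
    rt S (m - 1) * S.R m 0 * S.r (m - 1) /
        (rt S (m - 2) * S.R (m - 1) 0 * S.r m * P.b (m - 1) * P.c (m - 1) *
          S.y (m - 1) l * S.yt (m - 1) l) *
      (∏ s ∈ (Finset.Icc 1 (m - 2)).erase l,
        S.yy (m - 1) l (m - 1) s / S.yy (m - 1) s (m - 1) l) *
      ((∏ k ∈ Finset.Icc 1 (m - 1), S.yy m k (m - 1) l) /
        ∏ s ∈ Finset.Icc 1 (m - 3), S.yy (m - 1) l (m - 2) s) = 1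

/-- Genericity. Through `IsChoice.avgB`, the conditions `R_ne` and `R_simple` say that for
`2 ≤ m ≤ n` the polynomial `𝓑_m(Λ)/Λ` has degree `m-1` and nonzero simple zeros, which are
the numbers `ε r_{m,s}^N`. -/
structure IsGeneric (N n : ℕ) (P : Params) (S : Roots) : Prop where
  κ_ne : ∀ k ∈ Finset.Icc 1 n, P.κ k ≠ 0
  a_ne : ∀ k ∈ Finset.Icc 1 n, P.a k ≠ 0
  b_ne : ∀ k ∈ Finset.Icc 1 n, P.b k ≠ 0
  c_ne : ∀ k ∈ Finset.Icc 2 n, P.c k ≠ 0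
  d_ne : ∀ k ∈ Finset.Icc 2 n, P.d k ≠ 0
  a0_ne : P.a0 ≠ 0
  r_ne : ∀ k ∈ Finset.Icc 1 n, S.r k ≠ 0
  R_ne : ∀ m ∈ Finset.Icc 2 n, ∀ s ∈ Finset.range m, S.R m s ≠ 0
  R_simple : ∀ m ∈ Finset.Icc 2 n, ∀ s ∈ Finset.Icc 1 (m - 1), ∀ s' ∈ Finset.Icc 1 (m - 1),
    s ≠ s' → S.R m s ^ N ≠ S.R m s' ^ N
  det_ne : ∀ m ∈ Finset.Icc 2 n, ∀ s ∈ Finset.Icc 1 (m - 1),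
    (avgT N P n (eps N * S.R m s ^ N)).det ≠ 0

/-! ### The eigenvectors -/

/-- The one-site vector `ψ^{(k)}_ρ = ∑_γ w_{p_k}(γ - ρ) |γ⟩`. -/
def psi (P : Params) (S : Roots) (k : ℕ) (ρ : ZMod N) : ZMod N → ℂ :=
  fun γ => w (pSite P S k) (γ - ρ)

/-- The indices `s = 1, …, m-1` among `s = 0, …, m-1`. -/
def pos (m : ℕ) : Finset (Fin m) := Finset.univ.filter fun s => (s : ℕ) ≠ 0

/-- The products of `w_p` common to `Q(ρ_m, · | ρ_{m+1})` and `Q^B`; here `ρ = ρ_m` and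
`ρ' = ρ_{m+1}`. -/
def coreQ (P : Params) (S : Roots) (m : ℕ) (ρ : Fin m → ZMod N) (ρ' : Fin (m + 1) → ZMod N) : ℂ :=
  (∏ l ∈ pos m, ∏ k ∈ pos (m + 1), w (pCross S (m + 1) k m l) (ρ l - ρ' k)) /
    (∏ j ∈ pos m, ∏ l ∈ (pos m).erase j, w (pCross S m l m j) (ρ j - ρ l)) *
    ∏ l ∈ pos m, w (pPos P S m l) (-ρ l) / w (ptPos P S m l) (ρ l)

/-- The coefficient `Q(ρ_m, σ | ρ_{m+1})` of the bulk recursion; here `ρ = ρ_m`,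
`ρ' = ρ_{m+1}`, and `σ` is the label of the one-site vector at site `m+1`. -/
def bulkQ (P : Params) (S : Roots) (m : ℕ) [NeZero m] (ρ : Fin m → ZMod N) (σ : ZMod N)
    (ρ' : Fin (m + 1) → ZMod N) : ℂ :=
  om ((∑ s, ρ' s - ∑ s, ρ s) * (σ - ρ' 0)) /
      (w (pZero P S (m + 1)) (ρ' 0 - ρ 0 - 1) * w (pTilde P S (m + 1)) (∑ s, ρ' s - σ - 1)) *
    coreQ P S m ρ ρ'

/-- The vectors `Ψ_{ρ_m} ∈ V^{(m)}`, for `m ≥ 1` (the value at `m = 0` is a placeholder). -/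
def Psi (P : Params) (S : Roots) : (m : ℕ) → (Fin m → ZMod N) → State N m
  | 0, _ => 0
  | 1, ρ => fun γ => psi P S 1 (ρ 0) (γ 0)
  | m + 2, ρ => ∑ ρ₁ : Fin (m + 1) → ZMod N, ∑ σ : ZMod N,
      bulkQ P S (m + 1) ρ₁ σ ρ • tens (Psi P S (m + 1) ρ₁) (psi P S (m + 2) σ)

/-- The full label `ρ_{n+1}` belonging to `ρ'_{n+1} = (ρ_{n+1,1}, …, ρ_{n+1,n})`:
`ρ_{n+1,0} = γ_0 + 1 - ∑_k ρ_{n+1,k}`. -/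
def bdryLabel {n : ℕ} (g0 : ZMod N) (ρ' : Fin n → ZMod N) : Fin (n + 1) → ZMod N :=
  Fin.cons (g0 + 1 - ∑ k, ρ' k) ρ'

/-- The coefficient `Q^B(ρ_n | ρ'_{n+1})`. -/
def QB (P : Params) (S : Roots) (n : ℕ) [NeZero n] (g0 g1 : ZMod N)
    (ρ : Fin n → ZMod N) (ρ' : Fin n → ZMod N) : ℂ :=
  om ((g0 + 1 - ∑ s, ρ s) * (∑ k, ρ' k - 1)) /
      w (pZeroBdry P S n) (g1 - ∑ k, ρ' k - ρ 0) *
    coreQ P S n ρ (bdryLabel g0 ρ')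

/-- `Ψ^B_{ρ'_{n+1}} = ∑_{ρ_n} Q^B(ρ_n | ρ'_{n+1}) Ψ_{ρ_n} ∈ V^{(n)}`. -/
def PsiB (P : Params) (S : Roots) (n : ℕ) [NeZero n] (g0 g1 : ZMod N)
    (ρ' : Fin n → ZMod N) : State N n :=
  ∑ ρ : Fin n → ZMod N, QB P S n g0 g1 ρ ρ' • Psi P S n ρ

/-- `f ⊗ |γ_{n+1}⟩`: the identification of `V^{(n)}` with the subspace of `V^{(n+1)}` of fixed
boundary spin `γ_{n+1}`. -/
def withSpin {n : ℕ} (g1 : ZMod N) (f : State N n) : State N (n + 1) := tens f (ket g1)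

/-- The zero `λ_{n+1,k} = -r_{n+1,k} ω^{-ρ_{n+1,k}}`; the index `k : Fin n` stands for
the number `k + 1`. -/
def zeroB (S : Roots) {n : ℕ} (ρ' : Fin n → ZMod N) (k : Fin n) : ℂ :=
  -S.R (n + 1) (k + 1) * om (-ρ' k)

/-- The eigenvalue of `B_{n+1}(λ)` on `Ψ^B_{ρ'_{n+1}}`. -/
def eigB (S : Roots) {n : ℕ} (g0 : ZMod N) (ρ' : Fin n → ZMod N) (lam : ℂ) : ℂ :=
  lam * S.R (n + 1) 0 * om (-(bdryLabel g0 ρ' 0)) *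
    ∏ k : Fin n, (lam + S.R (n + 1) (k + 1) * om (-ρ' k))

/-- `F_s(λ) = (b_s + ω a_s κ_s λ)(λ c_s + d_s / κ_s)`. -/
def F (N : ℕ) [NeZero N] (P : Params) (s : ℕ) (lam : ℂ) : ℂ :=
  (P.b s + om (1 : ZMod N) * P.a s * P.κ s * lam) * (lam * P.c s + P.d s / P.κ s)

/-- The coefficient `φ̃_k(ρ'_{n+1})`; the index `k : Fin n` stands for the number `k + 1`. -/
def phiTilde (P : Params) (S : Roots) {n : ℕ} (ρ' : Fin n → ZMod N) (k : Fin n) : ℂ :=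
  -(S.r (n + 1) / rt S n) *
    (om (∑ j, ρ' j - 1) / ∏ s ∈ Finset.Icc 1 (n - 1), S.yy (n + 1) (k + 1) n s) *
    ∏ s ∈ Finset.Icc 1 n, F N P s (zeroB S ρ' k)

end BBS

end

/-! The vectors are built one site at a time, by induction on the number `m` of sites. The induction
statement `Solved` has two halves: B_m(λ) is diagonal on the Ψ_ρ with an explicit eigenvalue, and at
the k-th zero of that eigenvalue A_m raises ρ_{m,k} by one. Now A_m(λ) is a polynomial of degree m
with A_m(0) = 1 and leading coefficient ∏κ times the translation of all spins (`isPoly_bulkT`), and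
this translation raises ρ_{m,0} (`shift_Psi`). So the two halves determine A_m(λ)Ψ_ρ for every λ by
interpolation.

Step for B. The vector ψ_σ is an eigenvector of u⁻¹(a - bv), and vψ_σ = ψ_{σ+1}. Hence the
ψ_σ-component of B_{m+1}Ψ is a combination of A_m and B_m applied to ∑ Q Ψ_ρ. Demanding that it be a
multiple of the same sum is a polynomial identity in λ, which is checked at λ = 0, at λ = ∞ and at
the zeros of B_m (`Solved.combination`). The three resulting difference equations are the recursions
of w at p̃_m, of w at p_{m,0}, and of the kernel K; in the last one the constants agree because of
the phase relations (`kernelK_match`).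

Step for A. Multiplying A_{m+1}(λ) by the invertible L₀₁(λ) expresses it through B_{m+1} and B_m
(`L_zero_one_mul_bulkT`). At a zero of B_{m+1} only the B_m term survives, and B_m is already
diagonal.

Boundary. On states of fixed boundary spin, A_{n+1} and B_{n+1} are the same operator A_n +
c_{n+1}ω^{γ_{n+1}}B_n up to a scalar, so `Solved.combination` treats both at once. The action of
D_{n+1} comes from the quantum determinant (`quantum_det`) applied to the vector with ρ_{n+1,k}
lowered, whose k-th zero is ωλ_{n+1,k}.

Nonvanishing follows because the eigenvalues of B_m separate the labels ρ and no coefficient Q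
vanishes. The latter rests on all the Fermat points having y ≠ 0, which is read off from the
averaged polynomials. -/

set_option linter.unusedSectionVars false

noncomputable section

namespace BBS

variable {N : ℕ} [NeZero N]

/-! ### Powers of `ω` -/

theorem om_zero : om (0 : ZMod N) = 1 := AddChar.map_zero_eq_one _

theorem om_add (x y : ZMod N) : om (x + y) = om x * om y := AddChar.map_add_eq_mul _ x y

theorem om_neg (x : ZMod N) : om (-x) = (om x)⁻¹ := AddChar.map_neg_eq_inv _ x

theorem om_sub (x y : ZMod N) : om (x - y) = om x / om y := by
  rw [sub_eq_add_neg, om_add, om_neg, div_eq_mul_inv]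

theorem om_ne_zero (x : ZMod N) : om x ≠ 0 := by
  intro h
  have := om_add x (-x)
  rw [h, add_neg_cancel, om_zero, zero_mul] at this
  exact one_ne_zero this

theorem om_injective : Function.Injective (om : ZMod N → ℂ) := ZMod.injective_stdAddChar

theorem om_sum {ι : Type*} (s : Finset ι) (f : ι → ZMod N) :
    om (∑ i ∈ s, f i) = ∏ i ∈ s, om (f i) := by
  classical
  induction s using Finset.induction_on with
  | empty => simp [om_zero]
  | insert i s hi ih => rw [Finset.sum_insert hi, Finset.prod_insert hi, om_add, ih]

theorem om_pow_card (x : ZMod N) : om x ^ N = 1 := by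
  have h : om x ^ N = om (N • x) := (AddChar.map_nsmul_eq_pow _ N x).symm
  rw [h, nsmul_eq_mul, CharP.cast_eq_zero, zero_mul, om_zero]

theorem om_natCast (j : ℕ) : om ((j : ℕ) : ZMod N) = om (1 : ZMod N) ^ j := by
  have h : om (1 : ZMod N) ^ j = om (j • (1 : ZMod N)) := (AddChar.map_nsmul_eq_pow _ j 1).symm
  rw [h, nsmul_one]

theorem isPrimitiveRoot_om_one : IsPrimitiveRoot (om (1 : ZMod N)) N := by
  refine ⟨om_pow_card 1, fun l hl => ?_⟩
  rw [← om_natCast, ← om_zero (N := N)] at hl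
  exact (ZMod.natCast_eq_zero_iff l N).1 (om_injective hl)

/-- This factorisation over all N-th roots of unity closes the recursion of `w` around the cycle
ℤ/N. -/
theorem prod_one_sub_om_mul (x : ℂ) :
    ∏ j ∈ Finset.range N, (1 - om ((j + 1 : ℕ) : ZMod N) * x) = 1 - x ^ N := by
  have h := (isPrimitiveRoot_om_one (N := N)).pow_sub_pow_eq_prod_sub_mul 1 x
    (Nat.pos_of_ne_zero (NeZero.ne N))
  rw [one_pow] at h
  rw [h]
  refine Finset.prod_bij (fun j _ => om ((j + 1 : ℕ) : ZMod N)) ?_ ?_ ?_ ?_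
  · intro j _
    rw [Polynomial.mem_nthRootsFinset (Nat.pos_of_ne_zero (NeZero.ne N))]
    exact om_pow_card _
  · intro i hi j hj hij
    have h1 := (ZMod.natCast_eq_natCast_iff _ _ _).1 (om_injective hij)
    have h2 : i ≡ j [MOD N] := Nat.ModEq.add_right_cancel' 1 h1
    rw [Finset.mem_range] at hi hj
    exact Nat.ModEq.eq_of_lt_of_lt h2 hi hj
  · intro b hb
    rw [Polynomial.mem_nthRootsFinset (Nat.pos_of_ne_zero (NeZero.ne N))] at hb
    obtain ⟨i, hi, rfl⟩ := (isPrimitiveRoot_om_one (N := N)).eq_pow_of_pow_eq_one hb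
    -- The product runs over exponents 1, …, N, so the root 1 is hit by j = N - 1 rather than by
    -- exponent 0.
    rcases Nat.eq_zero_or_pos i with rfl | hpos
    · refine ⟨N - 1, by simp [Nat.pos_of_ne_zero (NeZero.ne N)], ?_⟩
      rw [Nat.sub_add_cancel (Nat.pos_of_ne_zero (NeZero.ne N)), pow_zero, CharP.cast_eq_zero,
        om_zero]
    · refine ⟨i - 1, by simp; omega, ?_⟩
      rw [Nat.sub_add_cancel hpos, om_natCast]
  · intro j _
    rfl

/-! ### The cyclic functions `w_p` -/

/-- A point of the Fermat curve off the lines where `w_p` degenerates. -/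
def Regular (N : ℕ) (p : ℂ × ℂ) : Prop := OnFermat N p ∧ p.2 ≠ 0

/-- On the curve ω^γ x = 1 would give x^N = 1, hence y = 0. -/
theorem Regular.one_sub_ne_zero {p : ℂ × ℂ} (hp : Regular N p) (γ : ZMod N) :
    1 - om γ * p.1 ≠ 0 := by
  intro h
  have h1 : (om γ * p.1) ^ N = 1 := by rw [← sub_eq_zero.1 h, one_pow]
  rw [mul_pow, om_pow_card, one_mul] at h1
  have h2 := hp.1
  rw [OnFermat, h1] at h2
  exact hp.2 (pow_eq_zero_iff (NeZero.ne N) |>.1 (by linear_combination h2))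

theorem Regular.w_ne_zero {p : ℂ × ℂ} (hp : Regular N p) (γ : ZMod N) : w p γ ≠ 0 :=
  Finset.prod_ne_zero_iff.2 fun _ _ => div_ne_zero hp.2 (hp.one_sub_ne_zero _)

theorem w_zero (p : ℂ × ℂ) : w p (0 : ZMod N) = 1 := by simp [w]

theorem Regular.w_add_one {p : ℂ × ℂ} (hp : Regular N p) (γ : ZMod N) :
    w p (γ + 1) = w p γ * (p.2 / (1 - om (γ + 1) * p.1)) := by
  have hstep : w p γ * (p.2 / (1 - om (γ + 1) * p.1)) =
      ∏ j ∈ Finset.range (γ.val + 1), p.2 / (1 - om ((j + 1 : ℕ) : ZMod N) * p.1) := by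
    rw [Finset.prod_range_succ, w]
    simp
  rw [hstep]
  by_cases h : γ.val + 1 < N
  · have hval : (γ + 1).val = γ.val + 1 := by
      have h1 : γ + 1 = ((γ.val + 1 : ℕ) : ZMod N) := by simp
      rw [h1, ZMod.val_natCast, Nat.mod_eq_of_lt h]
    rw [w, hval]
  -- Wrap-around: the product of all N factors is y^N / (1 - x^N), which is 1 on the Fermat curve.
  · have hN : γ.val + 1 = N := by have := ZMod.val_lt γ; omega
    have h1 : γ + 1 = 0 := by
      have h1 : γ + 1 = ((γ.val + 1 : ℕ) : ZMod N) := by simp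
      rw [h1, hN, CharP.cast_eq_zero]
    rw [h1, w_zero, hN, Finset.prod_div_distrib, Finset.prod_const, Finset.card_range,
      prod_one_sub_om_mul]
    have h2 := hp.1
    rw [OnFermat] at h2
    rw [show 1 - p.1 ^ N = p.2 ^ N by linear_combination -h2, div_self (pow_ne_zero _ hp.2)]

theorem Regular.w_sub_one {p : ℂ × ℂ} (hp : Regular N p) (γ : ZMod N) :
    w p (γ - 1) = w p γ * ((1 - om γ * p.1) / p.2) := by
  have h := hp.w_add_one (γ - 1)
  rw [sub_add_cancel] at h
  rw [h]
  have := hp.one_sub_ne_zero γ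
  have := hp.2
  field_simp

/-! ### Interpolation -/

/-- `f` is a polynomial function of degree at most `d` whose coefficient in degree `d` is `t`. -/
def IsPoly (d : ℕ) (f : ℂ → ℂ) (t : ℂ) : Prop :=
  ∃ p : Polynomial ℂ, p.natDegree ≤ d ∧ p.coeff d = t ∧ ∀ x, p.eval x = f x

theorem IsPoly.const (c : ℂ) : IsPoly 0 (fun _ => c) c :=
  ⟨Polynomial.C c, by simp, by simp, by simp⟩

theorem IsPoly.add {d : ℕ} {f g : ℂ → ℂ} {s t : ℂ} (hf : IsPoly d f s) (hg : IsPoly d g t) :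
    IsPoly d (fun x => f x + g x) (s + t) := by
  obtain ⟨p, hp, rfl, hpf⟩ := hf
  obtain ⟨q, hq, rfl, hqg⟩ := hg
  exact ⟨p + q, Polynomial.natDegree_add_le_of_degree_le hp hq, by simp,
    fun x => by simp [hpf, hqg]⟩

theorem IsPoly.succ {d : ℕ} {f : ℂ → ℂ} {t : ℂ} (hf : IsPoly d f t) : IsPoly (d + 1) f 0 := by
  obtain ⟨p, hp, -, hpf⟩ := hf
  exact ⟨p, hp.trans d.le_succ, Polynomial.coeff_eq_zero_of_natDegree_lt (by omega), hpf⟩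

theorem IsPoly.id_mul {d : ℕ} {f : ℂ → ℂ} {t : ℂ} (hf : IsPoly d f t) :
    IsPoly (d + 1) (fun x => x * f x) t := by
  obtain ⟨p, hp, rfl, hpf⟩ := hf
  refine ⟨Polynomial.X * p, ?_, by simp, fun x => by simp [hpf]⟩
  refine Polynomial.natDegree_mul_le.trans ?_
  have := Polynomial.natDegree_X_le (R := ℂ)
  omega

theorem IsPoly.const_mul {d : ℕ} {f : ℂ → ℂ} {t : ℂ} (c : ℂ) (hf : IsPoly d f t) :
    IsPoly d (fun x => c * f x) (c * t) := by
  obtain ⟨p, hp, rfl, hpf⟩ := hf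
  exact ⟨Polynomial.C c * p, (Polynomial.natDegree_C_mul_le _ _).trans hp, by simp,
    fun x => by simp [hpf]⟩

theorem isPoly_prod_sub {ι : Type*} (s : Finset ι) (z : ι → ℂ) :
    IsPoly s.card (fun x => ∏ i ∈ s, (x - z i)) 1 := by
  refine ⟨∏ i ∈ s, (Polynomial.X - Polynomial.C (z i)), ?_, ?_, fun x => ?_⟩
  · rw [Polynomial.natDegree_finsetProd_X_sub_C_eq_card]
  · have := Polynomial.monic_prod_X_sub_C z s
    have h2 := Polynomial.natDegree_finsetProd_X_sub_C_eq_card s z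
    rw [Polynomial.Monic, Polynomial.leadingCoeff, h2] at this
    exact this
  · simp [Polynomial.eval_prod]

/-- A polynomial function of degree `≤ M` with vanishing top coefficient and `M` zeros is zero. -/
theorem IsPoly.eq_zero {M : ℕ} {f : ℂ → ℂ} (hf : IsPoly M f 0) {z : Fin M → ℂ}
    (hz : Function.Injective z) (h : ∀ k, f (z k) = 0) (x : ℂ) : f x = 0 := by
  obtain ⟨p, hp, h0, hpf⟩ := hf
  have hp0 : p = 0 := by
    refine Polynomial.eq_zero_of_degree_lt_of_eval_index_eq_zero Finset.univ
      (hz.injOn) ?_ (fun k _ => by rw [hpf, h])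
    rw [Finset.card_univ, Fintype.card_fin, Polynomial.degree_lt_iff_coeff_zero]
    intro m hm
    rcases hm.eq_or_lt with rfl | hm
    · exact h0
    · exact Polynomial.coeff_eq_zero_of_natDegree_lt (by omega)
  rw [← hpf, hp0, Polynomial.eval_zero]

theorem IsPoly.sum {ι : Type*} {d : ℕ} (s : Finset ι) {f : ι → ℂ → ℂ}
    (hf : ∀ i ∈ s, IsPoly d (f i) 0) : IsPoly d (fun x => ∑ i ∈ s, f i x) 0 := by
  classical
  induction s using Finset.induction_on with
  | empty => exact ⟨0, by simp, by simp, by simp⟩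
  | insert i s hi ih =>
    have h := (hf i (Finset.mem_insert_self i s)).add
      (ih fun j hj => hf j (Finset.mem_insert_of_mem hj))
    simp only [Finset.sum_insert hi]
    simpa using h

/-- A polynomial function of degree `≤ M + 1` in terms of its value at `0`, its top coefficient
and its values at `M` nonzero points. -/
theorem IsPoly.interpolate {M : ℕ} {f : ℂ → ℂ} {t : ℂ} (hf : IsPoly (M + 1) f t) {z : Fin M → ℂ}
    (hz : Function.Injective z) (hz0 : ∀ k, z k ≠ 0) (x : ℂ) :
    f x = (∏ k, (x - z k)) / (∏ k, (-z k)) * f 0 + x * (∏ k, (x - z k)) * t +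
      ∑ k, x * (∏ s ∈ Finset.univ.erase k, (x - z s)) /
        (z k * ∏ s ∈ Finset.univ.erase k, (z k - z s)) * f (z k) := by
  have hne : ∏ k, (-z k) ≠ 0 := Finset.prod_ne_zero_iff.2 fun k _ => neg_ne_zero.2 (hz0 k)
  have hk : ∀ k, ∏ s ∈ Finset.univ.erase k, (z k - z s) ≠ 0 := fun k =>
    Finset.prod_ne_zero_iff.2 fun s hs => sub_ne_zero.2 fun h => (Finset.mem_erase.1 hs).1 (hz h.symm)
  have hprod : IsPoly M (fun x => ∏ k, (x - z k)) 1 := by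
    simpa using isPoly_prod_sub Finset.univ z
  have hterm : ∀ k ∈ Finset.univ, IsPoly (M + 1) (fun x => -(f (z k) /
      (z k * ∏ s ∈ Finset.univ.erase k, (z k - z s))) *
      (x * (∏ s ∈ Finset.univ.erase k, (x - z s)))) 0 := by
    intro k _
    have h1 := ((isPoly_prod_sub (Finset.univ.erase k) z).id_mul.succ).const_mul
      (-(f (z k) / (z k * ∏ s ∈ Finset.univ.erase k, (z k - z s))))
    rw [mul_zero] at h1
    -- Each Lagrange term has degree at most M; regarded in degree M + 1 its top coefficient is 0.
    have hc : (Finset.univ.erase k).card + 1 + 1 = M + 1 := by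
      rw [Finset.card_erase_of_mem (Finset.mem_univ k), Finset.card_univ, Fintype.card_fin]
      have := k.pos
      omega
    rwa [hc] at h1
  have hdiff := ((hf.add (hprod.succ.const_mul (-(f 0 / ∏ k, (-z k))))).add
    (hprod.id_mul.const_mul (-t))).add (IsPoly.sum Finset.univ hterm)
  rw [show t + -(f 0 / ∏ k, (-z k)) * 0 + -t * 1 + 0 = 0 by ring] at hdiff
  -- The difference between `f` and its interpolant has no term of degree M + 1 and vanishes at the
  -- M + 1 distinct points 0, z_1, …, z_M.
  have hinj : Function.Injective (Fin.cons 0 z : Fin (M + 1) → ℂ) :=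
    Fin.cons_injective_iff.2 ⟨fun ⟨k, hk⟩ => hz0 k hk, hz⟩
  have hzero := hdiff.eq_zero hinj ?_ x
  · have hsum : ∑ k, x * (∏ s ∈ Finset.univ.erase k, (x - z s)) /
        (z k * ∏ s ∈ Finset.univ.erase k, (z k - z s)) * f (z k) =
        -∑ k, -(f (z k) / (z k * ∏ s ∈ Finset.univ.erase k, (z k - z s))) *
          (x * (∏ s ∈ Finset.univ.erase k, (x - z s))) := by
      rw [← Finset.sum_neg_distrib]
      exact Finset.sum_congr rfl fun k _ => by ring
    rw [hsum]
    linear_combination hzero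
  · intro j
    refine Fin.cases ?_ (fun k => ?_) j
    · simp only [Fin.cons_zero, zero_sub, zero_mul, mul_zero, Finset.sum_const_zero, add_zero]
      field_simp
      ring
    · simp only [Fin.cons_succ]
      have h0 : ∏ i, (z k - z i) = 0 := Finset.prod_eq_zero (Finset.mem_univ k) (sub_self (z k))
      rw [h0, Finset.sum_eq_single k]
      · have := hz0 k
        have := hk k
        field_simp
        ring
      · intro i _ hik
        have h1 : ∏ s ∈ Finset.univ.erase i, (z k - z s) = 0 :=
          Finset.prod_eq_zero (Finset.mem_erase.2 ⟨hik.symm, Finset.mem_univ k⟩) (sub_self (z k))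
        rw [h1]
        ring
      · exact fun h => absurd (Finset.mem_univ k) h

/-! ### Operators on the chain -/

theorem u_apply {m : ℕ} (k : Fin m) (f : State N m) (γ : Fin m → ZMod N) :
    u k f γ = om (γ k) * f γ := rfl

theorem uInv_apply {m : ℕ} (k : Fin m) (f : State N m) (γ : Fin m → ZMod N) :
    uInv k f γ = om (-γ k) * f γ := rfl

theorem v_apply {m : ℕ} (k : Fin m) (f : State N m) (γ : Fin m → ZMod N) :
    v k f γ = f (γ - Pi.single k 1) := rfl

/-- The state on the first `m` sites obtained by fixing the spin of the last site. -/
def slice {m : ℕ} (x : ZMod N) : State N (m + 1) →ₗ[ℂ] State N m :=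
  LinearMap.funLeft ℂ ℂ (fun γ => Fin.snoc (α := fun _ => ZMod N) γ x)

theorem slice_apply {m : ℕ} (x : ZMod N) (F : State N (m + 1)) (γ : Fin m → ZMod N) :
    slice x F γ = F (Fin.snoc (α := fun _ => ZMod N) γ x) := rfl

/-- An operator on the first `m` sites, acting on `m + 1` sites. -/
def lift {m : ℕ} : Module.End ℂ (State N m) →ₐ[ℂ] Module.End ℂ (State N (m + 1)) where
  toFun X :=
    { toFun := fun F γ => X (slice (γ (Fin.last m)) F) (Fin.init γ)
      map_add' := fun F G => by ext γ; simp
      map_smul' := fun c F => by ext γ; simp }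
  map_one' := by
    ext F γ
    simp [slice_apply]
  map_mul' X Y := by
    refine LinearMap.ext fun F => funext fun γ => ?_
    change X (Y (slice (γ (Fin.last m)) F)) (Fin.init γ) =
      X (slice (γ (Fin.last m)) (fun γ => Y (slice (γ (Fin.last m)) F) (Fin.init γ))) (Fin.init γ)
    refine congrFun (congrArg X (funext fun γ' => ?_)) _
    simp [slice_apply]
  map_zero' := by ext F γ; simp
  map_add' X Y := by ext F γ; simp
  commutes' c := by
    ext F γ
    simp [slice_apply, Algebra.algebraMap_eq_smul_one]

theorem lift_apply {m : ℕ} (X : Module.End ℂ (State N m)) (F : State N (m + 1))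
    (γ : Fin (m + 1) → ZMod N) :
    lift X F γ = X (slice (γ (Fin.last m)) F) (Fin.init γ) := rfl

theorem lift_tens {m : ℕ} (X : Module.End ℂ (State N m)) (f : State N m) (g : ZMod N → ℂ) :
    lift X (tens f g) = tens (X f) g := by
  ext γ
  have h : slice (γ (Fin.last m)) (tens f g) = g (γ (Fin.last m)) • f := by
    ext γ'
    simp [slice_apply, tens, mul_comm]
  rw [lift_apply, h, map_smul, tens, Pi.smul_apply, smul_eq_mul, mul_comm]

theorem lift_u {m : ℕ} (k : Fin m) : lift (u (N := N) k) = u k.castSucc := by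
  ext F γ
  simp [lift_apply, u_apply, slice_apply, Fin.init]

theorem lift_uInv {m : ℕ} (k : Fin m) : lift (uInv (N := N) k) = uInv k.castSucc := by
  ext F γ
  simp [lift_apply, uInv_apply, slice_apply, Fin.init]

theorem snoc_sub_single {m : ℕ} (k : Fin m) (γ : Fin (m + 1) → ZMod N) :
    (Fin.snoc (α := fun _ => ZMod N) (Fin.init γ - Pi.single k 1) (γ (Fin.last m)) :
      Fin (m + 1) → ZMod N) = γ - Pi.single k.castSucc 1 := by
  ext i
  refine Fin.lastCases ?_ (fun j => ?_) i
  · simp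
  · simp [Fin.init, Pi.single_apply]

theorem lift_v {m : ℕ} (k : Fin m) : lift (v (N := N) k) = v k.castSucc := by
  ext F γ
  simp [lift_apply, v_apply, slice_apply, snoc_sub_single]

theorem init_sub_single_last {m : ℕ} (γ : Fin (m + 1) → ZMod N) :
    (Fin.init (γ - Pi.single (Fin.last m) 1 : Fin (m + 1) → ZMod N) : Fin m → ZMod N)
      = Fin.init γ := by
  ext i
  simp [Fin.init]

theorem snoc_sub_single_last {m : ℕ} (γ : Fin m → ZMod N) (x : ZMod N) :
    (Fin.snoc (α := fun _ => ZMod N) γ x - Pi.single (Fin.last m) 1 : Fin (m + 1) → ZMod N) =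
      Fin.snoc (α := fun _ => ZMod N) γ (x - 1) := by
  ext i
  refine Fin.lastCases ?_ (fun j => ?_) i
  · simp
  · simp

theorem commute_lift_u {m : ℕ} (X : Module.End ℂ (State N m)) :
    Commute (lift X) (u (Fin.last m)) := by
  refine LinearMap.ext fun F => funext fun γ => ?_
  have h : slice (γ (Fin.last m)) (u (Fin.last m) F) =
      om (γ (Fin.last m)) • slice (γ (Fin.last m)) F := by
    ext γ'
    simp [slice_apply, u_apply]
  simp only [Module.End.mul_apply]
  rw [lift_apply, h, map_smul, u_apply, lift_apply, Pi.smul_apply, smul_eq_mul]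

theorem commute_lift_uInv {m : ℕ} (X : Module.End ℂ (State N m)) :
    Commute (lift X) (uInv (Fin.last m)) := by
  refine LinearMap.ext fun F => funext fun γ => ?_
  have h : slice (γ (Fin.last m)) (uInv (Fin.last m) F) =
      om (-γ (Fin.last m)) • slice (γ (Fin.last m)) F := by
    ext γ'
    simp [slice_apply, uInv_apply]
  simp only [Module.End.mul_apply]
  rw [lift_apply, h, map_smul, uInv_apply, lift_apply, Pi.smul_apply, smul_eq_mul]

theorem commute_lift_v {m : ℕ} (X : Module.End ℂ (State N m)) :
    Commute (lift X) (v (Fin.last m)) := by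
  refine LinearMap.ext fun F => funext fun γ => ?_
  have h : slice (γ (Fin.last m)) (v (Fin.last m) F) = slice (γ (Fin.last m) - 1) F := by
    ext γ'
    simp [slice_apply, v_apply, snoc_sub_single_last]
  simp only [Module.End.mul_apply]
  rw [lift_apply, h, v_apply, lift_apply, init_sub_single_last]
  simp

/-! ### One-site operators -/

section site
variable (P : Params) {m : ℕ} (i : Fin m)

theorem L_zero_zero (lam : ℂ) : L (N := N) P i lam 0 0 = 1 + (lam * P.κ (i + 1)) • v i := rfl

theorem L_zero_one (lam : ℂ) : L (N := N) P i lam 0 1 =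
    lam • (uInv i * (P.a (i + 1) • 1 - P.b (i + 1) • v i)) := rfl

theorem L_one_zero (lam : ℂ) : L (N := N) P i lam 1 0 =
    u i * (P.c (i + 1) • 1 - P.d (i + 1) • v i) := rfl

theorem L_one_one (lam : ℂ) : L (N := N) P i lam 1 1 =
    (lam * P.a (i + 1) * P.c (i + 1)) • 1 + (P.b (i + 1) * P.d (i + 1) / P.κ (i + 1)) • v i := rfl

theorem L_zero_zero_apply (lam : ℂ) (f : State N m) (γ : Fin m → ZMod N) :
    L P i lam 0 0 f γ = f γ + lam * P.κ (i + 1) * f (γ - Pi.single i 1) := rfl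

theorem L_zero_one_apply (lam : ℂ) (f : State N m) (γ : Fin m → ZMod N) :
    L P i lam 0 1 f γ =
      lam * (om (-γ i) * (P.a (i + 1) * f γ - P.b (i + 1) * f (γ - Pi.single i 1))) := rfl

theorem L_one_zero_apply (lam : ℂ) (f : State N m) (γ : Fin m → ZMod N) :
    L P i lam 1 0 f γ =
      om (γ i) * (P.c (i + 1) * f γ - P.d (i + 1) * f (γ - Pi.single i 1)) := rfl

theorem L_one_one_apply (lam : ℂ) (f : State N m) (γ : Fin m → ZMod N) :
    L P i lam 1 1 f γ = lam * P.a (i + 1) * P.c (i + 1) * f γ +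
      P.b (i + 1) * P.d (i + 1) / P.κ (i + 1) * f (γ - Pi.single i 1) := rfl

/-- Exchange relations at spectral parameters λ and ωλ. This one and `L_one_zero_mul_L_one_one`
cancel the unwanted terms of the quantum determinant; `L_det_top` and `L_det_bot` evaluate the
remaining ones. -/
theorem L_zero_zero_mul_L_zero_one (lam : ℂ) :
    L (N := N) P i lam 0 0 * L P i (om (1 : ZMod N) * lam) 0 1 =
      om (1 : ZMod N) • (L P i lam 0 1 * L P i (om (1 : ZMod N) * lam) 0 0) := by
  refine LinearMap.ext fun f => funext fun γ => ?_
  simp only [Module.End.mul_apply, LinearMap.smul_apply, Pi.smul_apply, smul_eq_mul,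
    L_zero_zero_apply, L_zero_one_apply, Pi.sub_apply, Pi.single_eq_same, om_neg, om_sub]
  have h1 := om_ne_zero (1 : ZMod N)
  have h2 := om_ne_zero (γ i)
  field_simp
  ring

theorem L_one_zero_mul_L_one_one (lam : ℂ) :
    L (N := N) P i lam 1 0 * L P i (om (1 : ZMod N) * lam) 1 1 =
      om (1 : ZMod N) • (L P i lam 1 1 * L P i (om (1 : ZMod N) * lam) 1 0) := by
  refine LinearMap.ext fun f => funext fun γ => ?_
  simp only [Module.End.mul_apply, LinearMap.smul_apply, Pi.smul_apply, smul_eq_mul,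
    L_one_zero_apply, L_one_one_apply, Pi.sub_apply, Pi.single_eq_same, om_sub]
  have h1 := om_ne_zero (1 : ZMod N)
  have h2 := om_ne_zero (γ i)
  field_simp
  ring

theorem L_det_top {lam : ℂ} (hκ : P.κ (i + 1) ≠ 0) :
    L (N := N) P i lam 0 0 * L P i (om (1 : ZMod N) * lam) 1 1 -
      om (1 : ZMod N) • (L P i lam 0 1 * L P i (om (1 : ZMod N) * lam) 1 0) =
      F N P (i + 1) lam • v i := by
  refine LinearMap.ext fun f => funext fun γ => ?_
  simp only [Module.End.mul_apply, LinearMap.smul_apply, Pi.smul_apply, smul_eq_mul, v_apply,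
    LinearMap.sub_apply, Pi.sub_apply, L_zero_zero_apply, L_zero_one_apply, L_one_zero_apply,
    L_one_one_apply, Pi.single_eq_same, om_neg, om_sub, F]
  have h1 := om_ne_zero (1 : ZMod N)
  have h2 := om_ne_zero (γ i)
  field_simp
  ring

theorem L_det_bot {lam : ℂ} (hκ : P.κ (i + 1) ≠ 0) :
    L (N := N) P i lam 1 0 * L P i (om (1 : ZMod N) * lam) 0 1 -
      om (1 : ZMod N) • (L P i lam 1 1 * L P i (om (1 : ZMod N) * lam) 0 0) =
      -(om (1 : ZMod N) * F N P (i + 1) lam) • v i := by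
  refine LinearMap.ext fun f => funext fun γ => ?_
  simp only [Module.End.mul_apply, LinearMap.smul_apply, Pi.smul_apply, smul_eq_mul, v_apply,
    LinearMap.sub_apply, Pi.sub_apply, L_zero_zero_apply, L_zero_one_apply, L_one_zero_apply,
    L_one_one_apply, Pi.single_eq_same, om_neg, om_sub, F]
  have h1 := om_ne_zero (1 : ZMod N)
  have h2 := om_ne_zero (γ i)
  field_simp
  ring

/-- Together with `L_det_left`, this allows L₀₁ to be moved past the first column of L at the cost
of replacing λ by λ/ω in L₀₀. -/
theorem L_zero_one_mul_L_zero_zero (lam : ℂ) :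
    L (N := N) P i lam 0 1 * L P i lam 0 0 =
      L P i (lam / om (1 : ZMod N)) 0 0 * L P i lam 0 1 := by
  refine LinearMap.ext fun f => funext fun γ => ?_
  simp only [Module.End.mul_apply,
    L_zero_zero_apply, L_zero_one_apply, Pi.sub_apply, Pi.single_eq_same, om_neg, om_sub]
  have h1 := om_ne_zero (1 : ZMod N)
  have h2 := om_ne_zero (γ i)
  field_simp
  ring

theorem L_det_left {lam : ℂ} (hκ : P.κ (i + 1) ≠ 0) :
    L (N := N) P i lam 0 1 * L P i lam 1 0 -
      L P i (lam / om (1 : ZMod N)) 0 0 * L P i lam 1 1 =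
      -F N P (i + 1) (lam / om (1 : ZMod N)) • v i := by
  refine LinearMap.ext fun f => funext fun γ => ?_
  simp only [Module.End.mul_apply, LinearMap.smul_apply, Pi.smul_apply, smul_eq_mul, v_apply,
    LinearMap.sub_apply, Pi.sub_apply, L_zero_zero_apply, L_zero_one_apply, L_one_zero_apply,
    L_one_one_apply, Pi.single_eq_same, om_neg, om_sub, F]
  have h1 := om_ne_zero (1 : ZMod N)
  have h2 := om_ne_zero (γ i)
  field_simp
  ring

theorem L_zero_one_mul_v (lam : ℂ) :
    om (1 : ZMod N) • (L (N := N) P i lam 0 1 * v i) = v i * L P i lam 0 1 := by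
  refine LinearMap.ext fun f => funext fun γ => ?_
  simp only [Module.End.mul_apply, LinearMap.smul_apply, Pi.smul_apply, smul_eq_mul, v_apply,
    Pi.sub_apply, L_zero_one_apply, Pi.single_eq_same, om_neg, om_sub]
  have h1 := om_ne_zero (1 : ZMod N)
  have h2 := om_ne_zero (γ i)
  field_simp

theorem L_one_zero_mul_v (lam : ℂ) :
    L (N := N) P i lam 1 0 * v i = om (1 : ZMod N) • (v i * L P i lam 1 0) := by
  refine LinearMap.ext fun f => funext fun γ => ?_
  simp only [Module.End.mul_apply, LinearMap.smul_apply, Pi.smul_apply, smul_eq_mul, v_apply,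
    Pi.sub_apply, L_one_zero_apply, Pi.single_eq_same, om_sub]
  have h1 := om_ne_zero (1 : ZMod N)
  have h2 := om_ne_zero (γ i)
  field_simp

theorem L_zero_zero_mul_v (lam : ℂ) : L (N := N) P i lam 0 0 * v i = v i * L P i lam 0 0 := rfl

theorem L_one_one_mul_v (lam : ℂ) : L (N := N) P i lam 1 1 * v i = v i * L P i lam 1 1 := rfl

theorem sub_nsmul_single (n : ℕ) (f : State N m) (h : ∀ γ, P.a (i + 1) * f γ =
    P.b (i + 1) * f (γ - Pi.single i 1)) (γ : Fin m → ZMod N) :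
    P.a (i + 1) ^ n * f γ = P.b (i + 1) ^ n * f (γ - n • Pi.single i 1) := by
  induction n with
  | zero => simp
  | succ n ih =>
    rw [pow_succ', mul_assoc, ih, mul_left_comm, h, succ_nsmul, sub_add_eq_sub_sub]
    ring

/-- A kernel vector satisfies a f = b v f; going once around the cycle gives a^N f = b^N f. -/
theorem L_zero_one_injective {lam : ℂ} (hlam : lam ≠ 0)
    (hab : P.a (i + 1) ^ N ≠ P.b (i + 1) ^ N) :
    Function.Injective (L (N := N) P i lam 0 1) := by
  refine (injective_iff_map_eq_zero _).2 fun f hf => ?_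
  have h : ∀ γ, P.a (i + 1) * f γ = P.b (i + 1) * f (γ - Pi.single i 1) := by
    intro γ
    have h1 := congrFun hf γ
    rw [L_zero_one_apply, Pi.zero_apply] at h1
    have h2 := (mul_eq_zero.1 ((mul_eq_zero.1 h1).resolve_left hlam)).resolve_left (om_ne_zero _)
    exact sub_eq_zero.1 h2
  funext γ
  have h3 := sub_nsmul_single P i N f h γ
  have h5 : N • (Pi.single i 1 : Fin m → ZMod N) = 0 := by
    ext j
    simp
  rw [h5, sub_zero] at h3
  have h4 : (P.a (i + 1) ^ N - P.b (i + 1) ^ N) * f γ = 0 := by linear_combination h3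
  exact (mul_eq_zero.1 h4).resolve_left (sub_ne_zero.2 hab)

end site

/-! ### The monodromy of the first `m` sites -/

/-- `T_m(λ) = L_1(λ) ⋯ L_m(λ)`. -/
def bulkT (P : Params) (m : ℕ) (lam : ℂ) : Matrix (Fin 2) (Fin 2) (Module.End ℂ (State N m)) :=
  (List.ofFn fun i : Fin m => L P i lam).prod

theorem lift_L (P : Params) {m : ℕ} (i : Fin m) (lam : ℂ) (a b : Fin 2) :
    lift (L (N := N) P i lam a b) = L P i.castSucc lam a b := by
  fin_cases a <;> fin_cases b <;>
    simp [L, lift_u, lift_uInv, lift_v]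

theorem prod_L_castSucc (P : Params) (m : ℕ) (lam : ℂ) :
    (List.ofFn fun i : Fin m => L (N := N) P i.castSucc lam).prod =
      lift.mapMatrix (bulkT P m lam) := by
  have h : (fun i : Fin m => L (N := N) P i.castSucc lam) =
      lift.mapMatrix ∘ fun i => L P i lam := by
    funext i
    ext1 a b
    exact (lift_L P i lam a b).symm
  rw [h, bulkT, map_list_prod, List.map_ofFn]

theorem bulkT_zero (P : Params) (lam : ℂ) : bulkT (N := N) P 0 lam = 1 := rfl

theorem bulkT_succ (P : Params) (m : ℕ) (lam : ℂ) (a b : Fin 2) :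
    bulkT (N := N) P (m + 1) lam a b =
      lift (bulkT P m lam a 0) * L P (Fin.last m) lam 0 b +
        lift (bulkT P m lam a 1) * L P (Fin.last m) lam 1 b := by
  have h : bulkT (N := N) P (m + 1) lam =
      lift.mapMatrix (bulkT P m lam) * L P (Fin.last m) lam := by
    rw [← prod_L_castSucc, bulkT, List.ofFn_succ', List.prod_concat]
  rw [h, Matrix.mul_apply, Fin.sum_univ_two]
  rfl

theorem commute_lift_L (P : Params) {m : ℕ} (X : Module.End ℂ (State N m)) (lam : ℂ)
    (a b : Fin 2) : Commute (lift X) (L P (Fin.last m) lam a b) := by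
  have hv := commute_lift_v X
  have hu := commute_lift_u X
  have hu' := commute_lift_uInv X
  have h1 := Commute.one_right (lift X)
  fin_cases a <;> fin_cases b
  · exact h1.add_right (hv.smul_right (lam * P.κ ((Fin.last m : ℕ) + 1)))
  · exact (hu'.mul_right ((h1.smul_right (P.a ((Fin.last m : ℕ) + 1))).sub_right
      (hv.smul_right (P.b ((Fin.last m : ℕ) + 1))))).smul_right lam
  · exact hu.mul_right ((h1.smul_right (P.c ((Fin.last m : ℕ) + 1))).sub_right
      (hv.smul_right (P.d ((Fin.last m : ℕ) + 1))))
  · exact (h1.smul_right (lam * P.a ((Fin.last m : ℕ) + 1) * P.c ((Fin.last m : ℕ) + 1))).add_right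
      (hv.smul_right (P.b ((Fin.last m : ℕ) + 1) * P.d ((Fin.last m : ℕ) + 1) /
        P.κ ((Fin.last m : ℕ) + 1)))

theorem bulkT_succ' (P : Params) (m : ℕ) (lam : ℂ) (a b : Fin 2) :
    bulkT (N := N) P (m + 1) lam a b =
      L P (Fin.last m) lam 0 b * lift (bulkT P m lam a 0) +
        L P (Fin.last m) lam 1 b * lift (bulkT P m lam a 1) := by
  rw [bulkT_succ, (commute_lift_L P _ lam 0 b).eq, (commute_lift_L P _ lam 1 b).eq]

/-! ### Elimination of A_m, translation of all spins, and the quantum determinant. -/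

theorem left_elimination {R : Type*} [Ring R] [Algebra ℂ R] {c : ℂ} {A B α β γ δ α' x : R}
    (h : β * α = α' * β) (h' : β * γ - α' * δ = -c • x) :
    β * (α * A + γ * B) = α' * (β * A + δ * B) - c • (x * B) := by
  rw [mul_add, mul_add, ← mul_assoc, ← mul_assoc, ← mul_assoc, ← mul_assoc, h,
    sub_eq_iff_eq_add.1 h', add_mul, neg_smul, neg_mul, smul_mul_assoc]
  abel

/-- A_m drops out of the right-hand side: on a vector killed by B_{m+1}(λ), A_{m+1}(λ) is determined
by B_m(λ) alone. -/
theorem L_zero_one_mul_bulkT (P : Params) (m : ℕ) (lam : ℂ) (hκ : P.κ (m + 1) ≠ 0) :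
    L P (Fin.last m) lam 0 1 * bulkT (N := N) P (m + 1) lam 0 0 =
      L P (Fin.last m) (lam / om (1 : ZMod N)) 0 0 * bulkT P (m + 1) lam 0 1 -
        F N P (m + 1) (lam / om (1 : ZMod N)) • (v (Fin.last m) * lift (bulkT P m lam 0 1)) := by
  rw [bulkT_succ', bulkT_succ']
  exact left_elimination (L_zero_one_mul_L_zero_zero P (Fin.last m) lam)
    (L_det_left P (Fin.last m) hκ)

/-- The operator raising all spins. -/
def shift (m : ℕ) : Module.End ℂ (State N m) :=
  LinearMap.funLeft ℂ ℂ (fun γ : Fin m → ZMod N => fun i => γ i - 1)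

theorem shift_apply {m : ℕ} (f : State N m) (γ : Fin m → ZMod N) :
    shift m f γ = f (fun i => γ i - 1) := rfl

theorem shift_zero : shift (N := N) 0 = 1 := by
  refine LinearMap.ext fun f => funext fun γ => ?_
  rw [shift_apply]
  exact congrArg f (Subsingleton.elim _ _)

theorem shift_succ (m : ℕ) : shift (N := N) (m + 1) = lift (shift m) * v (Fin.last m) := by
  refine LinearMap.ext fun f => funext fun γ => ?_
  rw [shift_apply, Module.End.mul_apply, lift_apply, shift_apply, slice_apply, v_apply]
  congr 1
  ext i
  refine Fin.lastCases ?_ (fun j => ?_) i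
  · simp
  · simp [Fin.init]

theorem shift_injective (m : ℕ) : Function.Injective (shift (N := N) m) := by
  refine LinearMap.funLeft_injective_of_surjective ℂ ℂ _ fun γ => ⟨fun i => γ i + 1, ?_⟩
  ext i
  simp

/-- Charge counting: u carries charge one under translation of the spins, C_m has charge one and D_m
charge zero. The induction closes on the bottom row, since each row of T_{m+1} involves only the
same row of T_m. -/
theorem bulkT_mul_shift (P : Params) (m : ℕ) (lam : ℂ) :
    bulkT (N := N) P m lam 1 0 * shift m = om (1 : ZMod N) • (shift m * bulkT P m lam 1 0) ∧
      bulkT (N := N) P m lam 1 1 * shift m = shift m * bulkT P m lam 1 1 := by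
  induction m with
  | zero => simp [bulkT_zero, shift_zero]
  | succ m ih =>
    obtain ⟨hC, hD⟩ := ih
    have hC' := congrArg (lift (N := N)) hC
    have hD' := congrArg (lift (N := N)) hD
    rw [map_mul, map_smul, map_mul] at hC'
    rw [map_mul, map_mul] at hD'
    have hcomm : ∀ (X : Module.End ℂ (State N m)) a b,
        (lift X * L P (Fin.last m) lam a b) * (lift (shift m) * v (Fin.last m)) =
          (lift X * lift (shift m)) * (L P (Fin.last m) lam a b * v (Fin.last m)) := fun X a b =>
      Commute.mul_mul_mul_comm (commute_lift_L P (shift m) lam a b).symm _ _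
    have hcomm' : ∀ (X : Module.End ℂ (State N m)) a b,
        (lift (shift m) * lift X) * (v (Fin.last m) * L P (Fin.last m) lam a b) =
          (lift (shift m) * v (Fin.last m)) * (lift X * L P (Fin.last m) lam a b) := fun X a b =>
      Commute.mul_mul_mul_comm (commute_lift_v X) _ _
    have h01 := L_zero_one_mul_v (N := N) P (Fin.last m) lam
    have h10 := L_one_zero_mul_v (N := N) P (Fin.last m) lam
    have h00 := L_zero_zero_mul_v (N := N) P (Fin.last m) lam
    have h11 := L_one_one_mul_v (N := N) P (Fin.last m) lam
    constructor
    · rw [bulkT_succ, shift_succ, add_mul, hcomm, hcomm, hC', hD', h00, h10, mul_add, smul_add,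
        ← hcomm', ← hcomm', smul_mul_assoc, mul_smul_comm]
    · rw [bulkT_succ, shift_succ, add_mul, hcomm, hcomm, hC', hD', h11, smul_mul_assoc,
        ← mul_smul_comm, h01, mul_add, ← hcomm', ← hcomm']

/-- Unprimed letters stand for λ, primed ones for ωλ; Latin letters for the first m sites, Greek
ones for the new site. Commutation across sites collects the one-site brackets, two of which vanish
in `quantum_det`. -/
theorem quantum_det_step {R : Type*} [Ring R] [Algebra ℂ R] (w : ℂ)
    (A' B' C D α β γ δ α' β' γ' δ' : R) (hαA : Commute α A') (hαB : Commute α B')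
    (hβA : Commute β A') (hβB : Commute β B') (hγA : Commute γ A') (hγB : Commute γ B')
    (hδA : Commute δ A') (hδB : Commute δ B') :
    (C * α + D * γ) * (A' * β' + B' * δ') - w • ((C * β + D * δ) * (A' * α' + B' * γ')) =
      C * A' * (α * β' - w • (β * α')) + C * B' * (α * δ' - w • (β * γ')) +
        D * A' * (γ * β' - w • (δ * α')) + D * B' * (γ * δ' - w • (δ * γ')) := by
  simp only [add_mul, mul_add, hαA.mul_mul_mul_comm, hαB.mul_mul_mul_comm, hβA.mul_mul_mul_comm,
    hβB.mul_mul_mul_comm, hγA.mul_mul_mul_comm, hγB.mul_mul_mul_comm, hδA.mul_mul_mul_comm,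
    hδB.mul_mul_mul_comm, mul_sub, smul_add, mul_smul_comm]
  abel

theorem quantum_det_step' {R : Type*} [Ring R] [Algebra ℂ R] {w c : ℂ} {X Y S : R}
    (h : X - w • Y = -(w * c) • S) (f : ℂ) (x : R) :
    X * (f • x) + Y * (-(w * f) • x) = -(w * (c * f)) • (S * x) := by
  rw [sub_eq_iff_eq_add.1 h, add_mul, smul_mul_smul_comm, smul_mul_smul_comm, mul_smul_comm]
  module

/-- The quantum determinant is multiplicative over sites, each site contributing F_s(λ) v_s. This
version pairs the bottom row at λ with the top row at ωλ, as needed to reach C and D. -/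
theorem quantum_det (P : Params) (m : ℕ) (lam : ℂ) (hκ : ∀ k ∈ Finset.Icc 1 m, P.κ k ≠ 0) :
    bulkT (N := N) P m lam 1 0 * bulkT P m (om (1 : ZMod N) * lam) 0 1 -
      om (1 : ZMod N) • (bulkT P m lam 1 1 * bulkT P m (om (1 : ZMod N) * lam) 0 0) =
      -(om (1 : ZMod N) * ∏ s ∈ Finset.Icc 1 m, F N P s lam) • shift m := by
  induction m with
  | zero =>
    rw [bulkT_zero, bulkT_zero, shift_zero]
    simp only [ne_eq, one_ne_zero, not_false_eq_true, zero_ne_one, Matrix.one_apply_ne,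
      Matrix.one_apply_eq, zero_mul, mul_one, zero_sub, Finset.Icc_eq_empty_of_lt Nat.zero_lt_one,
      Finset.prod_empty]
    exact (neg_smul _ _).symm
  | succ m ih =>
    have hκm : P.κ ((Fin.last m : ℕ) + 1) ≠ 0 := by
      rw [Fin.val_last]
      exact hκ _ (by simp)
    have ih' := congrArg (lift (N := N)) (ih fun k hk => hκ k (by
      rw [Finset.mem_Icc] at hk ⊢
      omega))
    rw [map_sub, map_smul, map_smul, map_mul, map_mul] at ih'
    rw [bulkT_succ P m lam, bulkT_succ P m lam, bulkT_succ P m (om 1 * lam),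
      bulkT_succ P m (om 1 * lam), quantum_det_step _ _ _ _ _ _ _ _ _ _ _ _ _
      (commute_lift_L P _ lam _ _).symm (commute_lift_L P _ lam _ _).symm
      (commute_lift_L P _ lam _ _).symm (commute_lift_L P _ lam _ _).symm
      (commute_lift_L P _ lam _ _).symm (commute_lift_L P _ lam _ _).symm
      (commute_lift_L P _ lam _ _).symm (commute_lift_L P _ lam _ _).symm,
      L_zero_zero_mul_L_zero_one, L_one_zero_mul_L_one_one, L_det_top P _ hκm, L_det_bot P _ hκm,
      sub_self, sub_self, mul_zero, mul_zero, zero_add, add_zero, Fin.val_last,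
      quantum_det_step' ih', ← shift_succ, Finset.prod_Icc_succ_top (by omega)]

/-- The values of A_m at 0 and ∞, the two data besides the zeros of B_m that interpolation needs.
The statements on B_m serve only to carry the induction, so its top coefficient is left unspecified.
-/
theorem isPoly_bulkT (P : Params) (m : ℕ) :
    (∀ (f : State N m) γ, IsPoly m (fun lam => bulkT P m lam 0 0 f γ)
      ((∏ k ∈ Finset.Icc 1 m, P.κ k) * shift m f γ)) ∧
    (∀ (f : State N m) γ, ∃ t, IsPoly m (fun lam => bulkT P m lam 0 1 f γ) t) ∧
    bulkT (N := N) P m 0 0 0 = 1 ∧ bulkT (N := N) P m 0 0 1 = 0 := by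
  induction m with
  | zero =>
    refine ⟨fun f γ => ?_, fun f γ => ⟨0, ?_⟩, rfl, rfl⟩
    · simpa [bulkT_zero, shift_zero] using IsPoly.const (f γ)
    · simpa [bulkT_zero] using IsPoly.const 0
  | succ m ih =>
    obtain ⟨hA, hB, hA0, hB0⟩ := ih
    refine ⟨fun f γ => ?_, fun f γ => ?_, ?_, ?_⟩
    · set x := γ (Fin.last m)
      -- L₁₀ does not depend on λ, so it is evaluated at 0.
      obtain ⟨t, ht⟩ := hB (slice x (L P (Fin.last m) 0 1 0 f)) (Fin.init γ)
      have h := ((hA (slice x f) (Fin.init γ)).succ.add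
        (((hA (slice x (v (Fin.last m) f)) (Fin.init γ)).id_mul).const_mul
          (P.κ (m + 1)))).add ht.succ
      convert h using 1
      · funext lam
        rw [bulkT_succ, LinearMap.add_apply, Module.End.mul_apply, Module.End.mul_apply,
          Pi.add_apply, lift_apply, lift_apply, L_zero_zero]
        simp only [LinearMap.add_apply, Module.End.one_apply, LinearMap.smul_apply, map_add,
          map_smul, Pi.add_apply, Pi.smul_apply, smul_eq_mul, Fin.val_last]
        rw [L_one_zero, L_one_zero]
        ring
      · rw [Finset.prod_Icc_succ_top (by omega), shift_succ, Module.End.mul_apply, lift_apply]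
        ring
    · set x := γ (Fin.last m)
      obtain ⟨t, ht⟩ := hB (slice x f) (Fin.init γ)
      obtain ⟨t', ht'⟩ := hB (slice x (v (Fin.last m) f)) (Fin.init γ)
      -- L₀₁(λ) = λ L₀₁(1), which accounts for the extra factor λ here.
      have h := ((hA (slice x (L P (Fin.last m) 1 0 1 f)) (Fin.init γ)).id_mul.add
        (ht.id_mul.const_mul (P.a (m + 1) * P.c (m + 1)))).add
        (ht'.succ.const_mul (P.b (m + 1) * P.d (m + 1) / P.κ (m + 1)))
      refine ⟨_, (congrArg (fun f => IsPoly (m + 1) f _) ?_).mp h⟩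
      funext lam
      symm
      rw [bulkT_succ, LinearMap.add_apply, Module.End.mul_apply, Module.End.mul_apply,
        Pi.add_apply, lift_apply, lift_apply, L_one_one, L_zero_one, L_zero_one]
      simp only [LinearMap.add_apply, Module.End.one_apply, LinearMap.smul_apply, map_add,
        map_smul, Pi.add_apply, Pi.smul_apply, smul_eq_mul, Fin.val_last, one_smul]
      ring
    · rw [bulkT_succ, hA0, hB0, map_one, map_zero, L_zero_zero]
      simp
    · rw [bulkT_succ, hA0, hB0, map_one, map_zero, L_zero_one]
      simp

/-! ### Amplitudes: the Fermat points are regular -/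

theorem prod_Icc_one (f : ℕ → ℂ) (M : ℕ) : ∏ s ∈ Finset.Icc 1 M, f s = ∏ i : Fin M, f (i + 1) := by
  rw [Fin.prod_univ_eq_prod_range (fun i => f (i + 1))]
  induction M with
  | zero => simp
  | succ M ih => rw [Finset.prod_Icc_succ_top (by omega), ih, Finset.prod_range_succ]

theorem prod_range_succ_eq (f : ℕ → ℂ) (M : ℕ) :
    ∏ s ∈ Finset.range (M + 1), f s = f 0 * ∏ s ∈ Finset.Icc 1 M, f s := by
  rw [Finset.prod_range_succ', prod_Icc_one, Fin.prod_univ_eq_prod_range (fun i => f (i + 1)),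
    mul_comm]

theorem rt_succ (S : Roots) (M : ℕ) :
    rt S (M + 1) = S.R (M + 1) 0 * ∏ j : Fin M, S.R (M + 1) (j + 1) := by
  rw [rt, prod_range_succ_eq, prod_Icc_one]

theorem eps_mul_self (N : ℕ) : eps N * eps N = 1 := by
  rw [eps, ← mul_pow]
  simp

theorem eps_ne_zero (N : ℕ) : eps N ≠ 0 := by
  rw [eps]
  exact pow_ne_zero _ (by norm_num)

theorem IsPoly.top_unique {d : ℕ} {f : ℂ → ℂ} {s t : ℂ} (h : IsPoly d f s) (h' : IsPoly d f t) :
    s = t := by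
  obtain ⟨p, -, rfl, hp⟩ := h
  obtain ⟨q, -, rfl, hq⟩ := h'
  rw [Polynomial.funext fun x => (hp x).trans (hq x).symm]

theorem IsPoly.continuous {d : ℕ} {f : ℂ → ℂ} {t : ℂ} (h : IsPoly d f t) : Continuous f := by
  obtain ⟨p, -, -, hp⟩ := h
  exact (funext hp : (fun x => p.eval x) = f) ▸ p.continuous

theorem avgT_zero (P : Params) (Λ : ℂ) : avgT N P 0 Λ = 1 := rfl

theorem avgT_succ (P : Params) (m : ℕ) (Λ : ℂ) :
    avgT N P (m + 1) Λ = avgT N P m Λ * avgL N P (m + 1) Λ := by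
  rw [avgT, List.ofFn_succ', List.prod_concat]
  simp [avgT]

theorem avgT_det (P : Params) (m : ℕ) (Λ : ℂ) :
    (avgT N P m Λ).det = ∏ k ∈ Finset.Icc 1 m, (avgL N P k Λ).det := by
  induction m with
  | zero => simp [avgT_zero]
  | succ m ih => rw [avgT_succ, Matrix.det_mul, ih, Finset.prod_Icc_succ_top (by omega)]

theorem avgL_det (P : Params) (k : ℕ) (Λ : ℂ) (hκ : P.κ k ≠ 0) :
    (avgL N P k Λ).det = (P.b k ^ N - eps N * Λ * (P.a k ^ N * P.κ k ^ N)) *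
      (P.d k ^ N / P.κ k ^ N - eps N * Λ * P.c k ^ N) := by
  have hκ' : P.κ k ^ N ≠ 0 := pow_ne_zero _ hκ
  rw [avgL, Matrix.det_fin_two_of]
  field_simp
  ring

theorem isPoly_avgT (P : Params) (m : ℕ) :
    IsPoly m (fun Λ => avgT N P m Λ 0 0) ((-eps N) ^ m * ∏ k ∈ Finset.Icc 1 m, P.κ k ^ N) ∧
    (∃ t, IsPoly m (fun Λ => avgT N P m Λ 0 1) t) ∧
    avgT N P m 0 0 0 = 1 ∧ avgT N P m 0 0 1 = 0 := by
  induction m with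
  | zero =>
    refine ⟨?_, ⟨0, ?_⟩, rfl, rfl⟩
    · simpa [avgT_zero] using IsPoly.const 1
    · simpa [avgT_zero] using IsPoly.const 0
  | succ m ih =>
    obtain ⟨hA, ⟨t, hB⟩, hA0, hB0⟩ := ih
    refine ⟨?_, ?_, ?_, ?_⟩
    · have h := (hA.succ.add (hA.id_mul.const_mul (-eps N * P.κ (m + 1) ^ N))).add
        (hB.succ.const_mul (P.c (m + 1) ^ N - P.d (m + 1) ^ N))
      convert h using 1
      · funext Λ
        rw [avgT_succ, Matrix.mul_apply, Fin.sum_univ_two]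
        simp [avgL]
        ring
      · rw [Finset.prod_Icc_succ_top (by omega)]
        ring
    · have h := ((hA.id_mul.const_mul (-eps N * (P.a (m + 1) ^ N - P.b (m + 1) ^ N))).add
        (hB.succ.const_mul (P.b (m + 1) ^ N * P.d (m + 1) ^ N / P.κ (m + 1) ^ N))).add
        (hB.id_mul.const_mul (-eps N * P.a (m + 1) ^ N * P.c (m + 1) ^ N))
      refine ⟨_, (congrArg (fun f => IsPoly (m + 1) f _) ?_).mp h⟩
      funext Λ
      rw [avgT_succ, Matrix.mul_apply, Fin.sum_univ_two]
      simp [avgL]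
      ring
    · rw [avgT_succ, Matrix.mul_apply, Fin.sum_univ_two, hA0, hB0]
      simp [avgL]
    · rw [avgT_succ, Matrix.mul_apply, Fin.sum_univ_two, hA0, hB0]
      simp [avgL]

/-- Comparison of the factorised forms of `𝓑_m` and `𝓑_{m+1}`: leading coefficients. -/
theorem avg_leading {P : Params} {S : Roots} {M : ℕ} {e f r : ℂ}
    (hB : ∀ Λ, avgT N P (M + 1) Λ 0 1 = (-eps N) ^ (M + 1) * Λ * S.R (M + 1) 0 ^ N *
      ∏ s ∈ Finset.Icc 1 M, (Λ - eps N * S.R (M + 1) s ^ N))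
    (h : ∀ Λ, avgT N P (M + 1) Λ 0 0 * (-eps N * Λ * r) + avgT N P (M + 1) Λ 0 1 *
      (e - eps N * Λ * f) = (-eps N) ^ (M + 2) * Λ * S.R (M + 2) 0 ^ N *
      ∏ s ∈ Finset.Icc 1 (M + 1), (Λ - eps N * S.R (M + 2) s ^ N)) :
    S.R (M + 2) 0 ^ N = S.R (M + 1) 0 ^ N * f + (∏ k ∈ Finset.Icc 1 (M + 1), P.κ k ^ N) * r := by
  obtain ⟨hA, -, -, -⟩ := isPoly_avgT (N := N) P (M + 1)
  have hp1 := (isPoly_prod_sub (Finset.Icc 1 M) fun s => eps N * S.R (M + 1) s ^ N)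
  have hp2 := (isPoly_prod_sub (Finset.Icc 1 (M + 1)) fun s => eps N * S.R (M + 2) s ^ N)
  rw [Nat.card_Icc, Nat.add_sub_cancel] at hp1 hp2
  have hB' := (hp1.id_mul).const_mul ((-eps N) ^ (M + 1) * S.R (M + 1) 0 ^ N)
  have hB2 := (hp2.id_mul).const_mul ((-eps N) ^ (M + 2) * S.R (M + 2) 0 ^ N)
  have hL := ((hA.id_mul.const_mul (-eps N * r)).add (hB'.succ.const_mul e)).add
    (hB'.id_mul.const_mul (-eps N * f))
  have heq := hL.top_unique ((congrArg (fun f => IsPoly (M + 1 + 1) f _) ?_).mp hB2)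
  · have h0 : (-eps N) ^ (M + 2) ≠ 0 := pow_ne_zero _ (neg_ne_zero.2 (eps_ne_zero N))
    refine mul_left_cancel₀ h0 ?_
    linear_combination -heq
  · funext Λ
    have h1 := h Λ
    rw [hB] at h1
    linear_combination -h1

/-- Comparison of the factorised forms of `𝓑_m` and `𝓑_{m+1}`: coefficients of `Λ`. -/
theorem avg_trailing {P : Params} {S : Roots} {M : ℕ} {e f r : ℂ}
    (hB : ∀ Λ, avgT N P (M + 1) Λ 0 1 = (-eps N) ^ (M + 1) * Λ * S.R (M + 1) 0 ^ N *
      ∏ s ∈ Finset.Icc 1 M, (Λ - eps N * S.R (M + 1) s ^ N))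
    (h : ∀ Λ, avgT N P (M + 1) Λ 0 0 * (-eps N * Λ * r) + avgT N P (M + 1) Λ 0 1 *
      (e - eps N * Λ * f) = (-eps N) ^ (M + 2) * Λ * S.R (M + 2) 0 ^ N *
      ∏ s ∈ Finset.Icc 1 (M + 1), (Λ - eps N * S.R (M + 2) s ^ N)) :
    rt S (M + 2) ^ N = r + rt S (M + 1) ^ N * e := by
  obtain ⟨hA, -, hA0, -⟩ := isPoly_avgT (N := N) P (M + 1)
  have hp1 := (isPoly_prod_sub (Finset.Icc 1 M) fun s => eps N * S.R (M + 1) s ^ N).continuous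
  have hp2 := (isPoly_prod_sub (Finset.Icc 1 (M + 1))
    fun s => eps N * S.R (M + 2) s ^ N).continuous
  have hcont := hA.continuous
  -- Both sides carry a factor Λ; after cancelling it for Λ ≠ 0 the identity extends to Λ = 0 by
  -- continuity.
  have key : (fun Λ => avgT N P (M + 1) Λ 0 0 * (-eps N * r) + (-eps N) ^ (M + 1) *
      S.R (M + 1) 0 ^ N * (∏ s ∈ Finset.Icc 1 M, (Λ - eps N * S.R (M + 1) s ^ N)) *
      (e - eps N * Λ * f)) = fun Λ => (-eps N) ^ (M + 2) * S.R (M + 2) 0 ^ N *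
      ∏ s ∈ Finset.Icc 1 (M + 1), (Λ - eps N * S.R (M + 2) s ^ N) := by
    refine Continuous.ext_on (dense_compl_singleton (0 : ℂ)) (by fun_prop) (by fun_prop) ?_
    intro Λ hΛ
    have h1 := h Λ
    rw [hB] at h1
    refine mul_left_cancel₀ (show Λ ≠ 0 from hΛ) ?_
    linear_combination h1
  have h0 := congrFun key 0
  simp only [hA0, zero_sub, mul_zero, zero_mul, sub_zero] at h0
  have hneg : ∀ m M, ∏ s ∈ Finset.Icc 1 M, -(eps N * S.R m s ^ N) =
      (-eps N) ^ M * ∏ s ∈ Finset.Icc 1 M, S.R m s ^ N := by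
    intro m M
    simp_rw [← neg_mul]
    rw [Finset.prod_mul_distrib, Finset.prod_const, Nat.card_Icc, Nat.add_sub_cancel]
  rw [hneg, hneg] at h0
  have hsq : ∀ k : ℕ, (-eps N) ^ k * (-eps N) ^ k = 1 := by
    intro k
    rw [← mul_pow, neg_mul_neg, eps_mul_self, one_pow]
  have hrt : ∀ M, rt S (M + 1) ^ N =
      S.R (M + 1) 0 ^ N * ∏ s ∈ Finset.Icc 1 M, S.R (M + 1) s ^ N := by
    intro M
    rw [rt, prod_range_succ_eq, mul_pow, Finset.prod_pow]
  rw [hrt, hrt]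
  have h1 := hsq M
  have h2 := hsq (M + 1)
  refine mul_left_cancel₀ (neg_ne_zero.2 (eps_ne_zero N)) ?_
  rw [pow_succ (-eps N) (M + 1), pow_succ (-eps N) M] at h0
  rw [pow_succ (-eps N) M] at h2
  generalize (-eps N) ^ M = E at *
  linear_combination -h0 - (eps N * S.R (M + 1) 0 ^ N * e *
    (∏ s ∈ Finset.Icc 1 M, S.R (M + 1) s ^ N)) * h1 + eps N * (S.R (M + 2) 0 ^ N *
    ∏ s ∈ Finset.Icc 1 (M + 1), S.R (M + 2) s ^ N) * h2

/-! ### Nonvanishing amplitudes and regular points for a fixed generic choice. -/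

section choice
variable {n : ℕ} {P : Params} {S : Roots}

theorem IsChoice.avg_rec (hS : IsChoice N n P S) {M : ℕ} (hM : M + 2 ≤ n) (Λ : ℂ) :
    avgT N P (M + 1) Λ 0 0 * (-eps N * Λ * S.r (M + 2) ^ N) + avgT N P (M + 1) Λ 0 1 *
      (P.b (M + 2) ^ N * P.d (M + 2) ^ N / P.κ (M + 2) ^ N -
        eps N * Λ * (P.a (M + 2) ^ N * P.c (M + 2) ^ N)) =
      (-eps N) ^ (M + 2) * Λ * S.R (M + 2) 0 ^ N *
      ∏ s ∈ Finset.Icc 1 (M + 1), (Λ - eps N * S.R (M + 2) s ^ N) := by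
  have h := hS.avgB (M + 2) (Finset.mem_Icc.2 ⟨by omega, hM⟩) Λ
  rw [avgT_succ, Matrix.mul_apply, Fin.sum_univ_two] at h
  rw [hS.site (M + 2) (Finset.mem_Icc.2 ⟨by omega, hM⟩)]
  simp only [avgL, Matrix.cons_val', Matrix.cons_val_zero, Matrix.cons_val_one,
    Matrix.cons_val_fin_one, Matrix.of_apply] at h
  rw [show M + 2 - 1 = M + 1 by omega, show M + 1 + 1 = M + 2 from rfl] at h
  linear_combination h

/-- Written with a term `0` so that it has the shape of `IsChoice.avg_rec` with e = 0; the
comparison lemmas then cover the bulk and the boundary alike. -/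
theorem IsChoice.avg_rec_bdry {M : ℕ} (hS : IsChoice N (M + 1) P S) (Λ : ℂ) :
    avgT N P (M + 1) Λ 0 0 * (-eps N * Λ * P.a0 ^ N) + avgT N P (M + 1) Λ 0 1 *
      (0 - eps N * Λ * (P.a0 ^ N * P.c (M + 2) ^ N)) =
      (-eps N) ^ (M + 2) * Λ * S.R (M + 2) 0 ^ N *
      ∏ s ∈ Finset.Icc 1 (M + 1), (Λ - eps N * S.R (M + 2) s ^ N) := by
  have h := hS.avgB_bdry Λ
  rw [avgTBdry, Matrix.mul_apply, Fin.sum_univ_two] at h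
  simp only [avgLBdry, Matrix.cons_val', Matrix.cons_val_zero, Matrix.cons_val_one,
    Matrix.cons_val_fin_one, Matrix.of_apply] at h
  rw [show M + 1 + 1 = M + 2 from rfl] at h
  linear_combination h

theorem IsChoice.avgB_eq (hS : IsChoice N n P S) {M : ℕ} (hM : M + 1 ≤ n) (Λ : ℂ) :
    avgT N P (M + 1) Λ 0 1 = (-eps N) ^ (M + 1) * Λ * S.R (M + 1) 0 ^ N *
      ∏ s ∈ Finset.Icc 1 M, (Λ - eps N * S.R (M + 1) s ^ N) :=
  hS.avgB (M + 1) (Finset.mem_Icc.2 ⟨by omega, hM⟩) Λ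

theorem R_ne_zero (hS : IsChoice N n P S) (hg : IsGeneric N n P S) {M s : ℕ} (hM : M + 1 ≤ n)
    (hs : s < M + 1) : S.R (M + 1) s ≠ 0 := by
  rcases Nat.eq_zero_or_pos M with rfl | h
  -- Genericity constrains `R` only from m = 2 on; for m = 1 the amplitude is r_1.
  · obtain rfl : s = 0 := by omega
    rw [zero_add, hS.first]
    exact hg.r_ne 1 (Finset.mem_Icc.2 ⟨le_rfl, hM⟩)
  · exact hg.R_ne (M + 1) (Finset.mem_Icc.2 ⟨by omega, hM⟩) s (Finset.mem_range.2 hs)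

/-- At the boundary the phase convention r̃_{n+1} = ω a_0 already forces every factor to be nonzero.
-/
theorem R_bdry_ne_zero (hS : IsChoice N n P S) (hg : IsGeneric N n P S) {s : ℕ}
    (hs : s < n + 1) : S.R (n + 1) s ≠ 0 := by
  have h : rt S (n + 1) ≠ 0 := by
    rw [hS.rt_bdry]
    exact mul_ne_zero (om_ne_zero _) hg.a0_ne
  exact Finset.prod_ne_zero_iff.1 h s (Finset.mem_range.2 hs)

theorem R_ne_zero' (hS : IsChoice N n P S) (hg : IsGeneric N n P S) {M s : ℕ} (hM : M ≤ n)
    (hs : s < M + 1) : S.R (M + 1) s ≠ 0 := by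
  rcases hM.eq_or_lt with rfl | h
  · exact R_bdry_ne_zero hS hg hs
  · exact R_ne_zero hS hg h hs

theorem r_ne_zero (hS : IsChoice N n P S) (hg : IsGeneric N n P S) {M : ℕ} (hM : M ≤ n) :
    S.r (M + 1) ≠ 0 := by
  rcases hM.eq_or_lt with rfl | h
  · rw [hS.site_bdry]
    exact hg.a0_ne
  · exact hg.r_ne _ (Finset.mem_Icc.2 ⟨by omega, h⟩)

theorem rt_ne_zero (hS : IsChoice N n P S) (hg : IsGeneric N n P S) {M : ℕ} (hM : M ≤ n) :
    rt S (M + 1) ≠ 0 :=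
  Finset.prod_ne_zero_iff.2 fun _ hs => R_ne_zero' hS hg hM (Finset.mem_range.1 hs)

theorem prod_κ_ne_zero (hg : IsGeneric N n P S) {M : ℕ} (hM : M ≤ n) :
    ∏ k ∈ Finset.Icc 1 M, P.κ k ≠ 0 :=
  Finset.prod_ne_zero_iff.2 fun k hk => hg.κ_ne k
    (Finset.mem_Icc.2 ⟨(Finset.mem_Icc.1 hk).1, (Finset.mem_Icc.1 hk).2.trans hM⟩)

theorem regular_of_pow_ne_one {p : ℂ × ℂ} (h : OnFermat N p) (hx : p.1 ^ N ≠ 1) : Regular N p := by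
  refine ⟨h, fun h0 => hx ?_⟩
  rw [OnFermat, h0, zero_pow (NeZero.ne N), add_zero] at h
  exact h

theorem regular_pSite (hS : IsChoice N n P S) (hg : IsGeneric N n P S) {M : ℕ} (hM : M + 1 ≤ n) :
    Regular N (pSite P S (M + 1)) := by
  have hk := Finset.mem_Icc.2 ⟨Nat.le_add_left 1 M, hM⟩
  have ha := hg.a_ne _ hk
  have hb := hg.b_ne _ hk
  refine ⟨?_, div_ne_zero hb ha⟩
  rw [OnFermat, pSite, div_pow, div_pow, hS.site _ hk]
  field_simp
  ring

/-- The Fermat relation for p_{m,0} is the comparison of the leading coefficients of consecutive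
averaged B's. -/
theorem regular_pZero (hS : IsChoice N n P S) (hg : IsGeneric N n P S) {M : ℕ}
    (hM : M + 2 ≤ n) : Regular N (pZero P S (M + 2)) := by
  have hR := R_ne_zero hS hg hM (Nat.succ_pos _)
  have h := avg_leading (hS.avgB_eq (by omega)) (hS.avg_rec hM)
  refine ⟨?_, div_ne_zero (mul_ne_zero (prod_κ_ne_zero hg (by omega)) (r_ne_zero hS hg (by omega)))
    hR⟩
  rw [OnFermat, pZero, show M + 2 - 1 = M + 1 by omega, div_pow, div_pow, mul_pow, mul_pow,
    mul_pow, ← Finset.prod_pow, ← add_div, div_eq_one_iff_eq (pow_ne_zero _ hR), h]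
  ring

theorem regular_pZeroBdry {M : ℕ} (hS : IsChoice N (M + 1) P S) (hg : IsGeneric N (M + 1) P S) :
    Regular N (pZeroBdry P S (M + 1)) := by
  have hR := R_bdry_ne_zero hS hg (Nat.succ_pos _)
  have h := avg_leading (hS.avgB_eq (by omega)) hS.avg_rec_bdry
  refine ⟨?_, div_ne_zero (mul_ne_zero (prod_κ_ne_zero hg le_rfl) hg.a0_ne) hR⟩
  rw [OnFermat, pZeroBdry, div_pow, div_pow, mul_pow, mul_pow,
    mul_pow, ← Finset.prod_pow, ← add_div, div_eq_one_iff_eq (pow_ne_zero _ hR), h]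
  ring

/-- The Fermat relation for p̃_m is the comparison of their lowest coefficients. -/
theorem regular_pTilde (hS : IsChoice N n P S) (hg : IsGeneric N n P S) {M : ℕ}
    (hM : M + 2 ≤ n) : Regular N (pTilde P S (M + 2)) := by
  have hk := Finset.mem_Icc.2 ⟨Nat.le_add_left 1 (M + 1), hM⟩
  have hk2 := Finset.mem_Icc.2 ⟨Nat.le_add_left 2 M, hM⟩
  have hR := rt_ne_zero hS hg (M := M + 1) (by omega)
  have hR' := rt_ne_zero hS hg (M := M) (by omega)
  have h := avg_trailing (hS.avgB_eq (by omega)) (hS.avg_rec hM)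
  have hκ := hg.κ_ne _ hk
  refine ⟨?_, div_ne_zero (mul_ne_zero (mul_ne_zero (hg.b_ne _ hk) (hg.d_ne _ hk2)) hR')
    (mul_ne_zero hκ hR)⟩
  rw [OnFermat, pTilde, show M + 2 - 1 = M + 1 by omega, div_pow, div_pow, mul_pow, mul_pow,
    mul_pow]
  rw [show M + 1 + 1 = M + 2 from rfl] at hR hκ
  field_simp
  rw [h]
  field_simp

theorem avgL_det_ne_zero (hg : IsGeneric N n P S) {M s : ℕ} (hM : M + 2 ≤ n)
    (hs : s ∈ Finset.Icc 1 (M + 1)) {k : ℕ} (hk : k ∈ Finset.Icc 1 n) :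
    (avgL N P k (eps N * S.R (M + 2) s ^ N)).det ≠ 0 := by
  have h := hg.det_ne (M + 2) (Finset.mem_Icc.2 ⟨by omega, hM⟩) s hs
  rw [avgT_det] at h
  exact Finset.prod_ne_zero_iff.1 h k hk

theorem avgT_det_ne_zero (hg : IsGeneric N n P S) {M s : ℕ} (hM : M + 2 ≤ n)
    (hs : s ∈ Finset.Icc 1 (M + 1)) : (avgT N P (M + 2) (eps N * S.R (M + 2) s ^ N)).det ≠ 0 := by
  rw [avgT_det]
  exact Finset.prod_ne_zero_iff.2 fun k hk => avgL_det_ne_zero hg hM hs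
    (Finset.mem_Icc.2 ⟨(Finset.mem_Icc.1 hk).1, (Finset.mem_Icc.1 hk).2.trans hM⟩)

/-- At x = r_{m,s} and k = m the two factors are nonzero precisely when the abscissas of p_{m,s} and
p̃_{m,s} have N-th power different from 1. -/
theorem avgL_det_at (P : Params) (k : ℕ) (x : ℂ) (hκ : P.κ k ≠ 0) :
    (avgL N P k (eps N * x ^ N)).det = (P.b k ^ N - (P.a k * P.κ k * x) ^ N) *
      (P.d k ^ N / P.κ k ^ N - (P.c k * x) ^ N) := by
  have h := eps_mul_self N
  rw [avgL_det P k _ hκ, show eps N * (eps N * x ^ N) = x ^ N by rw [← mul_assoc, h, one_mul]]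
  ring

theorem regular_pPos (hS : IsChoice N n P S) (hg : IsGeneric N n P S) {M s : ℕ} (hM : M + 2 ≤ n)
    (hs : s ∈ Finset.Icc 1 (M + 1)) : Regular N (pPos P S (M + 2) s) := by
  have hk := Finset.mem_Icc.2 ⟨Nat.le_add_left 1 (M + 1), hM⟩
  have h := avgL_det_ne_zero hg hM hs hk
  rw [avgL_det_at _ _ _ (hg.κ_ne _ hk)] at h
  refine regular_of_pow_ne_one (hS.fermat_y (M + 2) (Finset.mem_Icc.2 ⟨by omega, hM⟩) s hs)
    fun h1 => left_ne_zero_of_mul h ?_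
  rw [pPos, div_pow, div_eq_one_iff_eq (pow_ne_zero _ (hg.b_ne _ hk))] at h1
  rw [h1, sub_self]

theorem regular_ptPos (hS : IsChoice N n P S) (hg : IsGeneric N n P S) {M s : ℕ} (hM : M + 2 ≤ n)
    (hs : s ∈ Finset.Icc 1 (M + 1)) : Regular N (ptPos P S (M + 2) s) := by
  have hk := Finset.mem_Icc.2 ⟨Nat.le_add_left 1 (M + 1), hM⟩
  have hk2 := Finset.mem_Icc.2 ⟨Nat.le_add_left 2 M, hM⟩
  have h := avgL_det_ne_zero hg hM hs hk
  have hκ := hg.κ_ne _ hk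
  have hR := R_ne_zero hS hg hM (s := s) (by rw [Finset.mem_Icc] at hs; omega)
  rw [avgL_det_at _ _ _ hκ] at h
  refine regular_of_pow_ne_one (hS.fermat_yt (M + 2) (Finset.mem_Icc.2 ⟨by omega, hM⟩) s hs)
    fun h1 => right_ne_zero_of_mul h ?_
  rw [ptPos, div_pow, div_eq_one_iff_eq (pow_ne_zero _ (mul_ne_zero (mul_ne_zero hκ
    (hg.c_ne _ hk2)) hR))] at h1
  rw [h1, sub_eq_zero, div_eq_iff (pow_ne_zero _ hκ)]
  ring

theorem regular_pCross_same (hS : IsChoice N n P S) (hg : IsGeneric N n P S) {M s s' : ℕ}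
    (hM : M + 2 ≤ n) (hs : s ∈ Finset.Icc 1 (M + 1)) (hs' : s' ∈ Finset.Icc 1 (M + 1))
    (hne : s ≠ s') : Regular N (pCross S (M + 2) s (M + 2) s') := by
  have hm := Finset.mem_Icc.2 ⟨Nat.le_add_left 2 M, hM⟩
  refine regular_of_pow_ne_one (hS.fermat_same (M + 2) hm s hs s' hs' hne) fun h1 =>
    hg.R_simple (M + 2) hm s hs s' hs' hne ?_
  have hR := R_ne_zero hS hg hM (s := s') (by rw [Finset.mem_Icc] at hs'; omega)
  rwa [pCross, div_pow, div_eq_one_iff_eq (pow_ne_zero _ hR)] at h1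

/-- At a common zero of two consecutive averaged B's the recursion leaves only the upper left entry
of the averaged monodromy times a nonzero factor. That entry would then vanish, and with it the
determinant. -/
theorem R_pow_ne {e f r : ℂ} (hS : IsChoice N n P S) (hg : IsGeneric N n P S) {M k l : ℕ}
    (hM : M + 2 ≤ n) (hk : k ∈ Finset.Icc 1 (M + 2)) (hl : l ∈ Finset.Icc 1 (M + 1)) (hr : r ≠ 0)
    (h : ∀ Λ, avgT N P (M + 2) Λ 0 0 * (-eps N * Λ * r) + avgT N P (M + 2) Λ 0 1 *
      (e - eps N * Λ * f) = (-eps N) ^ (M + 3) * Λ * S.R (M + 3) 0 ^ N *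
      ∏ s ∈ Finset.Icc 1 (M + 2), (Λ - eps N * S.R (M + 3) s ^ N)) :
    S.R (M + 3) k ^ N ≠ S.R (M + 2) l ^ N := by
  intro heq
  have h1 := h (eps N * S.R (M + 2) l ^ N)
  have hB := hS.avgB_eq hM (eps N * S.R (M + 2) l ^ N)
  rw [Finset.prod_eq_zero hl (sub_self _), mul_zero] at hB
  have h0 : ∏ s ∈ Finset.Icc 1 (M + 2), (eps N * S.R (M + 2) l ^ N - eps N * S.R (M + 3) s ^ N)
      = 0 := Finset.prod_eq_zero hk (by rw [heq, sub_self])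
  have hdet := avgT_det_ne_zero hg hM hl
  have hR := R_ne_zero hS hg hM (s := l) (by rw [Finset.mem_Icc] at hl; omega)
  rw [Matrix.det_fin_two, hB, zero_mul, sub_zero] at hdet
  rw [hB, h0, zero_mul, add_zero, mul_zero] at h1
  refine mul_ne_zero (left_ne_zero_of_mul hdet) (mul_ne_zero (mul_ne_zero (neg_ne_zero.2
    (eps_ne_zero N)) (mul_ne_zero (eps_ne_zero N) (pow_ne_zero _ hR))) hr) h1

theorem regular_pCross_next (hS : IsChoice N n P S) (hg : IsGeneric N n P S) {M k l : ℕ}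
    (hM : M + 2 ≤ n) (hk : k ∈ Finset.Icc 1 (M + 2)) (hl : l ∈ Finset.Icc 1 (M + 1)) :
    Regular N (pCross S (M + 3) k (M + 2) l) := by
  have hm := Finset.mem_Icc.2 ⟨Nat.le_add_left 2 M, hM⟩
  have hR := R_ne_zero hS hg hM (s := l) (by rw [Finset.mem_Icc] at hl; omega)
  have hne : S.R (M + 3) k ^ N ≠ S.R (M + 2) l ^ N := by
    rcases hM.eq_or_lt with rfl | hlt
    · exact R_pow_ne hS hg le_rfl hk hl (pow_ne_zero _ hg.a0_ne) hS.avg_rec_bdry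
    · exact R_pow_ne hS hg hM hk hl (pow_ne_zero _ (r_ne_zero hS hg (M := M + 2) (by omega)))
        (hS.avg_rec hlt)
  refine regular_of_pow_ne_one (hS.fermat_next (M + 2) hm k hk l hl) fun h1 => hne ?_
  rwa [pCross, div_pow, div_eq_one_iff_eq (pow_ne_zero _ hR)] at h1

end choice

/-! ### Shifts of the kernels `K_m` -/

theorem pos_succ (M : ℕ) : pos (M + 1) = Finset.univ.map (Fin.succEmb M) := by
  ext i
  refine Fin.cases ?_ (fun j => ?_) i <;> simp [pos, Fin.succ_ne_zero]

theorem prod_pos (M : ℕ) (f : Fin (M + 1) → ℂ) : ∏ l ∈ pos (M + 1), f l = ∏ l : Fin M, f l.succ := by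
  rw [pos_succ, Finset.prod_map]
  rfl

theorem prod_pos_erase (M : ℕ) (j : Fin M) (f : Fin (M + 1) → ℂ) :
    ∏ l ∈ (pos (M + 1)).erase j.succ, f l = ∏ l ∈ Finset.univ.erase j, f l.succ := by
  have h : (pos (M + 1)).erase j.succ = (Finset.univ.erase j).map (Fin.succEmb M) := by
    rw [pos_succ, Finset.map_erase]
    rfl
  rw [h, Finset.prod_map]
  rfl

theorem prod_Icc_erase (M : ℕ) (k : Fin M) (f : ℕ → ℂ) :
    ∏ s ∈ (Finset.Icc 1 M).erase (k + 1), f s = ∏ s ∈ Finset.univ.erase k, f ((s : ℕ) + 1) := by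
  symm
  refine Finset.prod_bij (fun s _ => (s : ℕ) + 1) ?_ ?_ ?_ ?_
  · intro s hs
    have h1 := Finset.ne_of_mem_erase hs
    rw [Finset.mem_erase, Finset.mem_Icc]
    have := Fin.val_ne_of_ne h1
    omega
  · intro s _ t _ h
    exact Fin.ext (by omega)
  · intro b hb
    rw [Finset.mem_erase, Finset.mem_Icc] at hb
    refine ⟨⟨b - 1, by omega⟩, Finset.mem_erase.2 ⟨fun h => ?_, Finset.mem_univ _⟩, ?_⟩
    · have := congrArg Fin.val h
      simp only at this
      omega
    · simp only
      omega
  · intro s _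
    rfl

theorem tail_sub_single (M : ℕ) (ρ : Fin (M + 1) → ZMod N) (k : Fin M) :
    Fin.tail (ρ - Pi.single k.succ 1) = Fin.tail ρ - Pi.single k 1 := by
  ext j
  simp [Fin.tail, Pi.single_apply]

theorem tail_add_single (M : ℕ) (ρ : Fin (M + 1) → ZMod N) (k : Fin M) :
    Fin.tail (ρ + Pi.single k.succ 1) = Fin.tail ρ + Pi.single k 1 := by
  ext j
  simp [Fin.tail, Pi.single_apply]

theorem prod_sub_single {M : ℕ} (k : Fin M) (f : Fin M → ZMod N → ℂ) (σ : Fin M → ZMod N) {c : ℂ}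
    (h : f k (σ k - 1) = f k (σ k) * c) :
    ∏ l, f l ((σ - Pi.single k 1 : Fin M → ZMod N) l) = (∏ l, f l (σ l)) * c := by
  rw [← Finset.mul_prod_erase _ _ (Finset.mem_univ k),
    ← Finset.mul_prod_erase _ (fun l => f l (σ l)) (Finset.mem_univ k),
    Finset.prod_congr rfl fun l hl => by
      rw [Pi.sub_apply, Pi.single_eq_of_ne (Finset.ne_of_mem_erase hl), sub_zero],
    Pi.sub_apply, Pi.single_eq_same, h]
  ring

/-- Only the pairs containing `k` change: the factors `c` come from row `k`, the factors `d` from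
column `k`. -/
theorem prod_pair_sub_single {M : ℕ} (k : Fin M) (g : Fin M → Fin M → ZMod N → ℂ)
    (σ : Fin M → ZMod N) {c d : Fin M → ℂ}
    (hc : ∀ l ≠ k, g k l (σ k - σ l - 1) = g k l (σ k - σ l) * c l)
    (hd : ∀ j ≠ k, g j k (σ j - σ k + 1) = g j k (σ j - σ k) * d j) :
    ∏ j, ∏ l ∈ Finset.univ.erase j, g j l ((σ - Pi.single k 1 : Fin M → ZMod N) j - (σ - Pi.single k 1 : Fin M → ZMod N) l) =
      (∏ j, ∏ l ∈ Finset.univ.erase j, g j l (σ j - σ l)) *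
        ((∏ l ∈ Finset.univ.erase k, c l) * ∏ j ∈ Finset.univ.erase k, d j) := by
  have h1 : ∀ l ∈ Finset.univ.erase k,
      g k l ((σ - Pi.single k 1 : Fin M → ZMod N) k - (σ - Pi.single k 1 : Fin M → ZMod N) l) = g k l (σ k - σ l) * c l := by
    intro l hl
    rw [Pi.sub_apply, Pi.single_eq_same, Pi.sub_apply,
      Pi.single_eq_of_ne (Finset.ne_of_mem_erase hl), sub_zero, ← hc l (Finset.ne_of_mem_erase hl)]
    congr 1
    ring
  have h2 : ∀ j ∈ Finset.univ.erase k,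
      ∏ l ∈ Finset.univ.erase j, g j l ((σ - Pi.single k 1 : Fin M → ZMod N) j - (σ - Pi.single k 1 : Fin M → ZMod N) l) =
        (∏ l ∈ Finset.univ.erase j, g j l (σ j - σ l)) * d j := by
    intro j hj
    have hjk := Finset.ne_of_mem_erase hj
    have hk : k ∈ Finset.univ.erase j := Finset.mem_erase.2 ⟨hjk.symm, Finset.mem_univ k⟩
    rw [← Finset.mul_prod_erase _ _ hk, ← Finset.mul_prod_erase _ (fun l => g j l (σ j - σ l)) hk,
      Finset.prod_congr rfl fun l hl => by
        rw [Pi.sub_apply, Pi.sub_apply, Pi.single_eq_of_ne (Finset.ne_of_mem_erase hl),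
          Pi.single_eq_of_ne hjk, sub_zero, sub_zero],
      Pi.sub_apply, Pi.sub_apply, Pi.single_eq_same, Pi.single_eq_of_ne hjk, sub_zero,
      show σ j - (σ k - 1) = σ j - σ k + 1 by ring, hd j hjk]
    ring
  rw [← Finset.mul_prod_erase _ _ (Finset.mem_univ k),
    ← Finset.mul_prod_erase _ (fun j => ∏ l ∈ Finset.univ.erase j, g j l (σ j - σ l))
      (Finset.mem_univ k), Finset.prod_congr rfl h1, Finset.prod_congr rfl h2,
    Finset.prod_mul_distrib, Finset.prod_mul_distrib]
  ring

/-- The kernel `K_m` for `m = M + 1`, as a function of the labels with indices `≥ 1`. -/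
def kernelK (P : Params) (S : Roots) (M : ℕ) (σ : Fin M → ZMod N) (σ' : Fin (M + 1) → ZMod N) : ℂ :=
  (∏ l : Fin M, ∏ k : Fin (M + 1), w (pCross S (M + 2) (k + 1) (M + 1) (l + 1)) (σ l - σ' k)) /
    (∏ j : Fin M, ∏ l ∈ Finset.univ.erase j, w (pCross S (M + 1) (l + 1) (M + 1) (j + 1)) (σ j - σ l)) *
    ∏ l : Fin M, w (pPos P S (M + 1) (l + 1)) (-σ l) / w (ptPos P S (M + 1) (l + 1)) (σ l)

theorem coreQ_eq (P : Params) (S : Roots) (M : ℕ) (ρ : Fin (M + 1) → ZMod N)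
    (ρ' : Fin (M + 2) → ZMod N) :
    coreQ P S (M + 1) ρ ρ' = kernelK P S M (Fin.tail ρ) (Fin.tail ρ') := by
  rw [coreQ, kernelK, prod_pos, prod_pos, prod_pos]
  simp only [prod_pos, prod_pos_erase, Fin.val_succ]
  rfl

section kernel
variable {n : ℕ} {P : Params} {S : Roots}

theorem fin_mem_Icc {M : ℕ} (k : Fin M) : (k : ℕ) + 1 ∈ Finset.Icc 1 M :=
  Finset.mem_Icc.2 ⟨by omega, k.isLt⟩

theorem regular_cross (hS : IsChoice N n P S) (hg : IsGeneric N n P S) {M : ℕ} (hM : M + 1 ≤ n)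
    (k : Fin (M + 1)) (l : Fin M) : Regular N (pCross S (M + 2) (k + 1) (M + 1) (l + 1)) := by
  -- The index `l : Fin M` forces M ≥ 1, so the level m = M + 1 is at least 2, where the choice
  -- provides points.
  obtain ⟨M, rfl⟩ : ∃ M', M = M' + 1 := ⟨M - 1, by have := l.pos; omega⟩
  exact regular_pCross_next hS hg hM (fin_mem_Icc k) (fin_mem_Icc l)

theorem regular_same (hS : IsChoice N n P S) (hg : IsGeneric N n P S) {M : ℕ} (hM : M + 1 ≤ n)
    {j l : Fin M} (h : j ≠ l) : Regular N (pCross S (M + 1) (j + 1) (M + 1) (l + 1)) := by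
  obtain ⟨M, rfl⟩ : ∃ M', M = M' + 1 := ⟨M - 1, by have := l.pos; omega⟩
  exact regular_pCross_same hS hg hM (fin_mem_Icc j) (fin_mem_Icc l) (by
    have := Fin.val_ne_of_ne h
    omega)

theorem regular_pos (hS : IsChoice N n P S) (hg : IsGeneric N n P S) {M : ℕ} (hM : M + 1 ≤ n)
    (l : Fin M) : Regular N (pPos P S (M + 1) (l + 1)) := by
  obtain ⟨M, rfl⟩ : ∃ M', M = M' + 1 := ⟨M - 1, by have := l.pos; omega⟩
  exact regular_pPos hS hg hM (fin_mem_Icc l)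

theorem regular_ptilde (hS : IsChoice N n P S) (hg : IsGeneric N n P S) {M : ℕ} (hM : M + 1 ≤ n)
    (l : Fin M) : Regular N (ptPos P S (M + 1) (l + 1)) := by
  obtain ⟨M, rfl⟩ : ∃ M', M = M' + 1 := ⟨M - 1, by have := l.pos; omega⟩
  exact regular_ptPos hS hg hM (fin_mem_Icc l)

theorem kernelK_ne_zero (hS : IsChoice N n P S) (hg : IsGeneric N n P S) {M : ℕ} (hM : M + 1 ≤ n)
    (σ : Fin M → ZMod N) (σ' : Fin (M + 1) → ZMod N) : kernelK P S M σ σ' ≠ 0 := by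
  refine mul_ne_zero (div_ne_zero ?_ ?_) ?_
  · exact Finset.prod_ne_zero_iff.2 fun l _ => Finset.prod_ne_zero_iff.2 fun k _ =>
      (regular_cross hS hg hM k l).w_ne_zero _
  · exact Finset.prod_ne_zero_iff.2 fun j _ => Finset.prod_ne_zero_iff.2 fun l hl =>
      (regular_same hS hg hM (Finset.ne_of_mem_erase hl)).w_ne_zero _
  · exact Finset.prod_ne_zero_iff.2 fun l _ => div_ne_zero ((regular_pos hS hg hM l).w_ne_zero _)
      ((regular_ptilde hS hg hM l).w_ne_zero _)

theorem kernelK_add_single_right (hS : IsChoice N n P S) (hg : IsGeneric N n P S) {M : ℕ}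
    (hM : M + 1 ≤ n) (σ : Fin M → ZMod N) (σ' : Fin (M + 1) → ZMod N) (k : Fin (M + 1)) :
    kernelK P S M σ (σ' + Pi.single k 1) = kernelK P S M σ σ' *
      ∏ l : Fin M, ((1 - om (σ l - σ' k) * (S.R (M + 2) (k + 1) / S.R (M + 1) (l + 1))) /
        S.yy (M + 2) (k + 1) (M + 1) (l + 1)) := by
  have h : ∀ l : Fin M, ∏ k' : Fin (M + 1), w (pCross S (M + 2) (k' + 1) (M + 1) (l + 1))
      (σ l - (σ' + Pi.single k 1 : Fin (M + 1) → ZMod N) k') =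
      (∏ k' : Fin (M + 1), w (pCross S (M + 2) (k' + 1) (M + 1) (l + 1)) (σ l - σ' k')) *
      ((1 - om (σ l - σ' k) * (S.R (M + 2) (k + 1) / S.R (M + 1) (l + 1))) /
        S.yy (M + 2) (k + 1) (M + 1) (l + 1)) := by
    intro l
    -- Raising σ'_k lowers the argument of w, so the one-coordinate lemma is applied to -σ'.
    have h1 := prod_sub_single k
      (fun (k' : Fin (M + 1)) x => w (pCross S (M + 2) (k' + 1) (M + 1) (l + 1)) (σ l + x)) (-σ')
      (c := (1 - om (σ l - σ' k) * (S.R (M + 2) (k + 1) / S.R (M + 1) (l + 1))) /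
        S.yy (M + 2) (k + 1) (M + 1) (l + 1)) (by
        have h2 := (regular_cross hS hg hM k l).w_sub_one (σ l - σ' k)
        rw [Pi.neg_apply, ← add_sub_assoc, ← sub_eq_add_neg]
        exact h2)
    simpa [sub_eq_add_neg, add_comm, add_left_comm, add_assoc] using h1
  rw [kernelK, Finset.prod_congr rfl fun l _ => h l, Finset.prod_mul_distrib, kernelK]
  ring

theorem kernelK_sub_single_left (hS : IsChoice N n P S) (hg : IsGeneric N n P S) {M : ℕ}
    (hM : M + 1 ≤ n) (σ : Fin M → ZMod N) (σ' : Fin (M + 1) → ZMod N) (k : Fin M) :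
    kernelK P S M (σ - Pi.single k 1) σ' = kernelK P S M σ σ' *
      ((∏ k' : Fin (M + 1), ((1 - om (σ k - σ' k') * (S.R (M + 2) (k' + 1) / S.R (M + 1) (k + 1))) /
        S.yy (M + 2) (k' + 1) (M + 1) (k + 1))) /
      ((∏ l ∈ Finset.univ.erase k,
          ((1 - om (σ k - σ l) * (S.R (M + 1) (l + 1) / S.R (M + 1) (k + 1))) /
            S.yy (M + 1) (l + 1) (M + 1) (k + 1))) *
        ∏ j ∈ Finset.univ.erase k, (S.yy (M + 1) (k + 1) (M + 1) (j + 1) /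
            (1 - om (σ j - σ k + 1) * (S.R (M + 1) (k + 1) / S.R (M + 1) (j + 1))))) *
      (S.y (M + 1) (k + 1) / (1 - om (-σ k + 1) * (pPos P S (M + 1) (k + 1)).1) *
        (S.yt (M + 1) (k + 1) / (1 - om (σ k) * (ptPos P S (M + 1) (k + 1)).1)))) := by
  have h1 := prod_sub_single k
    (fun (l : Fin M) x => ∏ k' : Fin (M + 1), w (pCross S (M + 2) (k' + 1) (M + 1) (l + 1)) (x - σ' k')) σ
    (c := ∏ k' : Fin (M + 1), ((1 - om (σ k - σ' k') *
      (S.R (M + 2) (k' + 1) / S.R (M + 1) (k + 1))) / S.yy (M + 2) (k' + 1) (M + 1) (k + 1))) (by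
      rw [← Finset.prod_mul_distrib]
      refine Finset.prod_congr rfl fun k' _ => ?_
      rw [sub_right_comm, (regular_cross hS hg hM k' k).w_sub_one]
      rfl)
  have h2 := prod_pair_sub_single k
    (fun j l : Fin M => w (pCross S (M + 1) (l + 1) (M + 1) (j + 1))) σ
    (c := fun l : Fin M => (1 - om (σ k - σ l) * (S.R (M + 1) (l + 1) / S.R (M + 1) (k + 1))) /
            S.yy (M + 1) (l + 1) (M + 1) (k + 1))
    (d := fun j : Fin M => S.yy (M + 1) (k + 1) (M + 1) (j + 1) /
            (1 - om (σ j - σ k + 1) * (S.R (M + 1) (k + 1) / S.R (M + 1) (j + 1))))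
    (fun l hl => (regular_same hS hg hM hl).w_sub_one _)
    (fun j hj => (regular_same hS hg hM hj.symm).w_add_one _)
  have h3 := prod_sub_single k
    (fun (l : Fin M) x => w (pPos P S (M + 1) (l + 1)) (-x) / w (ptPos P S (M + 1) (l + 1)) x) σ
    (c := S.y (M + 1) (k + 1) / (1 - om (-σ k + 1) * (pPos P S (M + 1) (k + 1)).1) *
        (S.yt (M + 1) (k + 1) / (1 - om (σ k) * (ptPos P S (M + 1) (k + 1)).1))) (by
      rw [neg_sub, sub_eq_neg_add, (regular_pos hS hg hM k).w_add_one,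
        (regular_ptilde hS hg hM k).w_sub_one, div_mul_eq_div_div, mul_div_right_comm,
        div_div_eq_mul_div]
      change _ / _ * (S.y (M + 1) (k + 1) / _) * S.yt (M + 1) (k + 1) / _ = _
      ring)
  rw [kernelK, h1, h2, h3, kernelK, mul_div_mul_comm]
  ring

end kernel

/-! ### The zeros of the eigenvalues of B_m and the residue identity. -/

section
variable {n : ℕ} {P : Params} {S : Roots}

theorem zeroB_sub_single_self {M : ℕ} (σ : Fin M → ZMod N) (k : Fin M) :
    zeroB S (σ - Pi.single k 1) k = om (1 : ZMod N) * zeroB S σ k := by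
  rw [zeroB, zeroB, Pi.sub_apply, Pi.single_eq_same, neg_sub, sub_eq_add_neg, om_add]
  ring

theorem zeroB_ne_zero (hS : IsChoice N n P S) (hg : IsGeneric N n P S) {M : ℕ} (hM : M ≤ n)
    (σ : Fin M → ZMod N) (k : Fin M) : zeroB S σ k ≠ 0 :=
  mul_ne_zero (neg_ne_zero.2 (R_ne_zero' hS hg hM (by omega))) (om_ne_zero _)

/-- The N-th power of a zero forgets its label and depends only on r_{m,k}^N, so simplicity of the
averaged roots separates different indices for any two labels. -/
theorem zeroB_ne (hg : IsGeneric N n P S) {M : ℕ} (hM : M + 1 ≤ n)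
    (σ τ : Fin M → ZMod N) {k l : Fin M} (hkl : k ≠ l) : zeroB S σ k ≠ zeroB S τ l := by
  obtain ⟨M, rfl⟩ : ∃ M', M = M' + 1 := ⟨M - 1, by have := l.pos; omega⟩
  intro h
  refine hg.R_simple (M + 2) (Finset.mem_Icc.2 ⟨by omega, hM⟩) (k + 1) (fin_mem_Icc k) (l + 1)
    (fin_mem_Icc l) (fun h => hkl (Fin.ext (by omega))) ?_
  have h1 := congrArg (fun x => x ^ N) h
  simp only [zeroB, mul_pow, om_pow_card, mul_one, neg_pow (S.R _ _)] at h1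
  exact mul_left_cancel₀ (pow_ne_zero _ (by norm_num)) h1

theorem zeroB_injective (hg : IsGeneric N n P S) {M : ℕ} (hM : M + 1 ≤ n)
    (σ : Fin M → ZMod N) : Function.Injective (zeroB S σ) := by
  intro k l h
  by_contra hkl
  exact zeroB_ne hg hM σ σ hkl h

/-- Translates a recursion factor of `w` at a crossed point into a difference of zeros -rω^{-ρ}. -/
theorem one_sub_om_mul_div {x y : ℂ} (hy : y ≠ 0) (a b : ZMod N) :
    1 - om (a - b) * (x / y) = (-y * om (-a) - -x * om (-b)) / (-y * om (-a)) := by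
  have h1 := om_ne_zero a
  have h2 := om_ne_zero b
  rw [om_sub, om_neg, om_neg]
  field_simp
  ring

/-- The coefficient in `A_m(λ_{m,k}) Ψ_ρ = φ_k Ψ_{ρ + e_k}`, for `m = M + 1`; it depends on the
labels with indices `≥ 1` only. -/
def phi (P : Params) (S : Roots) (M : ℕ) (σ : Fin M → ZMod N) (k : Fin M) : ℂ :=
  -(rt S M / S.r (M + 1)) * F N P (M + 1) (zeroB S σ k / om (1 : ZMod N)) * om (-∑ j, σ j) *
    ∏ s ∈ Finset.Icc 1 (M - 1), S.yy (M + 1) (k + 1) M s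

theorem phases_fin (hS : IsChoice N n P S) {M : ℕ} (hM : M + 1 ≤ n) (k : Fin M) :
    rt S (M + 1) * S.R (M + 2) 0 * S.r (M + 1) /
        (rt S M * S.R (M + 1) 0 * S.r (M + 2) * P.b (M + 1) * P.c (M + 1) *
          S.y (M + 1) (k + 1) * S.yt (M + 1) (k + 1)) *
      ((∏ s ∈ Finset.univ.erase k, S.yy (M + 1) (k + 1) (M + 1) (s + 1)) /
        ∏ s ∈ Finset.univ.erase k, S.yy (M + 1) (s + 1) (M + 1) (k + 1)) *
      ((∏ k' : Fin (M + 1), S.yy (M + 2) (k' + 1) (M + 1) (k + 1)) /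
        ∏ s ∈ Finset.Icc 1 (M - 1), S.yy (M + 1) (k + 1) M s) = 1 := by
  have hk := k.pos
  have h := hS.phases (M + 2) (Finset.mem_Icc.2 ⟨by omega, by omega⟩) (k + 1) (fin_mem_Icc k)
  rw [show M + 2 - 1 = M + 1 by omega, show M + 2 - 2 = M by omega,
    show M + 2 - 3 = M - 1 by omega, prod_Icc_erase, prod_Icc_one, Finset.prod_div_distrib] at h
  exact h

theorem prod_ne_zero {ι : Type*} [Fintype ι] {f : ι → ℂ} (h : ∀ i, f i ≠ 0) : ∏ i, f i ≠ 0 :=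
  Finset.prod_ne_zero_iff.2 fun i _ => h i

/-- The scalar content of `kernelK_match`, each product being one letter: `PZ`, `PS`, `PW` are
products of differences of zeros, the `Y`'s are products of y-coordinates. The essential inputs are
the phase relation `hph` and the product of all zeros `hneg`. -/
theorem residue_algebra {PZ PS PW Y1 Ya Yb Y3 z Pn K ω y yt Fb Fd b c rtM r1 r2 R10 R20 Rall E : ℂ}
    {n : ℕ} (hω : ω ≠ 0) (hz : z ≠ 0) (hPS : PS ≠ 0) (hPW : PW ≠ 0) (hFb : Fb ≠ 0) (hFd : Fd ≠ 0)
    (hb : b ≠ 0) (hc : c ≠ 0) (hY1 : Y1 ≠ 0) (hYa : Ya ≠ 0) (hYb : Yb ≠ 0) (hy : y ≠ 0)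
    (hyt : yt ≠ 0) (hE : E ≠ 0) (hRall : Rall ≠ 0) (hR10 : R10 ≠ 0) (hR20 : R20 ≠ 0) (hr1 : r1 ≠ 0)
    (hr2 : r2 ≠ 0) (hrt : rtM ≠ 0)
    (hph : R10 * Rall * R20 * r1 / (rtM * R10 * r2 * b * c * y * yt) * (Yb / Ya) * (Y1 / Y3) = 1)
    (hneg : -z * Pn = Rall * E) :
    PZ / PS * K = r2 / R20 * ω⁻¹ * (-(rtM / r1) * (Fb * Fd) * (ω * E) * Y3) / PW *
      (K * (PZ / z ^ (n + 1 + 1) / Y1 / ((PS / z ^ n / Ya) * (Yb / (PW / Pn))) *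
        (y / (Fb / b) * (yt / (Fd / (z * c)))))) := by
  -- If Y3 were 0, division by zero would give 0 and `hph` would read 0 = 1.
  have hY3 : Y3 ≠ 0 := by
    rintro rfl
    simp at hph
  have hPn : Pn = -(Rall * E / z) := by
    field_simp
    linear_combination -hneg
  subst hPn
  field_simp at hph
  field_simp
  linear_combination PZ * K * z ^ 2 * z ^ n * hph

/-- The residue identity behind the action of `B_{m+1}`. -/
theorem kernelK_match (hS : IsChoice N n P S) (hg : IsGeneric N n P S) {M : ℕ} (hM : M + 1 ≤ n)
    (σ : Fin M → ZMod N) (σ' : Fin (M + 1) → ZMod N) (k : Fin M) :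
    (∏ k', (zeroB S σ k - zeroB S σ' k')) /
        (∏ s ∈ Finset.univ.erase k, (zeroB S σ k - zeroB S σ s)) * kernelK P S M σ σ' =
      S.r (M + 2) / S.R (M + 2) 0 * (om (1 : ZMod N))⁻¹ * phi P S M (σ - Pi.single k 1) k /
        (∏ s ∈ Finset.univ.erase k, (om (1 : ZMod N) * zeroB S σ k - zeroB S σ s)) *
        kernelK P S M (σ - Pi.single k 1) σ' := by
  have hk := fin_mem_Icc k
  have hm : M + 1 ∈ Finset.Icc 1 n := Finset.mem_Icc.2 ⟨by omega, hM⟩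
  have hm2 : M + 1 ∈ Finset.Icc 2 n := Finset.mem_Icc.2 ⟨by have := k.pos; omega, hM⟩
  have hRk : ∀ l : Fin M, S.R (M + 1) (l + 1) ≠ 0 := fun l => R_ne_zero hS hg hM (by omega)
  have hz := zeroB_ne_zero hS hg (by omega) σ
  have hb := hg.b_ne _ hm
  have hc := hg.c_ne _ hm2
  have hκ := hg.κ_ne _ hm
  have hω := om_ne_zero (1 : ZMod N)
  have e1 : ∀ k' : Fin (M + 1), 1 - om (σ k - σ' k') * (S.R (M + 2) (k' + 1) / S.R (M + 1) (k + 1))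
      = (zeroB S σ k - zeroB S σ' k') / zeroB S σ k := fun k' => one_sub_om_mul_div (hRk k) _ _
  have e2 : ∀ l : Fin M, 1 - om (σ k - σ l) * (S.R (M + 1) (l + 1) / S.R (M + 1) (k + 1))
      = (zeroB S σ k - zeroB S σ l) / zeroB S σ k := fun l => one_sub_om_mul_div (hRk k) _ _
  have e3 : ∀ j : Fin M, 1 - om (σ j - σ k + 1) * (S.R (M + 1) (k + 1) / S.R (M + 1) (j + 1))
      = (om (1 : ZMod N) * zeroB S σ k - zeroB S σ j) / (-zeroB S σ j) := by
    intro j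
    have h := one_sub_om_mul_div (x := S.R (M + 1) (k + 1)) (hRk j) (σ j) (σ k - 1)
    rw [← sub_add] at h
    rw [h, neg_sub, show (1 : ZMod N) - σ k = 1 + -σ k by ring, om_add, ← neg_div_neg_eq, zeroB, zeroB]
    congr 1
    ring
  have e4 : 1 - om (-σ k + 1) * (pPos P S (M + 1) (k + 1)).1 =
      (P.b (M + 1) + om (1 : ZMod N) * P.a (M + 1) * P.κ (M + 1) * zeroB S σ k) / P.b (M + 1) := by
    rw [pPos, zeroB, om_add]
    field_simp
    ring
  have e5 : 1 - om (σ k) * (ptPos P S (M + 1) (k + 1)).1 =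
      (zeroB S σ k * P.c (M + 1) + P.d (M + 1) / P.κ (M + 1)) / (zeroB S σ k * P.c (M + 1)) := by
    have h1 := om_ne_zero (σ k)
    have h2 := hRk k
    rw [ptPos, zeroB, om_neg]
    field_simp
    ring
  have n4 := (regular_pos hS hg hM k).one_sub_ne_zero (-σ k + 1)
  have n5 := (regular_ptilde hS hg hM k).one_sub_ne_zero (σ k)
  rw [e4] at n4
  rw [e5] at n5
  have n4' := (div_ne_zero_iff.1 n4).1
  have n5' := (div_ne_zero_iff.1 n5).1
  have hPS : ∏ s ∈ Finset.univ.erase k, (zeroB S σ k - zeroB S σ s) ≠ 0 :=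
    Finset.prod_ne_zero_iff.2 fun s hs =>
      sub_ne_zero.2 (zeroB_ne hg hM σ σ (Finset.ne_of_mem_erase hs).symm)
  have hPW : ∏ s ∈ Finset.univ.erase k, (om (1 : ZMod N) * zeroB S σ k - zeroB S σ s) ≠ 0 := by
    rw [← zeroB_sub_single_self]
    exact Finset.prod_ne_zero_iff.2 fun s hs =>
      sub_ne_zero.2 (zeroB_ne hg hM _ σ (Finset.ne_of_mem_erase hs).symm)
  have hneg : -zeroB S σ k * ∏ s ∈ Finset.univ.erase k, -zeroB S σ s =
      (∏ j : Fin M, S.R (M + 1) (j + 1)) * om (-∑ j, σ j) := by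
    rw [Finset.mul_prod_erase Finset.univ (fun s => -zeroB S σ s) (Finset.mem_univ k),
      ← Finset.sum_neg_distrib, om_sum, ← Finset.prod_mul_distrib]
    exact Finset.prod_congr rfl fun j _ => by rw [zeroB]; ring
  have hsum : om (-∑ j, (σ - Pi.single k 1 : Fin M → ZMod N) j) =
      om (1 : ZMod N) * om (-∑ j, σ j) := by
    rw [← om_add]
    congr 1
    simp [Finset.sum_sub_distrib]
    ring
  have hph := phases_fin hS hM k
  have hrt := rt_succ S M
  rw [kernelK_sub_single_left hS hg hM σ σ' k, phi, zeroB_sub_single_self, hsum,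
    mul_div_cancel_left₀ _ hω, F, e4, e5]
  simp only [e1, e2, e3]
  rw [hrt] at hph
  -- With M = M' + 1 the full product has M' + 2 factors 1/λ_k and the product without k has M', the
  -- exponents in `residue_algebra`.
  obtain ⟨M, rfl⟩ : ∃ M', M = M' + 1 := ⟨M - 1, by have := k.pos; omega⟩
  simp only [Finset.prod_div_distrib, Finset.prod_const, Finset.card_erase_of_mem,
    Finset.mem_univ, Finset.card_univ, Fintype.card_fin, Nat.add_sub_cancel]
  exact residue_algebra hω (hz k) hPS hPW n4' n5' hb hc
    (prod_ne_zero fun k' => (regular_cross hS hg hM k' k).2)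
    (Finset.prod_ne_zero_iff.2 fun l hl => (regular_same hS hg hM (Finset.ne_of_mem_erase hl)).2)
    (Finset.prod_ne_zero_iff.2 fun l hl =>
      (regular_same hS hg hM (Finset.ne_of_mem_erase hl).symm).2)
    (regular_pos hS hg hM k).2 (regular_ptilde hS hg hM k).2
    (om_ne_zero _) (prod_ne_zero hRk) (R_ne_zero hS hg hM (Nat.succ_pos _))
    (R_ne_zero' hS hg (M := M + 2) hM (Nat.succ_pos _)) (r_ne_zero hS hg (M := M + 1) (by omega))
    (r_ne_zero hS hg (M := M + 2) hM) (rt_ne_zero hS hg (M := M) (by omega)) hph hneg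

end

/-! ### Tensor products with one-site vectors -/

theorem tens_smul_left {m : ℕ} (c : ℂ) (f : State N m) (g : ZMod N → ℂ) :
    tens (c • f) g = c • tens f g := by
  ext γ
  simp [tens, mul_assoc]

theorem tens_add_left {m : ℕ} (f f' : State N m) (g : ZMod N → ℂ) :
    tens (f + f') g = tens f g + tens f' g := by
  ext γ
  simp [tens, add_mul]

theorem tens_sum_left {ι : Type*} {m : ℕ} (s : Finset ι) (f : ι → State N m) (g : ZMod N → ℂ) :
    tens (∑ i ∈ s, f i) g = ∑ i ∈ s, tens (f i) g := by
  ext γ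
  simp [tens, Finset.sum_mul, Finset.sum_apply]

theorem shift_tens {m : ℕ} (f : State N m) (g : ZMod N → ℂ) :
    shift (m + 1) (tens f g) = tens (shift m f) (fun x => g (x - 1)) := rfl

theorem psi_apply (P : Params) (S : Roots) (k : ℕ) (ρ γ : ZMod N) :
    psi P S k ρ γ = w (pSite P S k) (γ - ρ) := rfl

theorem v_tens_psi (P : Params) (S : Roots) {m : ℕ} (f : State N m) (σ : ZMod N) :
    v (Fin.last m) (tens f (psi P S (m + 1) σ)) = tens f (psi P S (m + 1) (σ + 1)) := by
  ext γ
  rw [v_apply, tens, tens, init_sub_single_last, psi_apply, psi_apply, Pi.sub_apply, Pi.single_eq_same]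
  congr 2
  ring

section
variable {n : ℕ} {P : Params} {S : Roots}

/-- The recursion of w at p_k reads a w(γ) - b w(γ-1) = r ω^γ w(γ), which makes ψ_σ an eigenvector
of u⁻¹(a - bv). -/
theorem L_zero_one_tens_psi (hS : IsChoice N n P S) (hg : IsGeneric N n P S) {m : ℕ}
    (hm : m + 1 ≤ n) (lam : ℂ) (f : State N m) (σ : ZMod N) :
    L P (Fin.last m) lam 0 1 (tens f (psi P S (m + 1) σ)) =
      (lam * S.r (m + 1) * om (-σ)) • tens f (psi P S (m + 1) σ) := by
  have hk := Finset.mem_Icc.2 ⟨Nat.le_add_left 1 m, hm⟩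
  have ha := hg.a_ne _ hk
  have hb := hg.b_ne _ hk
  ext γ
  have h := (regular_pSite hS hg hm).w_sub_one (γ (Fin.last m) - σ)
  rw [L_zero_one_apply, Pi.smul_apply, tens, tens, init_sub_single_last, psi_apply, psi_apply, Pi.sub_apply,
    Pi.single_eq_same, sub_right_comm, h, pSite, Fin.val_last, om_neg, om_neg, om_sub, smul_eq_mul]
  have h1 := om_ne_zero σ
  have h2 := om_ne_zero (γ (Fin.last m))
  field_simp
  ring

theorem L_one_one_tens_psi {m : ℕ} (lam : ℂ) (f : State N m) (σ : ZMod N) :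
    L P (Fin.last m) lam 1 1 (tens f (psi P S (m + 1) σ)) =
      (lam * P.a (m + 1) * P.c (m + 1)) • tens f (psi P S (m + 1) σ) +
        (P.b (m + 1) * P.d (m + 1) / P.κ (m + 1)) • tens f (psi P S (m + 1) (σ + 1)) := by
  rw [← v_tens_psi, L_one_one]
  rfl

/-- The action of `B_{m+1}` on `f ⊗ ψ_σ`. -/
theorem bulkT_zero_one_tens_psi (hS : IsChoice N n P S) (hg : IsGeneric N n P S) {m : ℕ}
    (hm : m + 1 ≤ n) (lam : ℂ) (f : State N m) (σ : ZMod N) :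
    bulkT P (m + 1) lam 0 1 (tens f (psi P S (m + 1) σ)) =
      (lam * S.r (m + 1) * om (-σ)) • tens (bulkT P m lam 0 0 f) (psi P S (m + 1) σ) +
      ((lam * P.a (m + 1) * P.c (m + 1)) • tens (bulkT P m lam 0 1 f) (psi P S (m + 1) σ) +
        (P.b (m + 1) * P.d (m + 1) / P.κ (m + 1)) •
          tens (bulkT P m lam 0 1 f) (psi P S (m + 1) (σ + 1))) := by
  rw [bulkT_succ', LinearMap.add_apply, Module.End.mul_apply, Module.End.mul_apply, lift_tens,
    lift_tens, L_zero_one_tens_psi hS hg hm, L_one_one_tens_psi]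

/-! ### The vectors `Ψ` -/

theorem bulkQ_eq (M : ℕ) (ρ : Fin (M + 1) → ZMod N) (σ : ZMod N) (ρ' : Fin (M + 2) → ZMod N) :
    bulkQ P S (M + 1) ρ σ ρ' = om ((∑ s, ρ' s - ∑ s, ρ s) * (σ - ρ' 0)) /
      (w (pZero P S (M + 2)) (ρ' 0 - ρ 0 - 1) * w (pTilde P S (M + 2)) (∑ s, ρ' s - σ - 1)) *
    kernelK P S M (Fin.tail ρ) (Fin.tail ρ') := by
  rw [bulkQ, coreQ_eq]

theorem Psi_succ (M : ℕ) (ρ : Fin (M + 2) → ZMod N) :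
    Psi P S (M + 2) ρ = ∑ σ, tens (∑ ρ₁, bulkQ P S (M + 1) ρ₁ σ ρ • Psi P S (M + 1) ρ₁)
      (psi P S (M + 2) σ) := by
  rw [Psi, Finset.sum_comm]
  simp only [tens_sum_left, tens_smul_left]

theorem tail_add_single_zero (M : ℕ) (ρ : Fin (M + 1) → ZMod N) :
    Fin.tail (ρ + Pi.single 0 1) = Fin.tail ρ := by
  ext j
  simp [Fin.tail, Fin.succ_ne_zero]

theorem tail_sub_single_zero (M : ℕ) (ρ : Fin (M + 1) → ZMod N) :
    Fin.tail (ρ - Pi.single 0 1) = Fin.tail ρ := by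
  ext j
  simp [Fin.tail, Fin.succ_ne_zero]

theorem sum_add_single {M : ℕ} (ρ : Fin M → ZMod N) (k : Fin M) :
    ∑ s, (ρ + Pi.single k 1 : Fin M → ZMod N) s = ∑ s, ρ s + 1 := by
  simp [Finset.sum_add_distrib]

theorem sum_sub_single {M : ℕ} (ρ : Fin M → ZMod N) (k : Fin M) :
    ∑ s, (ρ - Pi.single k 1 : Fin M → ZMod N) s = ∑ s, ρ s - 1 := by
  simp [Finset.sum_sub_distrib]

/-- K ignores the labels of index 0, and the other factors of Q involve only differences that are
unchanged when ρ_{m,0}, ρ_{m-1,0} and σ are raised together. -/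
theorem shift_Psi (M : ℕ) (ρ : Fin (M + 1) → ZMod N) :
    shift (M + 1) (Psi P S (M + 1) ρ) = Psi P S (M + 1) (ρ + Pi.single 0 1) := by
  induction M with
  | zero =>
    ext γ
    change w (pSite P S 1) (γ 0 - 1 - ρ 0) =
      w (pSite P S 1) (γ 0 - (ρ + Pi.single 0 1 : Fin 1 → ZMod N) 0)
    rw [Pi.add_apply, Pi.single_eq_same]
    congr 1
    ring
  | succ M ih =>
    rw [Psi_succ, Psi_succ, map_sum]
    refine Eq.trans ?_ (Equiv.sum_comp (Equiv.addRight (1 : ZMod N)) _)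
    refine Finset.sum_congr rfl fun σ _ => ?_
    rw [shift_tens, map_sum]
    congr 1
    · refine Eq.trans ?_
        (Equiv.sum_comp (Equiv.addRight (Pi.single 0 1 : Fin (M + 1) → ZMod N)) _)
      refine Finset.sum_congr rfl fun ρ₁ _ => ?_
      rw [map_smul, ih, Equiv.coe_addRight, Equiv.coe_addRight, bulkQ_eq, bulkQ_eq,
        tail_add_single_zero, tail_add_single_zero, sum_add_single, sum_add_single]
      simp only [Pi.add_apply, Pi.single_eq_same, add_sub_add_right_eq_sub]
    · ext x
      rw [Equiv.coe_addRight, psi_apply, psi_apply]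
      congr 1
      ring

/-- The eigenvalue of `B_{M+1}(λ)` on `Ψ_ρ`. -/
def eigM (S : Roots) {M : ℕ} (ρ : Fin (M + 1) → ZMod N) (lam : ℂ) : ℂ :=
  lam * S.R (M + 1) 0 * om (-ρ 0) * ∏ j, (lam - zeroB S (Fin.tail ρ) j)

/-- The action of `A_m` and `B_m` on the vectors `Ψ_ρ`, for `m = M + 1`. -/
structure Solved (N : ℕ) [NeZero N] (P : Params) (S : Roots) (M : ℕ) : Prop where
  B : ∀ (ρ : Fin (M + 1) → ZMod N) lam,
    bulkT P (M + 1) lam 0 1 (Psi P S (M + 1) ρ) = eigM S ρ lam • Psi P S (M + 1) ρ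
  A : ∀ (ρ : Fin (M + 1) → ZMod N) (k : Fin M),
    bulkT P (M + 1) (zeroB S (Fin.tail ρ) k) 0 0 (Psi P S (M + 1) ρ) =
      phi P S M (Fin.tail ρ) k • Psi P S (M + 1) (ρ + Pi.single k.succ 1)

/-- The action of `A_m(λ)` for all `λ`, by interpolation. -/
theorem Solved.A_interpolate {M : ℕ} (h : Solved N P S M)
    (hS : IsChoice N n P S) (hg : IsGeneric N n P S) (hM : M + 1 ≤ n)
    (ρ : Fin (M + 1) → ZMod N) (lam : ℂ) :
    bulkT P (M + 1) lam 0 0 (Psi P S (M + 1) ρ) =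
      ((∏ k, (lam - zeroB S (Fin.tail ρ) k)) / ∏ k, -zeroB S (Fin.tail ρ) k) •
        Psi P S (M + 1) ρ +
      (lam * (∏ k, (lam - zeroB S (Fin.tail ρ) k)) * ∏ k ∈ Finset.Icc 1 (M + 1), P.κ k) •
        Psi P S (M + 1) (ρ + Pi.single 0 1) +
      ∑ k, (lam * (∏ s ∈ Finset.univ.erase k, (lam - zeroB S (Fin.tail ρ) s)) /
        (zeroB S (Fin.tail ρ) k * ∏ s ∈ Finset.univ.erase k,
          (zeroB S (Fin.tail ρ) k - zeroB S (Fin.tail ρ) s)) * phi P S M (Fin.tail ρ) k) •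
        Psi P S (M + 1) (ρ + Pi.single k.succ 1) := by
  obtain ⟨hA, -, hA0, -⟩ := isPoly_bulkT (N := N) P (M + 1)
  ext γ
  have h1 := (hA (Psi P S (M + 1) ρ) γ).interpolate (zeroB_injective hg hM (Fin.tail ρ))
    (zeroB_ne_zero hS hg (by omega) (Fin.tail ρ)) lam
  rw [h1, hA0, shift_Psi]
  simp only [h.A, Pi.add_apply, Pi.smul_apply, Finset.sum_apply, smul_eq_mul,
    Module.End.one_apply, mul_assoc]

theorem sum_smul_shift {M : ℕ} (e : Fin (M + 1) → ZMod N) (c : (Fin (M + 1) → ZMod N) → ℂ)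
    (Ψ : (Fin (M + 1) → ZMod N) → State N (M + 1)) :
    ∑ ρ, c ρ • Ψ (ρ + e) = ∑ ρ, c (ρ - e) • Ψ ρ := by
  rw [← Equiv.sum_comp (Equiv.addRight e) fun ρ => c (ρ - e) • Ψ ρ]
  simp

/-- The combination of `A_m` and `B_m` met in `B_{m+1}` acts diagonally on `∑ q(ρ) Ψ_ρ` as soon as
`q` satisfies three difference equations. -/
theorem Solved.combination {M : ℕ} (h : Solved N P S M) (hS : IsChoice N n P S)
    (hg : IsGeneric N n P S) (hM : M + 1 ≤ n) {q q' : (Fin (M + 1) → ZMod N) → ℂ} {s t h0 : ℂ}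
    (σ' : Fin (M + 1) → ZMod N)
    (hlow : ∀ ρ, h0 * (∏ k, -zeroB S σ' k) * q ρ =
      s * q ρ + S.R (M + 1) 0 * om (-ρ 0) * (∏ k, -zeroB S (Fin.tail ρ) k) * q' ρ)
    (htop : ∀ ρ, h0 * q ρ = s * (∏ k ∈ Finset.Icc 1 (M + 1), P.κ k) * q (ρ - Pi.single 0 1) +
      S.R (M + 1) 0 * om (-ρ 0) * t * q ρ)
    (hres : ∀ ρ (k : Fin M), s * q (ρ - Pi.single k.succ 1) * kernelK P S M (Fin.tail ρ) σ' =
      h0 * (S.r (M + 2) / S.R (M + 2) 0) * kernelK P S M (Fin.tail ρ - Pi.single k 1) σ' * q ρ)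
    (lam : ℂ) :
    (lam * s) • bulkT P (M + 1) lam 0 0 (∑ ρ, q ρ • Psi P S (M + 1) ρ) +
      bulkT P (M + 1) lam 0 1 (∑ ρ, (lam * t * q ρ + q' ρ) • Psi P S (M + 1) ρ) =
      (lam * (h0 * ∏ k, (lam - zeroB S σ' k))) • ∑ ρ, q ρ • Psi P S (M + 1) ρ := by
  have hA : bulkT P (M + 1) lam 0 0 (∑ ρ, q ρ • Psi P S (M + 1) ρ) =
      ∑ ρ, (((∏ k, (lam - zeroB S (Fin.tail ρ) k)) / ∏ k, -zeroB S (Fin.tail ρ) k) * q ρ +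
        (lam * (∏ k, (lam - zeroB S (Fin.tail ρ) k)) * ∏ k ∈ Finset.Icc 1 (M + 1), P.κ k) *
          q (ρ - Pi.single 0 1) +
        ∑ k, (lam * (∏ s ∈ Finset.univ.erase k, (lam - zeroB S (Fin.tail ρ) s)) /
          (om (1 : ZMod N) * zeroB S (Fin.tail ρ) k * ∏ s ∈ Finset.univ.erase k,
            (om (1 : ZMod N) * zeroB S (Fin.tail ρ) k - zeroB S (Fin.tail ρ) s)) *
          phi P S M (Fin.tail ρ - Pi.single k 1) k) * q (ρ - Pi.single k.succ 1)) •
        Psi P S (M + 1) ρ := by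
    rw [map_sum]
    simp only [map_smul, h.A_interpolate hS hg hM, smul_add, Finset.smul_sum, smul_smul,
      Finset.sum_add_distrib, add_smul, Finset.sum_smul]
    rw [sum_smul_shift, Finset.sum_comm]
    simp only [sum_smul_shift]
    rw [Finset.sum_comm]
    -- Lowering the k-th label multiplies the k-th zero by ω and leaves the others fixed; this is
    -- the source of the factors ω in the residue terms.
    have hoff : ∀ (ρ : Fin (M + 1) → ZMod N) (k : Fin M), ∀ s ∈ Finset.univ.erase k,
        zeroB S (Fin.tail ρ - Pi.single k 1) s = zeroB S (Fin.tail ρ) s := by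
      intro ρ k s hs
      rw [zeroB, zeroB, Pi.sub_apply, Pi.single_eq_of_ne (Finset.ne_of_mem_erase hs), sub_zero]
    congr 1
    · congr 1
      · exact Finset.sum_congr rfl fun ρ _ => by rw [mul_comm]
      · exact Finset.sum_congr rfl fun ρ _ => by rw [tail_sub_single_zero, mul_comm]
    · refine Finset.sum_congr rfl fun ρ _ => Finset.sum_congr rfl fun k _ => ?_
      have hprod : ∀ x, ∏ s ∈ Finset.univ.erase k, (x - zeroB S (Fin.tail ρ - Pi.single k 1) s) =
          ∏ s ∈ Finset.univ.erase k, (x - zeroB S (Fin.tail ρ) s) := fun x =>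
        Finset.prod_congr rfl fun s hs => by rw [hoff ρ k s hs]
      rw [tail_sub_single, zeroB_sub_single_self, mul_comm (q _), hprod, hprod]
  have hB : bulkT P (M + 1) lam 0 1 (∑ ρ, (lam * t * q ρ + q' ρ) • Psi P S (M + 1) ρ) =
      ∑ ρ, ((lam * t * q ρ + q' ρ) * eigM S ρ lam) • Psi P S (M + 1) ρ := by
    rw [map_sum]
    simp only [map_smul, h.B, smul_smul]
  rw [hA, hB, Finset.smul_sum, Finset.smul_sum, ← Finset.sum_add_distrib]
  refine Finset.sum_congr rfl fun ρ _ => ?_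
  rw [smul_smul, smul_smul, ← add_smul]
  congr 1
  set z := zeroB S (Fin.tail ρ) with hz
  have hz0 := zeroB_ne_zero hS hg (M := M) (by omega) (Fin.tail ρ)
  -- The desired eigenvalue is interpolated at the same nodes as A_m: its value at 0 is matched by
  -- `hlow`, its top coefficient by `htop`, its values at the zeros of B_m by `hres`.
  have hprod : IsPoly (M + 1) (fun x => h0 * ∏ k, (x - zeroB S σ' k)) (h0 * 1) := by
    have := (isPoly_prod_sub Finset.univ (zeroB S σ')).const_mul h0
    rwa [Finset.card_univ, Fintype.card_fin] at this
  have hint := hprod.interpolate (zeroB_injective hg hM (Fin.tail ρ)) hz0 lam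
  rw [hint]
  have hneg : ∏ k, -z k ≠ 0 := prod_ne_zero fun k => neg_ne_zero.2 (hz0 k)
  have hterm : ∀ k : Fin M,
      s * ((lam * (∏ s ∈ Finset.univ.erase k, (lam - z s)) /
          (om (1 : ZMod N) * z k * ∏ s ∈ Finset.univ.erase k, (om (1 : ZMod N) * z k - z s)) *
          phi P S M (Fin.tail ρ - Pi.single k 1) k) * q (ρ - Pi.single k.succ 1)) =
      lam * (∏ s ∈ Finset.univ.erase k, (lam - z s)) /
        (z k * ∏ s ∈ Finset.univ.erase k, (z k - z s)) *
        (h0 * ∏ k', (z k - zeroB S σ' k')) * q ρ := by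
    intro k
    have hm := kernelK_match hS hg hM (Fin.tail ρ) σ' k
    have hK := kernelK_ne_zero hS hg hM (Fin.tail ρ) σ'
    have hr := hres ρ k
    rw [← hz] at hm
    have hPS : ∏ s ∈ Finset.univ.erase k, (z k - z s) ≠ 0 :=
      Finset.prod_ne_zero_iff.2 fun s hs =>
        sub_ne_zero.2 (zeroB_ne hg hM _ _ (Finset.ne_of_mem_erase hs).symm)
    have hPW : ∏ s ∈ Finset.univ.erase k, (om (1 : ZMod N) * z k - z s) ≠ 0 := by
      rw [hz, ← zeroB_sub_single_self]
      exact Finset.prod_ne_zero_iff.2 fun s hs =>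
        sub_ne_zero.2 (zeroB_ne hg hM _ _ (Finset.ne_of_mem_erase hs).symm)
    have hzk : z k ≠ 0 := hz0 k
    have hω := om_ne_zero (1 : ZMod N)
    -- `hres` gives only the ratio of q at two neighbouring labels through K; multiplying by K ≠ 0
    -- lets `kernelK_match` finish.
    refine mul_right_cancel₀ hK ?_
    calc _ = lam * (∏ s ∈ Finset.univ.erase k, (lam - z s)) /
          (om (1 : ZMod N) * z k * ∏ s ∈ Finset.univ.erase k, (om (1 : ZMod N) * z k - z s)) *
          phi P S M (Fin.tail ρ - Pi.single k 1) k *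
          (s * q (ρ - Pi.single k.succ 1) * kernelK P S M (Fin.tail ρ) σ') := by ring
      _ = lam * (∏ s ∈ Finset.univ.erase k, (lam - z s)) / z k * h0 * q ρ *
          (S.r (M + 2) / S.R (M + 2) 0 * (om (1 : ZMod N))⁻¹ *
            phi P S M (Fin.tail ρ - Pi.single k 1) k /
          (∏ s ∈ Finset.univ.erase k, (om (1 : ZMod N) * z k - z s)) *
          kernelK P S M (Fin.tail ρ - Pi.single k 1) σ') := by
            rw [hr]
            field_simp
      _ = _ := by
            rw [← hm]
            field_simp
  have hsum : s * ∑ k : Fin M, ((lam * (∏ s ∈ Finset.univ.erase k, (lam - z s)) /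
          (om (1 : ZMod N) * z k * ∏ s ∈ Finset.univ.erase k, (om (1 : ZMod N) * z k - z s)) *
          phi P S M (Fin.tail ρ - Pi.single k 1) k) * q (ρ - Pi.single k.succ 1)) =
      (∑ k : Fin M, lam * (∏ s ∈ Finset.univ.erase k, (lam - z s)) /
        (z k * ∏ s ∈ Finset.univ.erase k, (z k - z s)) *
        (h0 * ∏ k', (z k - zeroB S σ' k'))) * q ρ := by
    rw [Finset.mul_sum, Finset.sum_mul]
    exact Finset.sum_congr rfl fun k _ => hterm k
  have hl := hlow ρ
  have ht := htop ρ
  rw [← hz] at hl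
  simp only [zero_sub]
  rw [eigM, ← hz]
  set T := ∏ k, (lam - z k)
  set Z := ∏ k, -z k
  have hl' : h0 * (∏ k, -zeroB S σ' k) * q ρ / Z =
      s * q ρ / Z + S.R (M + 1) 0 * om (-ρ 0) * q' ρ := by
    rw [hl]
    field_simp
  linear_combination lam * hsum - lam * T * hl' - lam ^ 2 * T * ht

end

section
variable {n : ℕ} {P : Params} {S : Roots}

/-! ### Difference equations for `Q` -/

theorem bulkQ_ne_zero (hS : IsChoice N n P S) (hg : IsGeneric N n P S) {M : ℕ} (hM : M + 2 ≤ n)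
    (ρ : Fin (M + 1) → ZMod N) (σ : ZMod N) (ρ' : Fin (M + 2) → ZMod N) :
    bulkQ P S (M + 1) ρ σ ρ' ≠ 0 := by
  rw [bulkQ_eq]
  exact mul_ne_zero (div_ne_zero (om_ne_zero _) (mul_ne_zero ((regular_pZero hS hg hM).w_ne_zero _)
    ((regular_pTilde hS hg hM).w_ne_zero _))) (kernelK_ne_zero hS hg (by omega) _ _)

theorem bulkQ_sub_one (hS : IsChoice N n P S) (hg : IsGeneric N n P S) {M : ℕ} (hM : M + 2 ≤ n)
    (ρ : Fin (M + 1) → ZMod N) (σ : ZMod N) (ρ' : Fin (M + 2) → ZMod N) :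
    bulkQ P S (M + 1) ρ (σ - 1) ρ' = bulkQ P S (M + 1) ρ σ ρ' *
      (om (∑ s, ρ s - ∑ s, ρ' s) * ((1 - om (∑ s, ρ' s - σ) * (pTilde P S (M + 2)).1) /
        (pTilde P S (M + 2)).2)) := by
  have hr := regular_pTilde hS hg hM
  have h := hr.w_add_one (∑ s, ρ' s - σ - 1)
  rw [sub_add_cancel] at h
  rw [bulkQ_eq, bulkQ_eq, show ∑ s, ρ' s - (σ - 1) - 1 = ∑ s, ρ' s - σ by ring, h,
    show (∑ s, ρ' s - ∑ s, ρ s) * (σ - 1 - ρ' 0) =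
      (∑ s, ρ' s - ∑ s, ρ s) * (σ - ρ' 0) + (∑ s, ρ s - ∑ s, ρ' s) by ring, om_add]
  have h1 := hr.one_sub_ne_zero (∑ s, ρ' s - σ)
  have h2 := hr.2
  field_simp

theorem bulkQ_sub_single_zero (hS : IsChoice N n P S) (hg : IsGeneric N n P S) {M : ℕ}
    (hM : M + 2 ≤ n) (ρ : Fin (M + 1) → ZMod N) (σ : ZMod N) (ρ' : Fin (M + 2) → ZMod N) :
    bulkQ P S (M + 1) (ρ - Pi.single 0 1) σ ρ' = bulkQ P S (M + 1) ρ σ ρ' *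
      (om (σ - ρ' 0) * ((1 - om (ρ' 0 - ρ 0) * (pZero P S (M + 2)).1) /
        (pZero P S (M + 2)).2)) := by
  have hr := regular_pZero hS hg hM
  have h := hr.w_add_one (ρ' 0 - ρ 0 - 1)
  rw [sub_add_cancel] at h
  rw [bulkQ_eq, bulkQ_eq, tail_sub_single_zero, sum_sub_single, Pi.sub_apply, Pi.single_eq_same,
    show ρ' 0 - (ρ 0 - 1) - 1 = ρ' 0 - ρ 0 by ring, h,
    show (∑ s, ρ' s - (∑ s, ρ s - 1)) * (σ - ρ' 0) =
      (∑ s, ρ' s - ∑ s, ρ s) * (σ - ρ' 0) + (σ - ρ' 0) by ring, om_add]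
  have h1 := hr.one_sub_ne_zero (ρ' 0 - ρ 0)
  have h2 := hr.2
  field_simp

theorem bulkQ_sub_single_succ {M : ℕ} (ρ : Fin (M + 1) → ZMod N) (σ : ZMod N)
    (ρ' : Fin (M + 2) → ZMod N) (k : Fin M) :
    bulkQ P S (M + 1) (ρ - Pi.single k.succ 1) σ ρ' * kernelK P S M (Fin.tail ρ) (Fin.tail ρ') =
      om (σ - ρ' 0) * bulkQ P S (M + 1) ρ σ ρ' *
        kernelK P S M (Fin.tail ρ - Pi.single k 1) (Fin.tail ρ') := by
  rw [bulkQ_eq, bulkQ_eq, tail_sub_single, sum_sub_single, Pi.sub_apply,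
    Pi.single_eq_of_ne (Fin.succ_ne_zero k).symm, sub_zero,
    show (∑ s, ρ' s - (∑ s, ρ s - 1)) * (σ - ρ' 0) =
      (∑ s, ρ' s - ∑ s, ρ s) * (σ - ρ' 0) + (σ - ρ' 0) by ring, om_add]
  ring

theorem bulkQ_add_single_right (hS : IsChoice N n P S) (hg : IsGeneric N n P S) {M : ℕ}
    (hM : M + 2 ≤ n) (ρ : Fin (M + 1) → ZMod N) (σ : ZMod N) (ρ' : Fin (M + 2) → ZMod N)
    (k : Fin (M + 1)) :
    bulkQ P S (M + 1) ρ σ (ρ' + Pi.single k.succ 1) = bulkQ P S (M + 1) ρ (σ - 1) ρ' *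
      om (σ - ρ' 0 + (∑ s, ρ' s - ∑ s, ρ s)) *
      ∏ l : Fin M, ((1 - om (Fin.tail ρ l - Fin.tail ρ' k) *
        (S.R (M + 2) (k + 1) / S.R (M + 1) (l + 1))) / S.yy (M + 2) (k + 1) (M + 1) (l + 1)) := by
  rw [bulkQ_eq, bulkQ_eq, tail_add_single, sum_add_single, Pi.add_apply,
    Pi.single_eq_of_ne (Fin.succ_ne_zero k).symm, add_zero,
    kernelK_add_single_right hS hg (by omega),
    show ∑ s, ρ' s + 1 - σ - 1 = ∑ s, ρ' s - (σ - 1) - 1 by ring,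
    show (∑ s, ρ' s + 1 - ∑ s, ρ s) * (σ - ρ' 0) = (∑ s, ρ' s - ∑ s, ρ s) * (σ - 1 - ρ' 0) +
      (σ - ρ' 0 + (∑ s, ρ' s - ∑ s, ρ s)) by ring, om_add]
  ring

theorem sum_eq_head_add_tail {M : ℕ} (ρ : Fin (M + 1) → ZMod N) :
    ∑ s, ρ s = ρ 0 + ∑ j, Fin.tail ρ j := Fin.sum_univ_succ ρ

theorem prod_neg_zeroB {M : ℕ} (σ : Fin M → ZMod N) :
    ∏ k, -zeroB S σ k = (∏ j : Fin M, S.R (M + 1) (j + 1)) * om (-∑ j, σ j) := by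
  rw [← Finset.sum_neg_distrib, om_sum, ← Finset.prod_mul_distrib]
  exact Finset.prod_congr rfl fun j _ => by rw [zeroB]; ring

theorem R_zero_mul_prod_neg_zeroB {M : ℕ} (ρ : Fin (M + 1) → ZMod N) :
    S.R (M + 1) 0 * om (-ρ 0) * ∏ k, -zeroB S (Fin.tail ρ) k =
      rt S (M + 1) * om (-∑ s, ρ s) := by
  rw [prod_neg_zeroB, rt_succ, sum_eq_head_add_tail, neg_add, om_add]
  ring

/-- The eigenvalue of `B_m` at a zero of `B_{m+1}`. -/
theorem eigM_at_zeroB (hS : IsChoice N n P S) (hg : IsGeneric N n P S) {M : ℕ} (hM : M + 1 ≤ n)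
    (ρ : Fin (M + 1) → ZMod N) (σ' : Fin (M + 1) → ZMod N) (k : Fin (M + 1)) :
    eigM S ρ (zeroB S σ' k) = zeroB S σ' k * rt S (M + 1) * om (-∑ s, ρ s) *
      ∏ l : Fin M, (1 - om (Fin.tail ρ l - σ' k) * (S.R (M + 2) (k + 1) / S.R (M + 1) (l + 1))) := by
  have h : ∀ l : Fin M, zeroB S σ' k - zeroB S (Fin.tail ρ) l = -zeroB S (Fin.tail ρ) l *
      (1 - om (Fin.tail ρ l - σ' k) * (S.R (M + 2) (k + 1) / S.R (M + 1) (l + 1))) := by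
    intro l
    have hz := zeroB_ne_zero hS hg (M := M) (by omega) (Fin.tail ρ) l
    have h1 := one_sub_om_mul_div (x := S.R (M + 2) (k + 1))
      (R_ne_zero hS hg hM (s := l + 1) (by omega)) (Fin.tail ρ l) (σ' k)
    change _ = (zeroB S (Fin.tail ρ) l - zeroB S σ' k) / zeroB S (Fin.tail ρ) l at h1
    rw [h1]
    field_simp
    ring
  rw [eigM]
  simp only [h]
  rw [Finset.prod_mul_distrib, mul_assoc, mul_assoc, ← mul_assoc (om _), ← mul_assoc (S.R _ _),
    ← mul_assoc (S.R _ _), R_zero_mul_prod_neg_zeroB]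
  ring

/-! ### The induction -/

theorem Psi_one (ρ : Fin 1 → ZMod N) :
    Psi P S 1 ρ = tens (fun _ : Fin 0 → ZMod N => 1) (psi P S 1 (ρ 0)) := by
  ext γ
  rw [Psi, tens, one_mul]
  rfl

/-- One site is the step from zero sites, where T_0 = 1 and the state space is ℂ; B_1 has no zeros
besides λ = 0. -/
theorem solved_zero (hS : IsChoice N n P S) (hg : IsGeneric N n P S) (hn : 1 ≤ n) :
    Solved N P S 0 where
  A _ k := k.elim0
  B ρ lam := by
    rw [Psi_one]
    have h := bulkT_zero_one_tens_psi hS hg (m := 0) hn lam (fun _ => 1) (ρ 0)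
    have h0 : ∀ f g, tens (bulkT (N := N) P 0 lam 0 1 f) g = 0 := fun f g => by
      ext γ
      simp [bulkT_zero, tens]
    rw [h0, h0, smul_zero, smul_zero, add_zero, add_zero] at h
    refine h.trans ?_
    rw [bulkT_zero, Matrix.one_apply_eq, Module.End.one_apply, eigM, ← hS.first]
    simp

theorem sum_tens_psi_shift {m : ℕ} (f : ZMod N → State N m) :
    ∑ σ, tens (f σ) (psi P S (m + 1) (σ + 1)) = ∑ σ, tens (f (σ - 1)) (psi P S (m + 1) σ) := by
  rw [← Equiv.sum_comp (Equiv.addRight (1 : ZMod N)) fun σ =>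
    tens (f (σ - 1)) (psi P S (m + 1) σ)]
  simp

theorem bulkT_zero_one_sum_tens (hS : IsChoice N n P S) (hg : IsGeneric N n P S) {m : ℕ}
    (hm : m + 1 ≤ n) (lam : ℂ) (f : ZMod N → State N m) :
    bulkT P (m + 1) lam 0 1 (∑ σ, tens (f σ) (psi P S (m + 1) σ)) =
      ∑ σ, tens ((lam * (S.r (m + 1) * om (-σ))) • bulkT P m lam 0 0 (f σ) +
        bulkT P m lam 0 1 ((lam * (P.a (m + 1) * P.c (m + 1))) • f σ +
          (P.b (m + 1) * P.d (m + 1) / P.κ (m + 1)) • f (σ - 1))) (psi P S (m + 1) σ) := by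
  rw [map_sum]
  simp only [bulkT_zero_one_tens_psi hS hg hm, map_add, map_smul, tens_add_left,
    tens_smul_left, Finset.sum_add_distrib, mul_assoc, ← Finset.smul_sum]
  rw [sum_tens_psi_shift fun σ => bulkT P m lam 0 1 (f σ)]

theorem v_lift_sum_tens {m : ℕ} (X : Module.End ℂ (State N m)) (f : ZMod N → State N m) :
    v (Fin.last m) (lift X (∑ σ, tens (f σ) (psi P S (m + 1) σ))) =
      ∑ σ, tens (X (f (σ - 1))) (psi P S (m + 1) σ) := by
  rw [map_sum, map_sum]
  simp only [lift_tens, v_tens_psi]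
  exact sum_tens_psi_shift fun σ => X (f σ)

theorem L_zero_one_sum_tens (hS : IsChoice N n P S) (hg : IsGeneric N n P S) {m : ℕ}
    (hm : m + 1 ≤ n) (lam : ℂ) (f : ZMod N → State N m) :
    L P (Fin.last m) lam 0 1 (∑ σ, tens (f σ) (psi P S (m + 1) σ)) =
      ∑ σ, tens ((lam * S.r (m + 1) * om (-σ)) • f σ) (psi P S (m + 1) σ) := by
  rw [map_sum]
  simp only [L_zero_one_tens_psi hS hg hm, tens_smul_left]

theorem Solved.succ_B {M : ℕ} (h : Solved N P S M) (hS : IsChoice N n P S)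
    (hg : IsGeneric N n P S) (hM : M + 2 ≤ n) (ρ' : Fin (M + 2) → ZMod N) (lam : ℂ) :
    bulkT P (M + 2) lam 0 1 (Psi P S (M + 2) ρ') = eigM S ρ' lam • Psi P S (M + 2) ρ' := by
  have hk := Finset.mem_Icc.2 ⟨Nat.le_add_left 1 (M + 1), hM⟩
  have hk2 := Finset.mem_Icc.2 ⟨Nat.le_add_left 2 M, hM⟩
  have hb := hg.b_ne _ hk
  have hd := hg.d_ne _ hk2
  have hκ := hg.κ_ne _ hk
  have hr2 := r_ne_zero hS hg (M := M + 1) (by omega)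
  have hR2 := R_ne_zero' hS hg (M := M + 1) (s := 0) (by omega) (by omega)
  have hrt := rt_ne_zero hS hg (M := M) (by omega)
  have hrt2 := rt_ne_zero hS hg (M := M + 1) (by omega)
  have hpκ := prod_κ_ne_zero hg (M := M + 1) (by omega)
  set q : ZMod N → (Fin (M + 1) → ZMod N) → ℂ := fun σ ρ => bulkQ P S (M + 1) ρ σ ρ' with hq
  have hcomb := fun σ => h.combination hS hg (by omega) (q := q σ)
    -- The v in L₁₁ carries the component at σ - 1 to σ.
    (q' := fun ρ => P.b (M + 2) * P.d (M + 2) / P.κ (M + 2) * q (σ - 1) ρ)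
    (s := S.r (M + 2) * om (-σ)) (t := P.a (M + 2) * P.c (M + 2))
    (h0 := S.R (M + 2) 0 * om (-ρ' 0)) (Fin.tail ρ')
    -- Lowest order in λ: the recursion of w at p̃_m in the variable σ.
    (fun ρ => by
      rw [R_zero_mul_prod_neg_zeroB, R_zero_mul_prod_neg_zeroB, hq]
      simp only
      rw [bulkQ_sub_one hS hg hM, pTilde, show M + 2 - 1 = M + 1 by omega]
      simp only [om_sub, om_neg]
      have h1 := om_ne_zero (∑ s, ρ s)
      have h2 := om_ne_zero (∑ s, ρ' s)
      have h3 := om_ne_zero σ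
      field_simp
      ring)
    -- Highest order in λ: the recursion of w at p_{m,0} in the variable ρ_{m-1,0}.
    (fun ρ => by
      rw [hq]
      simp only
      rw [bulkQ_sub_single_zero hS hg hM, pZero, show M + 2 - 1 = M + 1 by omega]
      simp only [om_sub, om_neg]
      have h1 := om_ne_zero (ρ 0)
      have h2 := om_ne_zero (ρ' 0)
      have h3 := om_ne_zero σ
      field_simp
      ring)
    (fun ρ k => by
      have h0 := bulkQ_sub_single_succ (P := P) (S := S) ρ σ ρ' k
      rw [mul_assoc, hq]
      simp only
      rw [h0, om_sub, om_neg, om_neg]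
      have h2 := om_ne_zero (ρ' 0)
      have h3 := om_ne_zero σ
      field_simp)
    lam
  rw [Psi_succ, bulkT_zero_one_sum_tens hS hg hM, Finset.smul_sum]
  refine Finset.sum_congr rfl fun σ _ => ?_
  have hsplit : ∑ ρ, (lam * (P.a (M + 2) * P.c (M + 2)) * q σ ρ +
        P.b (M + 2) * P.d (M + 2) / P.κ (M + 2) * q (σ - 1) ρ) • Psi P S (M + 1) ρ =
      (lam * (P.a (M + 2) * P.c (M + 2))) • (∑ ρ, q σ ρ • Psi P S (M + 1) ρ) +
      (P.b (M + 2) * P.d (M + 2) / P.κ (M + 2)) •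
        (∑ ρ, q (σ - 1) ρ • Psi P S (M + 1) ρ) := by
    simp only [add_smul, mul_smul, Finset.sum_add_distrib, Finset.smul_sum]
  have hc := hcomb σ
  rw [hsplit] at hc
  rw [← tens_smul_left]
  refine congrArg (fun f => tens f (psi P S (M + 2) σ)) (hc.trans ?_)
  rw [eigM]
  congr 1
  ring

theorem Solved.succ_A {M : ℕ} (h : Solved N P S M) (hS : IsChoice N n P S)
    (hg : IsGeneric N n P S) (hM : M + 2 ≤ n) (ρ' : Fin (M + 2) → ZMod N) (k : Fin (M + 1)) :
    bulkT P (M + 2) (zeroB S (Fin.tail ρ') k) 0 0 (Psi P S (M + 2) ρ') =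
      phi P S (M + 1) (Fin.tail ρ') k • Psi P S (M + 2) (ρ' + Pi.single k.succ 1) := by
  have hk := Finset.mem_Icc.2 ⟨Nat.le_add_left 1 (M + 1), hM⟩
  have hr2 := r_ne_zero hS hg (M := M + 1) (by omega)
  set z := zeroB S (Fin.tail ρ') k with hz
  have hz0 : z ≠ 0 := zeroB_ne_zero hS hg (by omega) _ k
  have hB : bulkT P (M + 2) z 0 1 (Psi P S (M + 2) ρ') = 0 := by
    rw [h.succ_B hS hg hM, eigM, Finset.prod_eq_zero (Finset.mem_univ k) (sub_self _), mul_zero,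
      zero_smul]
  have hab : P.a (M + 1 + 1) ^ N ≠ P.b (M + 1 + 1) ^ N := by
    rw [← sub_ne_zero, ← hS.site _ hk]
    exact pow_ne_zero _ hr2
  -- Both sides are compared after applying L₀₁(λ), which is injective because a^N - b^N = r^N ≠ 0.
  refine L_zero_one_injective P (Fin.last (M + 1)) hz0 (by rwa [Fin.val_last]) ?_
  have hel := congrArg (fun X => X (Psi P S (M + 2) ρ'))
    (L_zero_one_mul_bulkT (N := N) P (M + 1) z (hg.κ_ne _ hk))
  simp only [LinearMap.sub_apply, Module.End.mul_apply, LinearMap.smul_apply] at hel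
  rw [hB, map_zero, zero_sub] at hel
  refine hel.trans ?_
  rw [Psi_succ, Psi_succ, v_lift_sum_tens, map_smul, L_zero_one_sum_tens hS hg hM,
    Finset.smul_sum, Finset.smul_sum, ← Finset.sum_neg_distrib]
  refine Finset.sum_congr rfl fun σ _ => ?_
  rw [← tens_smul_left, ← tens_smul_left, ← neg_one_smul ℂ, ← tens_smul_left]
  refine congrArg (fun f => tens f (psi P S (M + 2) σ)) ?_
  rw [map_sum, Finset.smul_sum, Finset.smul_sum, Finset.smul_sum, Finset.smul_sum]
  refine Finset.sum_congr rfl fun ρ _ => ?_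
  rw [map_smul, h.B]
  simp only [smul_smul]
  congr 1
  -- The product of differences in the eigenvalue of the shorter B is the one that K acquires when
  -- ρ'_k is raised; it is abstracted as `X` below, and the remaining constants form `phi`.
  rw [hz, eigM_at_zeroB hS hg (by omega), bulkQ_add_single_right hS hg hM, ← hz, phi, ← hz,
    Finset.prod_div_distrib, prod_Icc_one,
    show M + 1 - 1 = M by omega, sum_eq_head_add_tail ρ']
  have hY : ∏ l : Fin M, S.yy (M + 1 + 1) (k + 1) (M + 1) (l + 1) ≠ 0 :=
    prod_ne_zero fun l => (regular_cross hS hg (by omega) k l).2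
  generalize ∏ l : Fin M, (1 - om (Fin.tail ρ l - Fin.tail ρ' k) *
    (S.R (M + 2) (k + 1) / S.R (M + 1) (l + 1))) = X
  simp only [om_add, om_sub, om_neg]
  have h1 := om_ne_zero (∑ s, ρ s)
  have h2 := om_ne_zero (∑ j, Fin.tail ρ' j)
  have h3 := om_ne_zero σ
  have h4 := om_ne_zero (ρ' 0)
  have h5 := om_ne_zero (1 : ZMod N)
  field_simp

theorem solved (hS : IsChoice N n P S) (hg : IsGeneric N n P S) (M : ℕ) (hM : M + 1 ≤ n) :
    Solved N P S M := by
  induction M with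
  | zero => exact solved_zero hS hg hM
  | succ M ih =>
    have h := ih (by omega)
    exact ⟨h.succ_B hS hg hM, h.succ_A hS hg hM⟩

end

/-! ### Independence of the eigenvectors -/

/-- The other summands are removed one at a time by applying B x - χ_j(x), with x chosen to separate
i from j, so that the coefficient of f_i stays nonzero. -/
theorem eq_zero_of_sum_eq_zero {ι E κ : Type*} [Fintype ι] [AddCommGroup E] [Module ℂ E]
    (B : κ → Module.End ℂ E) {f : ι → E} {χ : ι → κ → ℂ} (hB : ∀ x i, B x (f i) = χ i x • f i)
    (hχ : ∀ i j, i ≠ j → ∃ x, χ i x ≠ χ j x) (hsum : ∑ i, f i = 0) (i : ι) : f i = 0 := by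
  classical
  have key : ∀ s : Finset ι, i ∉ s →
      ∃ c : ι → ℂ, c i ≠ 0 ∧ (∀ j ∈ s, c j = 0) ∧ ∑ k, c k • f k = 0 := by
    intro s
    induction s using Finset.induction_on with
    | empty => exact fun _ => ⟨fun _ => 1, one_ne_zero, by simp, by simpa using hsum⟩
    | insert j s hj ih =>
      intro hi
      rw [Finset.mem_insert, not_or] at hi
      obtain ⟨c, hci, hcs, hc⟩ := ih hi.2
      obtain ⟨x, hx⟩ := hχ i j hi.1
      refine ⟨fun k => (χ k x - χ j x) * c k, mul_ne_zero (sub_ne_zero.2 hx) hci, ?_, ?_⟩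
      · intro k hk
        rcases Finset.mem_insert.1 hk with rfl | hk
        · simp
        · simp [hcs k hk]
      · have h := congrArg (B x) hc
        rw [map_sum, map_zero] at h
        simp only [map_smul, hB] at h
        simp only [sub_mul, sub_smul, Finset.sum_sub_distrib, mul_smul, ← Finset.smul_sum, hc,
          smul_zero, sub_zero]
        rw [← h]
        exact Finset.sum_congr rfl fun k _ => smul_comm _ _ _
  obtain ⟨c, hci, hcs, hc⟩ := key (Finset.univ.erase i) (by simp)
  rw [Finset.sum_eq_single i (fun j _ hj => by rw [hcs j (by simp [hj]), zero_smul])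
    (by simp)] at hc
  exact (smul_eq_zero.1 hc).resolve_left hci

section

variable {n : ℕ} {P : Params} {S : Roots}

theorem eigM_zero_iff (hS : IsChoice N n P S) (hg : IsGeneric N n P S) {M : ℕ} (hM : M + 1 ≤ n)
    (ρ : Fin (M + 1) → ZMod N) {lam : ℂ} (hlam : lam ≠ 0) :
    eigM S ρ lam = 0 ↔ ∃ j, lam = zeroB S (Fin.tail ρ) j := by
  have hR := R_ne_zero' hS hg (M := M) (s := 0) (by omega) (by omega)
  simp [eigM, hlam, hR, om_ne_zero, Finset.prod_eq_zero_iff, sub_eq_zero]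

theorem eigM_separates (hS : IsChoice N n P S) (hg : IsGeneric N n P S) {M : ℕ} (hM : M + 1 ≤ n)
    (ρ ρ' : Fin (M + 1) → ZMod N) (h : ρ ≠ ρ') : ∃ lam, eigM S ρ lam ≠ eigM S ρ' lam := by
  by_contra! hall
  have hz := zeroB_ne_zero hS hg (M := M) (by omega)
  have htail : Fin.tail ρ = Fin.tail ρ' := by
    funext j
    have h0 := (eigM_zero_iff hS hg hM ρ (hz (Fin.tail ρ) j)).2 ⟨j, rfl⟩
    rw [hall] at h0
    obtain ⟨l, hl⟩ := (eigM_zero_iff hS hg hM ρ' (hz (Fin.tail ρ) j)).1 h0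
    by_cases hjl : j = l
    · subst hjl
      have hR : S.R (M + 1) (j + 1) ≠ 0 := R_ne_zero' hS hg (by omega) (by omega)
      rw [zeroB, zeroB] at hl
      exact neg_injective (om_injective (mul_left_cancel₀ (neg_ne_zero.2 hR) hl))
    · exact absurd hl (zeroB_ne hg hM _ _ hjl)
  -- The zeros have fixed the labels of index ≥ 1; ρ_0 is then read off from the eigenvalue at any
  -- point where it does not vanish.
  obtain ⟨lam, hlam⟩ := Infinite.exists_notMem_finset
    (insert 0 (Finset.univ.image (zeroB S (Fin.tail ρ))))
  simp only [Finset.mem_insert, Finset.mem_image, Finset.mem_univ, true_and, not_or,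
    not_exists] at hlam
  have hR := R_ne_zero' hS hg (M := M) (s := 0) (by omega) (by omega)
  have hp : ∏ j, (lam - zeroB S (Fin.tail ρ) j) ≠ 0 :=
    prod_ne_zero fun j => sub_ne_zero.2 fun h => hlam.2 j h.symm
  have he := hall lam
  rw [eigM, eigM, ← htail] at he
  have h0 : ρ 0 = ρ' 0 := neg_injective (om_injective
    (mul_left_cancel₀ (mul_ne_zero hlam.1 hR) (mul_right_cancel₀ hp he)))
  refine h (funext fun i => ?_)
  refine Fin.cases h0 (fun j => ?_) i
  exact congrFun htail j

theorem eq_zero_of_sum_smul_Psi (hS : IsChoice N n P S) (hg : IsGeneric N n P S) {M : ℕ}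
    (hM : M + 1 ≤ n) {q : (Fin (M + 1) → ZMod N) → ℂ} (hsum : ∑ ρ, q ρ • Psi P S (M + 1) ρ = 0)
    (ρ : Fin (M + 1) → ZMod N) : q ρ • Psi P S (M + 1) ρ = 0 :=
  eq_zero_of_sum_eq_zero (fun lam => bulkT P (M + 1) lam 0 1) (χ := eigM S)
    (fun lam ρ => by rw [map_smul, (solved hS hg M hM).B, smul_comm])
    (eigM_separates hS hg hM) hsum ρ

theorem eq_zero_of_sum_tens_psi (hS : IsChoice N n P S) (hg : IsGeneric N n P S) {M : ℕ}
    (hM : M + 1 ≤ n) {f : ZMod N → State N M} (hsum : ∑ σ, tens (f σ) (psi P S (M + 1) σ) = 0)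
    (σ : ZMod N) : f σ = 0 := by
  have hr := r_ne_zero hS hg (M := M) (by omega)
  have h := eq_zero_of_sum_eq_zero (fun _ : Unit => L P (Fin.last M) 1 0 1)
    (χ := fun σ _ => 1 * S.r (M + 1) * om (-σ))
    (fun _ σ => L_zero_one_tens_psi hS hg hM 1 (f σ) σ)
    (fun i j hij => ⟨(), fun h => hij (neg_injective (om_injective
      (mul_left_cancel₀ (mul_ne_zero one_ne_zero hr) h)))⟩) hsum σ
  funext γ
  have h1 := congrFun h (Fin.snoc γ σ)
  simpa [tens, psi_apply, w_zero] using h1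

/-- If Ψ vanished, independence of the ψ_σ and then of the shorter eigenvectors would isolate a
single term Q·Ψ, a product of nonzero factors. -/
theorem Psi_ne_zero (hS : IsChoice N n P S) (hg : IsGeneric N n P S) (M : ℕ) (hM : M + 1 ≤ n)
    (ρ : Fin (M + 1) → ZMod N) : Psi P S (M + 1) ρ ≠ 0 := by
  induction M with
  | zero =>
    intro h
    have h1 := congrFun h ρ
    rw [Psi_one] at h1
    simp [tens, psi_apply, w_zero] at h1
  | succ M ih =>
    intro h
    rw [Psi_succ] at h
    have h1 := eq_zero_of_sum_tens_psi hS hg hM h 0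
    have h2 := eq_zero_of_sum_smul_Psi hS hg (by omega) h1 0
    exact (smul_ne_zero (bulkQ_ne_zero hS hg hM _ _ _) (ih (by omega) 0)) h2

/-! ### The boundary site -/

theorem QB_eq (M : ℕ) (g0 g1 : ZMod N) (ρ ρ' : Fin (M + 1) → ZMod N) :
    QB P S (M + 1) g0 g1 ρ ρ' = om ((g0 + 1 - ∑ s, ρ s) * (∑ k, ρ' k - 1)) /
      w (pZeroBdry P S (M + 1)) (g1 - ∑ k, ρ' k - ρ 0) * kernelK P S M (Fin.tail ρ) ρ' := by
  rw [QB, coreQ_eq, bdryLabel, Fin.tail_cons]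

theorem QB_ne_zero {M : ℕ} (hS : IsChoice N (M + 1) P S) (hg : IsGeneric N (M + 1) P S)
    (g0 g1 : ZMod N) (ρ ρ' : Fin (M + 1) → ZMod N) : QB P S (M + 1) g0 g1 ρ ρ' ≠ 0 := by
  rw [QB_eq]
  exact mul_ne_zero (div_ne_zero (om_ne_zero _) ((regular_pZeroBdry hS hg).w_ne_zero _))
    (kernelK_ne_zero hS hg le_rfl _ _)

theorem PsiB_ne_zero {M : ℕ} (hS : IsChoice N (M + 1) P S) (hg : IsGeneric N (M + 1) P S)
    (g0 g1 : ZMod N) (ρ' : Fin (M + 1) → ZMod N) : PsiB P S (M + 1) g0 g1 ρ' ≠ 0 := fun h =>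
  smul_ne_zero (QB_ne_zero hS hg g0 g1 0 ρ') (Psi_ne_zero hS hg M le_rfl 0)
    (eq_zero_of_sum_smul_Psi hS hg le_rfl h 0)

theorem QB_sub_single_zero {M : ℕ} (hS : IsChoice N (M + 1) P S) (hg : IsGeneric N (M + 1) P S)
    (g0 g1 : ZMod N) (ρ ρ' : Fin (M + 1) → ZMod N) :
    QB P S (M + 1) g0 g1 (ρ - Pi.single 0 1) ρ' = QB P S (M + 1) g0 g1 ρ ρ' *
      (om (∑ k, ρ' k - 1) * ((1 - om (g1 - ∑ k, ρ' k - ρ 0 + 1) * (pZeroBdry P S (M + 1)).1) /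
        (pZeroBdry P S (M + 1)).2)) := by
  have hreg := regular_pZeroBdry hS hg
  have h1 := hreg.2
  have h2 := hreg.one_sub_ne_zero (g1 - ∑ k, ρ' k - ρ 0 + 1)
  have h3 := hreg.w_ne_zero (g1 - ∑ k, ρ' k - ρ 0)
  rw [QB_eq, QB_eq, sum_sub_single, tail_sub_single_zero, Pi.sub_apply, Pi.single_eq_same,
    show g1 - ∑ k, ρ' k - (ρ 0 - 1) = g1 - ∑ k, ρ' k - ρ 0 + 1 by ring, hreg.w_add_one,
    show (g0 + 1 - (∑ s, ρ s - 1)) * (∑ k, ρ' k - 1) =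
      (g0 + 1 - ∑ s, ρ s) * (∑ k, ρ' k - 1) + (∑ k, ρ' k - 1) by ring, om_add]
  field_simp

theorem QB_sub_single_succ {M : ℕ} (g0 g1 : ZMod N) (ρ ρ' : Fin (M + 1) → ZMod N) (k : Fin M) :
    QB P S (M + 1) g0 g1 (ρ - Pi.single k.succ 1) ρ' * kernelK P S M (Fin.tail ρ) ρ' =
      om (∑ k, ρ' k - 1) * kernelK P S M (Fin.tail ρ - Pi.single k 1) ρ' *
        QB P S (M + 1) g0 g1 ρ ρ' := by
  rw [QB_eq, QB_eq, sum_sub_single, tail_sub_single, Pi.sub_apply,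
    Pi.single_eq_of_ne (Fin.succ_ne_zero k).symm, sub_zero,
    show (g0 + 1 - (∑ s, ρ s - 1)) * (∑ k, ρ' k - 1) =
      (g0 + 1 - ∑ s, ρ s) * (∑ k, ρ' k - 1) + (∑ k, ρ' k - 1) by ring, om_add]
  ring

/-- A_n + c_{n+1}ω^{γ_{n+1}}B_n is the operator to which both A_{n+1} and B_{n+1} reduce at fixed
boundary spin. It is the case s = 1, q' = 0 of `Solved.combination`. -/
theorem zero_zero_add_zero_one_PsiB {M : ℕ} (hS : IsChoice N (M + 1) P S)
    (hg : IsGeneric N (M + 1) P S) (g0 g1 : ZMod N) (ρ' : Fin (M + 1) → ZMod N) (lam : ℂ) :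
    lam • (bulkT P (M + 1) lam 0 0 (PsiB P S (M + 1) g0 g1 ρ') +
      (P.c (M + 2) * om g1) • bulkT P (M + 1) lam 0 1 (PsiB P S (M + 1) g0 g1 ρ')) =
      (lam * (S.R (M + 2) 0 * om (-bdryLabel g0 ρ' 0) * om g0 / P.a0 *
        ∏ k, (lam - zeroB S ρ' k))) • PsiB P S (M + 1) g0 g1 ρ' := by
  have ha0 := hg.a0_ne
  have hR := R_bdry_ne_zero hS hg (s := 0) (by omega)
  have hpκ := prod_κ_ne_zero hg (M := M + 1) le_rfl
  have hb : bdryLabel g0 ρ' 0 = g0 + 1 - ∑ k, ρ' k := rfl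
  have hsum : ∑ s, bdryLabel g0 ρ' s = g0 + 1 := by
    rw [sum_eq_head_add_tail, hb, bdryLabel, Fin.tail_cons, sub_add_cancel]
  have hprod := R_zero_mul_prod_neg_zeroB (S := S) (bdryLabel g0 ρ')
  -- As q' = 0, the lowest-order condition requires the constant term of the eigenvalue to be
  -- exactly 1. The phase r̃_{n+1} = ω a_0 and the label sum γ_0 + 1 ensure this.
  rw [hsum, hS.rt_bdry, show Fin.tail (bdryLabel g0 ρ') = ρ' from Fin.tail_cons _ _] at hprod
  have hr : S.r (M + 2) = P.a0 := hS.site_bdry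
  have hcomb := (solved hS hg M le_rfl).combination hS hg le_rfl
    (q := fun ρ => QB P S (M + 1) g0 g1 ρ ρ') (q' := fun _ => 0) (s := 1)
    (t := P.c (M + 2) * om g1)
    (h0 := S.R (M + 2) 0 * om (-bdryLabel g0 ρ' 0) * om g0 / P.a0) ρ'
    (fun ρ => by
      rw [mul_zero, add_zero]
      congr 1
      rw [div_mul_eq_mul_div, mul_right_comm, hprod, om_neg, om_add]
      have h1 := om_ne_zero g0
      have h2 := om_ne_zero (1 : ZMod N)
      field_simp)
    (fun ρ => by
      rw [QB_sub_single_zero hS hg, pZeroBdry, hb]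
      simp only [om_sub, om_neg, om_add]
      have h1 := om_ne_zero g0
      have h2 := om_ne_zero (1 : ZMod N)
      have h3 := om_ne_zero g1
      have h4 := om_ne_zero (∑ k, ρ' k)
      have h5 := om_ne_zero (ρ 0)
      field_simp
      ring)
    (fun ρ k => by
      rw [one_mul, QB_sub_single_succ, hr, hb]
      simp only [om_sub, om_neg, om_add]
      have h1 := om_ne_zero g0
      have h2 := om_ne_zero (1 : ZMod N)
      have h4 := om_ne_zero (∑ k, ρ' k)
      field_simp)
    lam
  refine Eq.trans ?_ hcomb
  rw [mul_one, smul_add, PsiB]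
  congr 1
  simp only [add_zero, mul_smul, ← Finset.smul_sum, map_smul]

/-- The eigenvalue of B_n at ωλ_k supplies the factor by which K changes when ρ'_k goes from its
lowered value back to ρ'_k. What remains is the shift of ρ_{n,0}, that is, the translation of all
spins. -/
theorem zero_one_PsiB_sub_single {M : ℕ} (hS : IsChoice N (M + 1) P S)
    (hg : IsGeneric N (M + 1) P S) (g0 g1 : ZMod N) (ρ' : Fin (M + 1) → ZMod N)
    (k : Fin (M + 1)) :
    bulkT P (M + 1) (om (1 : ZMod N) * zeroB S ρ' k) 0 1 (PsiB P S (M + 1) g0 g1 (ρ' - Pi.single k 1)) =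
      (zeroB S ρ' k * rt S (M + 1) * om (1 - g0 - ∑ j, ρ' j) *
        ∏ l : Fin M, S.yy (M + 2) (k + 1) (M + 1) (l + 1)) •
        shift (M + 1) (PsiB P S (M + 1) g0 g1 ρ') := by
  rw [PsiB, PsiB, map_sum, map_sum]
  simp only [map_smul, shift_Psi]
  rw [sum_smul_shift, Finset.smul_sum]
  refine Finset.sum_congr rfl fun ρ _ => ?_
  rw [(solved hS hg M le_rfl).B, smul_smul, smul_smul, ← zeroB_sub_single_self,
    eigM_at_zeroB hS hg le_rfl, zeroB_sub_single_self]
  congr 1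
  have hK := kernelK_add_single_right hS hg le_rfl (Fin.tail ρ) (ρ' - Pi.single k 1) k
  rw [sub_add_cancel, Finset.prod_div_distrib] at hK
  have hY : ∏ l : Fin M, S.yy (M + 2) (k + 1) (M + 1) (l + 1) ≠ 0 :=
    prod_ne_zero fun l => (regular_cross hS hg le_rfl k l).2
  rw [QB_eq, QB_eq, tail_sub_single_zero, hK, sum_sub_single, sum_sub_single, Pi.sub_apply ρ,
    Pi.single_eq_same,
    show g1 - (∑ k, ρ' k - 1) - ρ 0 = g1 - ∑ k, ρ' k - (ρ 0 - 1) by ring,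
    show (g0 + 1 - ∑ s, ρ s) * (∑ k, ρ' k - 1 - 1) =
      (g0 + 1 - (∑ s, ρ s - 1)) * (∑ k, ρ' k - 1) + (∑ s, ρ s - g0 - ∑ k, ρ' k) by ring, om_add]
  generalize ∏ l : Fin M, (1 - om (Fin.tail ρ l -
    (ρ' - Pi.single k 1 : Fin (M + 1) → ZMod N) k) * (S.R (M + 2) (k + 1) / S.R (M + 1) (l + 1))) = X
  simp only [om_sub (1 - g0), om_sub (∑ s, ρ s - g0), om_sub (∑ s, ρ s) g0, om_sub 1 g0, om_neg]
  have h1 := om_ne_zero g0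
  have h2 := om_ne_zero (1 : ZMod N)
  have h4 := om_ne_zero (∑ k, ρ' k)
  have h5 := om_ne_zero (∑ k, ρ k)
  field_simp

theorem one_zero_add_one_one_PsiB {M : ℕ} (hS : IsChoice N (M + 1) P S)
    (hg : IsGeneric N (M + 1) P S) (g0 g1 : ZMod N) (ρ' : Fin (M + 1) → ZMod N)
    (k : Fin (M + 1)) :
    bulkT P (M + 1) (zeroB S ρ' k) 1 0 (PsiB P S (M + 1) g0 g1 ρ') +
      (P.c (M + 2) * om g1) • bulkT P (M + 1) (zeroB S ρ' k) 1 1 (PsiB P S (M + 1) g0 g1 ρ') =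
      (-(∏ s ∈ Finset.Icc 1 (M + 1), F N P s (zeroB S ρ' k)) /
        (zeroB S ρ' k * rt S (M + 1) * om (1 - g0 - ∑ j, ρ' j) *
          ∏ l : Fin M, S.yy (M + 2) (k + 1) (M + 1) (l + 1))) •
        PsiB P S (M + 1) g0 g1 (ρ' - Pi.single k 1) := by
  have hz : zeroB S ρ' k ≠ 0 := zeroB_ne_zero hS hg le_rfl _ _
  have hB := zero_one_PsiB_sub_single hS hg g0 g1 ρ' k
  -- ωλ_k is the k-th zero for the lowered label, so there A_n can be traded for B_n inside the
  -- quantum determinant.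
  have hX := zero_zero_add_zero_one_PsiB hS hg g0 g1 (ρ' - Pi.single k 1) (om (1 : ZMod N) * zeroB S ρ' k)
  rw [← zeroB_sub_single_self, Finset.prod_eq_zero (Finset.mem_univ k) (sub_self _), mul_zero,
    mul_zero, zero_smul, zeroB_sub_single_self] at hX
  have hX' := (smul_eq_zero.1 hX).resolve_left (mul_ne_zero (om_ne_zero _) hz)
  have hdet := congrArg (fun X => X (PsiB P S (M + 1) g0 g1 (ρ' - Pi.single k 1)))
    (quantum_det (N := N) P (M + 1) (zeroB S ρ' k) hg.κ_ne)
  obtain ⟨hC, hD⟩ := bulkT_mul_shift (N := N) P (M + 1) (zeroB S ρ' k)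
  have hC' := congrArg (fun X => X (PsiB P S (M + 1) g0 g1 ρ')) hC
  have hD' := congrArg (fun X => X (PsiB P S (M + 1) g0 g1 ρ')) hD
  simp only [LinearMap.sub_apply, Module.End.mul_apply, LinearMap.smul_apply] at hdet hC' hD'
  rw [eq_neg_of_add_eq_zero_left hX', hB] at hdet
  simp only [map_neg, map_smul, hC', hD'] at hdet
  set ck := zeroB S ρ' k * rt S (M + 1) * om (1 - g0 - ∑ j, ρ' j) *
          ∏ l : Fin M, S.yy (M + 2) (k + 1) (M + 1) (l + 1) with hck
  have hck0 : ck ≠ 0 := mul_ne_zero (mul_ne_zero (mul_ne_zero hz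
    (rt_ne_zero hS hg (M := M) (by omega))) (om_ne_zero _))
    (prod_ne_zero fun l => (regular_cross hS hg le_rfl k l).2)
  -- Moving the translation to the left past C_n costs ω, past D_n nothing; this turns the weights
  -- of the determinant into C_n + c_{n+1}ω^{γ_{n+1}}D_n, and the translation then cancels.
  apply shift_injective
  rw [map_add, map_smul, map_smul]
  have hω := om_ne_zero (1 : ZMod N)
  generalize shift (M + 1) (bulkT P (M + 1) (zeroB S ρ' k) 1 0 (PsiB P S (M + 1) g0 g1 ρ')) = x
    at hdet ⊢
  generalize shift (M + 1) (bulkT P (M + 1) (zeroB S ρ' k) 1 1 (PsiB P S (M + 1) g0 g1 ρ')) = y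
    at hdet ⊢
  generalize shift (M + 1) (PsiB P S (M + 1) g0 g1 (ρ' - Pi.single k 1)) = q at hdet ⊢
  funext γ
  have h := congrFun hdet γ
  simp only [Pi.add_apply, Pi.sub_apply, Pi.neg_apply, Pi.smul_apply, smul_eq_mul] at h ⊢
  refine mul_left_cancel₀ (mul_ne_zero hω hck0) ?_
  have he := mul_div_cancel₀ (-(∏ s ∈ Finset.Icc 1 (M + 1), F N P s (zeroB S ρ' k))) hck0
  linear_combination h - om (1 : ZMod N) * q γ * he

/-! ### The boundary operators on vectors of fixed boundary spin -/

theorem withSpin_injective {m : ℕ} (g1 : ZMod N) :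
    Function.Injective (withSpin (n := m) g1) := by
  intro f f' h
  funext γ
  have h1 := congrFun h (Fin.snoc γ g1)
  simpa [withSpin, tens, ket] using h1

theorem u_last_withSpin {m : ℕ} (g1 : ZMod N) (f : State N m) :
    u (Fin.last m) (withSpin g1 f) = om g1 • withSpin g1 f := by
  funext γ
  rw [u_apply, Pi.smul_apply, smul_eq_mul, withSpin, tens, ket]
  by_cases h : γ (Fin.last m) = g1
  · rw [h]
  · rw [Pi.single_eq_of_ne h, mul_zero, mul_zero, mul_zero]

theorem uInv_last_withSpin {m : ℕ} (g1 : ZMod N) (f : State N m) :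
    uInv (Fin.last m) (withSpin g1 f) = om (-g1) • withSpin g1 f := by
  funext γ
  rw [uInv_apply, Pi.smul_apply, smul_eq_mul, withSpin, tens, ket]
  by_cases h : γ (Fin.last m) = g1
  · rw [h]
  · rw [Pi.single_eq_of_ne h, mul_zero, mul_zero, mul_zero]

theorem lift_withSpin {m : ℕ} (X : Module.End ℂ (State N m)) (g1 : ZMod N) (f : State N m) :
    lift X (withSpin g1 f) = withSpin g1 (X f) := lift_tens X f _

theorem withSpin_smul {m : ℕ} (g1 : ZMod N) (c : ℂ) (f : State N m) :
    withSpin g1 (c • f) = c • withSpin g1 f := tens_smul_left c f _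

theorem withSpin_add {m : ℕ} (g1 : ZMod N) (f f' : State N m) :
    withSpin g1 (f + f') = withSpin g1 f + withSpin g1 f' := tens_add_left f f' _

theorem monodromy_apply (P : Params) (n : ℕ) (g0 g1 : ZMod N) (lam : ℂ) (i : Fin 2) :
    monodromy P n g0 g1 lam i 0 = lift (bulkT P n lam i 0) +
      lift (bulkT P n lam i 1) * P.c (n + 1) • u (Fin.last n) ∧
    monodromy P n g0 g1 lam i 1 =
      lift (bulkT P n lam i 0) * (lam * P.a0 * om (g1 - g0)) • uInv (Fin.last n) +
      lift (bulkT P n lam i 1) * (lam * P.a0 * P.c (n + 1) * om (g1 - g0)) • 1 := by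
  rw [monodromy, prod_L_castSucc]
  constructor <;> simp [Matrix.mul_apply, LBdry]

theorem monodromy_zero_withSpin (P : Params) (n : ℕ) (g0 g1 : ZMod N) (lam : ℂ) (i : Fin 2)
    (f : State N n) : monodromy P n g0 g1 lam i 0 (withSpin g1 f) =
      withSpin g1 (bulkT P n lam i 0 f + (P.c (n + 1) * om g1) • bulkT P n lam i 1 f) := by
  rw [(monodromy_apply P n g0 g1 lam i).1, LinearMap.add_apply, Module.End.mul_apply,
    LinearMap.smul_apply, u_last_withSpin, map_smul, map_smul, lift_withSpin, lift_withSpin,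
    withSpin_add, withSpin_smul, mul_smul]

/-- L_{n+1} is degenerate: at fixed boundary spin its second column is λa_0ω^{-γ_0} times the first.
-/
theorem monodromy_one_withSpin (P : Params) (n : ℕ) (g0 g1 : ZMod N) (lam : ℂ) (i : Fin 2)
    (f : State N n) : monodromy P n g0 g1 lam i 1 (withSpin g1 f) = (lam * P.a0 * om (-g0)) •
      withSpin g1 (bulkT P n lam i 0 f + (P.c (n + 1) * om g1) • bulkT P n lam i 1 f) := by
  rw [(monodromy_apply P n g0 g1 lam i).2, LinearMap.add_apply, Module.End.mul_apply,
    Module.End.mul_apply, LinearMap.smul_apply, LinearMap.smul_apply, uInv_last_withSpin,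
    Module.End.one_apply, map_smul, map_smul, map_smul, lift_withSpin, lift_withSpin,
    withSpin_add, withSpin_smul, smul_add, smul_smul, smul_smul]
  have h := om_ne_zero g1
  congr 2
  · rw [om_sub, om_neg, om_neg]
    field_simp
  · rw [om_sub, om_neg]
    ring

theorem opB_PsiB {M : ℕ} (hS : IsChoice N (M + 1) P S) (hg : IsGeneric N (M + 1) P S)
    (g0 g1 : ZMod N) (ρ' : Fin (M + 1) → ZMod N) (lam : ℂ) :
    opB P (M + 1) g0 g1 lam (withSpin g1 (PsiB P S (M + 1) g0 g1 ρ')) =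
      eigB S g0 ρ' lam • withSpin g1 (PsiB P S (M + 1) g0 g1 ρ') := by
  have ha0 := hg.a0_ne
  have hω := om_ne_zero g0
  rw [opB, monodromy_one_withSpin, show lam * P.a0 * om (-g0) = P.a0 * om (-g0) * lam by ring,
    mul_smul, ← withSpin_smul, zero_zero_add_zero_one_PsiB hS hg, withSpin_smul, smul_smul]
  congr 1
  rw [eigB]
  simp only [zeroB, neg_mul, sub_neg_eq_add]
  rw [om_neg g0]
  field_simp

theorem opA_PsiB {M : ℕ} (hS : IsChoice N (M + 1) P S) (hg : IsGeneric N (M + 1) P S)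
    (g0 g1 : ZMod N) (ρ' : Fin (M + 1) → ZMod N) (k : Fin (M + 1)) :
    opA P (M + 1) g0 g1 (zeroB S ρ' k) (withSpin g1 (PsiB P S (M + 1) g0 g1 ρ')) = 0 := by
  have hX := zero_zero_add_zero_one_PsiB hS hg g0 g1 ρ' (zeroB S ρ' k)
  rw [Finset.prod_eq_zero (Finset.mem_univ k) (sub_self _), mul_zero, mul_zero, zero_smul] at hX
  rw [opA, monodromy_zero_withSpin,
    (smul_eq_zero.1 hX).resolve_left (zeroB_ne_zero hS hg le_rfl _ _)]
  funext γ
  simp [withSpin, tens]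

theorem opD_PsiB {M : ℕ} (hS : IsChoice N (M + 1) P S) (hg : IsGeneric N (M + 1) P S)
    (g0 g1 : ZMod N) (ρ' : Fin (M + 1) → ZMod N) (k : Fin (M + 1)) :
    opD P (M + 1) g0 g1 (zeroB S ρ' k) (withSpin g1 (PsiB P S (M + 1) g0 g1 ρ')) =
      phiTilde P S ρ' k • withSpin g1 (PsiB P S (M + 1) g0 g1 (ρ' - Pi.single k 1)) := by
  have hz : zeroB S ρ' k ≠ 0 := zeroB_ne_zero hS hg le_rfl _ _
  have hrt := rt_ne_zero hS hg (M := M) (by omega)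
  have hY : ∏ l : Fin M, S.yy (M + 2) (k + 1) (M + 1) (l + 1) ≠ 0 :=
    prod_ne_zero fun l => (regular_cross hS hg le_rfl k l).2
  have hr : S.r (M + 1 + 1) = P.a0 := hS.site_bdry
  rw [opD, monodromy_one_withSpin, one_zero_add_one_one_PsiB hS hg, withSpin_smul, smul_smul]
  congr 1
  rw [phiTilde, Nat.add_sub_cancel, prod_Icc_one (fun s => S.yy (M + 1 + 1) (k + 1) (M + 1) s), hr]
  simp only [om_sub, om_neg]
  have h1 := om_ne_zero g0
  have h2 := om_ne_zero (1 : ZMod N)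
  have h4 := om_ne_zero (∑ k, ρ' k)
  field_simp

end

end BBS

end

theorem theorem2 (N n : ℕ) [NeZero N] [NeZero n] (P : BBS.Params) (S : BBS.Roots)
    (hS : BBS.IsChoice N n P S) (hgen : BBS.IsGeneric N n P S) (g0 g1 : ZMod N) :
    (∀ (ρ' : Fin n → ZMod N) (lam : ℂ),
      (BBS.opB P n g0 g1 lam).HasEigenvector (BBS.eigB S g0 ρ' lam)
        (BBS.withSpin g1 (BBS.PsiB P S n g0 g1 ρ'))) ∧
    (∀ (ρ' : Fin n → ZMod N) (k : Fin n),
      BBS.opA P n g0 g1 (BBS.zeroB S ρ' k)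
          (BBS.withSpin g1 (BBS.PsiB P S n g0 g1 ρ')) = 0 ∧
      BBS.opD P n g0 g1 (BBS.zeroB S ρ' k)
          (BBS.withSpin g1 (BBS.PsiB P S n g0 g1 ρ')) =
        BBS.phiTilde P S ρ' k •
          BBS.withSpin g1 (BBS.PsiB P S n g0 g1 (ρ' - Pi.single k 1))) := by
  obtain ⟨M, rfl⟩ := Nat.exists_eq_succ_of_ne_zero (NeZero.ne n)
  refine ⟨fun ρ' lam => ⟨Module.End.mem_eigenspace_iff.2 (BBS.opB_PsiB hS hgen g0 g1 ρ' lam),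
    fun h => BBS.PsiB_ne_zero hS hgen g0 g1 ρ' (BBS.withSpin_injective g1 (h.trans ?_))⟩,
    fun ρ' k => ⟨BBS.opA_PsiB hS hgen g0 g1 ρ' k, BBS.opD_PsiB hS hgen g0 g1 ρ' k⟩⟩
  funext γ
  simp [BBS.withSpin, BBS.tens]
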